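/- A directed social network consists of a finite set $V$ of $n$ buyers and weights $w_{ij}\ge 0$ $(i,j\in V)$ with $w_{ii}=0$; its edges are the pairs $(i,j)$ with $w_{ij}>0$. For $A\subseteq V$ and a pricing probability $p$, the influence-and-exploit strategy $\mathrm{IE}(A,p)$ gives the product for free to the buyers of $A$ and then approaches the others in uniformly random order with pricing probability $p$. Its expected revenue, in the Uniform Additive Model, is $$R_{\mathrm{IE}}(A,p)=p(1-p)\sum_{i\in V\setminus A}\Big(w_{ii}+\sum_{j\in A}w_{ji}+\sum_{j\in V\setminus A,\,j\ne i}\frac{p\,w_{ji}}{2}\Big).$$ The part extracted from the edge $(i,j)$ is $p(1-p)w_{ij}$ if $i\in A$, $j\notin A$; it is $\tfrac12p^2(1-p)w_{ij}$ if $i,j\notin A$; and it is $0$ if $j\in A$. Let (S1) be the semidefinite program of maximizing $$\tfrac{p(1-p)}{4}\sum_{i,j\in V}w_{ij}\Big(1+\tfrac p2+(1-\tfrac p2)\,v_0\cdot v_i-(1+\tfrac p2)\,v_0\cdot v_j-(1-\tfrac p2)\,v_i\cdot v_j\Big)$$ over unit vectors $v_0\in\mathbb R^{n+1}$ and $v_i\in\mathbb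 R^{n+1}$ $(i\in V)$ such that, for all $i,j\in V$, each of the numbers $$v_i\cdot v_j+v_0\cdot v_i+v_0\cdot v_j,\quad v_i\cdot v_j-v_0\cdot v_i-v_0\cdot v_j,\quad -v_i\cdot v_j-v_0\cdot v_i+v_0\cdot v_j,\quad -v_i\cdot v_j+v_0\cdot v_i-v_0\cdot v_j$$ is at least $-1$. Given $p$ and $\gamma\in[0,1]$, the algorithm SDP-IE$(p,\gamma)$ takes an optimal solution $v_0,(v_i)_{i\in V}$ of (S1) and replaces each $v_i$ by the unit vector $v_i'$ that is coplanar with $v_0$ and $v_i$, lies on the same side of $v_0$ as $v_i$, and forms with $v_0$ the angle $$f_\gamma(\theta_i)=(1-\gamma)\theta_i+\gamma\pi(1-\cos\theta_i)/2,\qquad \theta_i=\arccos(v_0\cdot v_i)$$ (so $v_i'=v_i$ if $v_i=\pm v_0$). It then draws $r$ uniformly from the unit sphere of $\mathbb R^{n+1}$ and outputs $\mathrm{IE}(A,p)$ with $A=\{i\in V:\operatorname{sgn}(v_i'\cdot r)=\operatorname{sgn}(v_0\cdot r)\}$, where $\operatorname{sgn}(x)=1$ if $x\ge0$ and $-1$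 otherwise. **Theorem.** Let $G$ be a directed social network. (a) Let $p\in[1/2,1)$. Then (S1) has an optimal solution. Moreover, for every $\gamma\in[0,1]$, whichever optimal solution $v_0,(v_i)_{i\in V}$ is taken, the expected revenue (over $r$ and the order of the buyers) that the strategy of SDP-IE$(p,\gamma)$ extracts from each edge $(i,j)$ is $$w_{ij}\,p(1-p)\,\frac{(1-\frac p2)\,\theta'_{ij}-(1-\frac p2)\,\theta'_i+(1+\frac p2)\,\theta'_j}{2\pi},$$ where $\theta'_{ij}=\arccos(v'_i\cdot v'_j)$ and $\theta'_i=\arccos(v_0\cdot v'_i)$. (b) Whichever optimal solution of (S1) with $p=2/3$ is taken, the expected revenue of the strategy of SDP-IE$(2/3,\,0.722)$ is at least $$0.9064\cdot\max_{A\subseteq V}R_{\mathrm{IE}}(A,2/3).$$ -/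

import Mathlib

open MeasureTheory
open scoped RealInnerProductSpace

noncomputable section

/-- A directed weighted social network on the buyers `V`: `weight i j` is the influence of `i` on `j`.
The edges are the pairs of positive weight; there are no loops. -/
structure DirectedNetwork (V : Type*) where
  weight : V → V → ℝ
  weight_nonneg : ∀ i j, 0 ≤ weight i j
  weight_self : ∀ i, weight i i = 0

namespace DirectedNetwork

variable {V : Type*} [Fintype V] [DecidableEq V]

/-- The expected revenue of the influence-and-exploit strategy `IE(A, p)`: the buyers of `A` get the
product for free, then the others are approached in uniformly random order with pricing
probability `p`. -/
def ieRevenue (G : DirectedNetwork V) (A : Finset V) (p : ℝ) : ℝ :=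
  p * (1 - p) * ∑ i ∈ Aᶜ,
    (G.weight i i + ∑ j ∈ A, G.weight j i + ∑ j ∈ Aᶜ.erase i, p * G.weight j i / 2)

/-- The part of the expected revenue of `IE(A, p)` that is extracted from the edge `(i, j)`:
`p (1 - p) w_ij` if `i ∈ A` and `j ∉ A`; if both are outside `A`, it is `p² (1 - p) w_ij` times the
probability `1 / 2` that `i` precedes `j` in the random order; otherwise it is `0`. -/
def ieEdgeRevenue (G : DirectedNetwork V) (A : Finset V) (p : ℝ) (i j : V) : ℝ :=
  if j ∈ A then 0
  else if i ∈ A then p * (1 - p) * G.weight i j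
  else p ^ 2 * (1 - p) * G.weight i j * (1 / 2)

/-- The revenue of the best IE strategy with pricing probability `p`. -/
def bestIERevenue (G : DirectedNetwork V) (p : ℝ) : ℝ :=
  (Finset.univ : Finset (Finset V)).sup' Finset.univ_nonempty (fun A => G.ieRevenue A p)

/-- The space `ℝⁿ⁺¹`, where `n` is the number of buyers. -/
abbrev SDPSpace (V : Type*) [Fintype V] : Type := EuclideanSpace ℝ (Fin (Fintype.card V + 1))

/-- The feasible solutions `v₀, (v i)` of the semidefinite program. -/
structure IsFeasible (v₀ : SDPSpace V) (v : V → SDPSpace V) : Prop where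
  norm_zero : ⟪v₀, v₀⟫ = 1
  norm_one : ∀ i, ⟪v i, v i⟫ = 1
  triangle₁ : ∀ i j, -1 ≤ ⟪v i, v j⟫ + ⟪v₀, v i⟫ + ⟪v₀, v j⟫
  triangle₂ : ∀ i j, -1 ≤ ⟪v i, v j⟫ - ⟪v₀, v i⟫ - ⟪v₀, v j⟫
  triangle₃ : ∀ i j, -1 ≤ -⟪v i, v j⟫ - ⟪v₀, v i⟫ + ⟪v₀, v j⟫
  triangle₄ : ∀ i j, -1 ≤ -⟪v i, v j⟫ + ⟪v₀, v i⟫ - ⟪v₀, v j⟫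

/-- The objective function of the semidefinite program. -/
def sdpObjective (G : DirectedNetwork V) (p : ℝ) (v₀ : SDPSpace V) (v : V → SDPSpace V) : ℝ :=
  p * (1 - p) / 4 * ∑ i, ∑ j, G.weight i j *
    (1 + p / 2 + (1 - p / 2) * ⟪v₀, v i⟫ - (1 + p / 2) * ⟪v₀, v j⟫ - (1 - p / 2) * ⟪v i, v j⟫)

/-- The optimal solutions of the semidefinite program. -/
def IsOptimal (G : DirectedNetwork V) (p : ℝ) (v₀ : SDPSpace V) (v : V → SDPSpace V) : Prop :=
  IsFeasible v₀ v ∧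
    ∀ u₀ u, IsFeasible u₀ u → G.sdpObjective p u₀ u ≤ G.sdpObjective p v₀ v

end DirectedNetwork

namespace SDPIE

/-- The rotation function `f_γ`. -/
def rotAngle (γ θ : ℝ) : ℝ :=
  (1 - γ) * θ + γ * Real.pi * (1 - Real.cos θ) / 2

variable {E : Type*} [NormedAddCommGroup E] [InnerProductSpace ℝ E]

/-- The angle `arccos (u · v)` of two unit vectors. -/
def vecAngle (u v : E) : ℝ := Real.arccos ⟪u, v⟫

/-- The rotation of the unit vector `x` in the plane of `v₀` and `x`, on the same side of `v₀`,
so that its angle with `v₀` becomes `f_γ (θ)`, where `θ` is the angle of `v₀` and `x`. If `x = ± v₀`,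
the component of `x` orthogonal to `v₀` vanishes, and `x` stays where it is. -/
def rotate (γ : ℝ) (v₀ x : E) : E :=
  Real.cos (rotAngle γ (vecAngle v₀ x)) • v₀ +
    Real.sin (rotAngle γ (vecAngle v₀ x)) •
      (‖x - ⟪v₀, x⟫ • v₀‖⁻¹ • (x - ⟪v₀, x⟫ • v₀))

/-- `sgn x = 1` if `x ≥ 0`, and `-1` otherwise. -/
def sgn (x : ℝ) : ℤ := if 0 ≤ x then 1 else -1

/-- The influence set of a rounding direction `r`: the buyers `i` with
`sgn (v'ᵢ · r) = sgn (v₀ · r)`. -/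
def influenceSet {V : Type*} [Fintype V] (γ : ℝ) (v₀ : E) (v : V → E) (r : E) : Finset V :=
  Finset.univ.filter (fun i => sgn ⟪rotate γ v₀ (v i), r⟫ = sgn ⟪v₀, r⟫)

/-- The uniform probability measure on the unit sphere of `ℝᵐ`: the normalized surface measure. -/
def uniformSphere (m : ℕ) : Measure (Metric.sphere (0 : EuclideanSpace ℝ (Fin m)) 1) :=
  ((volume : Measure (EuclideanSpace ℝ (Fin m))).toSphere Set.univ)⁻¹ •
    (volume : Measure (EuclideanSpace ℝ (Fin m))).toSphere

open DirectedNetwork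

variable {V : Type*} [Fintype V] [DecidableEq V]

/-- The expected revenue of the IE strategy computed by `SDP-IE(p, γ)` from the solution
`v₀, (v i)` of the semidefinite program. -/
def expectedRevenue (G : DirectedNetwork V) (p γ : ℝ) (v₀ : SDPSpace V) (v : V → SDPSpace V) : ℝ :=
  ∫ r, G.ieRevenue (influenceSet γ v₀ v (r : SDPSpace V)) p
    ∂(uniformSphere (Fintype.card V + 1))

/-- The expected revenue extracted from the edge `(i, j)` by the IE strategy computed by
`SDP-IE(p, γ)` from the solution `v₀, (v i)` of the semidefinite program. -/
def expectedEdgeRevenue (G : DirectedNetwork V) (p γ : ℝ) (v₀ : SDPSpace V) (v : V → SDPSpace V)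
    (i j : V) : ℝ :=
  ∫ r, G.ieEdgeRevenue (influenceSet γ v₀ v (r : SDPSpace V)) p i j
    ∂(uniformSphere (Fintype.card V + 1))

end SDPIE

end

/-! The solutions of (S1) with every `v i` equal to `v₀` or `-v₀` reproduce the revenues of all
strategies IE(A, p), so the optimum of (S1) is at least the best IE revenue; it is attained because
the feasible set is compact. A uniformly random hyperplane separates two unit vectors with
probability angle / π (`uniformSphere_sgn_ne`). On every edge the extracted revenue is a linear
combination of three separation indicators (`ieEdgeRevenue_influenceSet`), and integrating it gives
the formula of (a).

For (b), each edge is compared with its own summand in (S1); this is `key_inequality`. Let a and b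
be the angles of `v₀` with `v i` and `v j`, and c the cosine of the dihedral angle of the two
planes, which the rotation preserves. Write z = cos a cos b + sin a sin b c, P = cos (rot a) cos
(rot b), M = sin (rot a) sin (rot b). The claim is that L(c) = rot a - 2 rot b + kap (2 + cos a - 2
cos b - z) is at most arccos (P + M c). For fixed a and b, L is affine and decreasing in c, and the
triangle constraints confine c to an interval [c₀, c₁]. At c₁, L is at most |rot a - rot b|, which
the arccosine always dominates (`upper_face_le`). Where P + M c ≥ 0 the arccosine is concave, so the
ends of the range suffice. Where P + M c ≤ 0 it is convex, and the inequality is carried over from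
c₀: either the arccosine is nowhere steeper than `kap` there, or a line below it that is no steeper
than L already dominates L at c₀ (`le_arccos_of_face`).

What remains are conditions at c₀, which involve only a and b. Small b and degenerate angles are
treated by hand. Elsewhere the conditions are verified by an adaptive bisection evaluated in the
kernel: sines and cosines in fixed point with proven errors, and a bound 16 on second derivatives to
pass from the corners of a cell to the whole cell. -/

open MeasureTheory
open scoped RealInnerProductSpace

noncomputable section

/-! ### Fixed-point evaluation, the tests on a cell, and the bisection -/

namespace SDPIE.Certificate

/-- Evaluation of `x` before it is passed on, for the benefit of the kernel. -/
def force (x : ℤ) (k : ℤ → Bool) : Bool :=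
  match x with
  | Int.ofNat n => Nat.rec (motive := fun _ => Bool) (k 0) (fun m _ => k (Int.ofNat (m + 1))) n
  | Int.negSucc n =>
    Nat.rec (motive := fun _ => Bool) (k (Int.negSucc 0)) (fun m _ => k (Int.negSucc (m + 1))) n

def forceNat (n : ℕ) (k : ℕ → ℤ) : ℤ :=
  Nat.rec (motive := fun _ => ℤ) (k 0) (fun m _ => k (m + 1)) n

/-- Fixed point cosine: `cosZ n / 2 ^ 30` approximates `cos (n / 2 ^ 30)`. -/
def cosZ (n : ℤ) : ℤ :=
  forceNat (n.natAbs ^ 2) fun u => forceNat (u ^ 2) fun v =>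
  Int.subNatNat
    -- The Taylor polynomial of degree 20 over the common denominator 20!, split into its positive
    -- and its negative terms so that the large arithmetic stays in the naturals. Dividing by `2 ^
    -- 570` instead of `2 ^ 600` leaves the scale `2 ^ 30`.
    (2432902008176640000 * 2 ^ 600 +
      v * (101370917007360000 * 2 ^ 480 +
      v * (60339831552000 * 2 ^ 360 +
      v * (5079110400 * 2 ^ 240 +
      v * (116280 * 2 ^ 120 +
      v * (1))))))
    (u * (1216451004088320000 * 2 ^ 540 +
      v * (3379030566912000 * 2 ^ 420 +
      v * (670442572800 * 2 ^ 300 +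
      v * (27907200 * 2 ^ 180 +
      v * (380 * 2 ^ 60)))))) / (2432902008176640000 * 2 ^ 570)

/-- Fixed point sine: `sinZ n / 2 ^ 30` approximates `sin (n / 2 ^ 30)`. -/
def sinZ (n : ℤ) : ℤ :=
  forceNat (n.natAbs ^ 2) fun u => forceNat (u ^ 2) fun v =>
  n * Int.subNatNat
    (121645100408832000 * 2 ^ 540 +
      v * (1013709170073600 * 2 ^ 420 +
      v * (335221286400 * 2 ^ 300 +
      v * (19535040 * 2 ^ 180 +
      v * (342 * 2 ^ 60)))))
    (u * (20274183401472000 * 2 ^ 480 +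
      v * (24135932620800 * 2 ^ 360 +
      v * (3047466240 * 2 ^ 240 +
      v * (93024 * 2 ^ 120 +
      v * (1)))))) / (121645100408832000 * 2 ^ 540)

/-- Fixed point version of `rotAngle 0.722`; the second argument is the cosine of the first. -/
def fZ (n c : ℤ) : ℤ := (2780000000 * n + 11341149479 * (2 ^ 30 - c)) / 10000000000

/-- The fixed point values, at one point, of the univariate functions that the tests use. -/
structure PtData where
  (C S h k s t ct st A : ℤ)

/-- `low` and `up` stand for the cases a + b ≤ π and a + b ≥ π, `A` and `B` for the tail and the
head of the edge. The least dihedral cosine is c₀ = -(k k') / (h h'), and `t` is the share of each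
end in L(c₀) = t + t'. -/
def lowA (n : ℤ) (K : PtData → Bool) : Bool :=
  force (cosZ n) fun c => force (fZ n c) fun A => force (cosZ A) fun C => force (sinZ A) fun S =>
  force (cosZ (n / 2)) fun h => force (sinZ (n / 2)) fun k => force (sinZ n) fun s =>
  K ⟨C, S, h, k, s, A, C, S, A⟩

def lowB (n : ℤ) (K : PtData → Bool) : Bool :=
  force (cosZ n) fun c => force (fZ n c) fun A => force (cosZ A) fun C => force (sinZ A) fun S =>
  force (cosZ (n / 2)) fun h => force (sinZ (n / 2)) fun k => force (sinZ n) fun s =>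
  force (-2 * A + (3 * 14237697906 * (2 ^ 30 - c)) / 10000000000) fun t =>
  force (cosZ t) fun ct => force (sinZ t) fun st =>
  K ⟨C, S, h, k, s, t, ct, st, A⟩

def upA (n : ℤ) (K : PtData → Bool) : Bool :=
  force (cosZ n) fun c => force (fZ n c) fun A => force (cosZ A) fun C => force (sinZ A) fun S =>
  force (sinZ (n / 2)) fun h => force (cosZ (n / 2)) fun k => force (sinZ n) fun s =>
  force (A + (2 * 14237697906 * c) / 10000000000) fun t =>
  force (cosZ t) fun ct => force (sinZ t) fun st =>
  K ⟨C, S, h, k, s, t, ct, st, A⟩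

def upB (n : ℤ) (K : PtData → Bool) : Bool :=
  force (cosZ n) fun c => force (fZ n c) fun A => force (cosZ A) fun C => force (sinZ A) fun S =>
  force (sinZ (n / 2)) fun h => force (cosZ (n / 2)) fun k => force (sinZ n) fun s =>
  force (-2 * A + (14237697906 * (3 * 2 ^ 30 - c)) / 10000000000) fun t =>
  force (cosZ t) fun ct => force (sinZ t) fun st =>
  K ⟨C, S, h, k, s, t, ct, st, A⟩

def nonnegZ (x : ℤ) : Bool :=
  match x with
  | Int.ofNat _ => true
  | Int.negSucc _ => false

/-- `F` is at least `m` at the four corners of a cell. -/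
def corners (F : PtData → PtData → ℤ) (m : ℤ) (a0 a1 b0 b1 : PtData) : Bool :=
  nonnegZ (F a0 b0 - m) && nonnegZ (F a0 b1 - m) && nonnegZ (F a1 b0 - m) && nonnegZ (F a1 b1 - m)

/-- The conditions at c₀, multiplied by h h' > 0 where c₀ occurs. The first two say L(c₀) ≤ ±(rot a
- rot b); `edgeZ` compares P + M c₀ with cos L(c₀); `obtuseZ`, or `slopeZ` with `lineZ`, serves the
region where the arccosine is convex. -/
def trivZ₁ (a b : PtData) : ℤ := b.A - a.A - a.t - b.t
def trivZ₂ (a b : PtData) : ℤ := a.A - b.A - a.t - b.t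
def edgeZ (a b : PtData) : ℤ :=
  a.h * b.h * (a.ct * b.ct - a.st * b.st - a.C * b.C) + a.S * b.S * (a.k * b.k)
def obtuseZ (a b : PtData) : ℤ :=
  a.h * b.h * (a.C * b.C + 817421346766254464) - a.S * b.S * (a.k * b.k)
def slopeZ (v : ℤ) (a b : PtData) : ℤ := v * (a.s * b.s) - a.S * b.S * 2 ^ 30
def lineZ (r m : ℤ) (a b : PtData) : ℤ :=
  a.h * b.h * ((m - r * (a.t + b.t)) - a.C * b.C) + a.S * b.S * (a.k * b.k)

/-- The margin that the corners need so that the function is nonnegative on the cell. -/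
def margin (w : ℤ) : ℤ := (2 * w) * 2 ^ 60 + 2 ^ 104

def testT (w : ℤ) (a0 a1 b0 b1 : PtData) : Bool :=
  -- At scale `2 ^ 30` this is twice the squared diagonal of the cell plus `2 ^ (-16)`, the same
  -- margin as `margin` at scale `2 ^ 120`.
  force ((2 * w) / 2 ^ 30 + 2 ^ 14) fun m =>
    corners trivZ₁ m a0 a1 b0 b1 || corners trivZ₂ m a0 a1 b0 b1

def testE (w : ℤ) (a0 a1 b0 b1 : PtData) : Bool :=
  testT w a0 a1 b0 b1 || force (margin w) fun m => corners edgeZ m a0 a1 b0 b1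

def testB (w : ℤ) (a0 a1 b0 b1 : PtData) (v r l : ℤ) : Bool :=
  (force ((2 * w) * 2 ^ 30 + 2 ^ 74) fun m => corners (slopeZ v) m a0 a1 b0 b1) &&
  (force (margin w) fun m => corners (lineZ r l) m a0 a1 b0 b1)

def testI (w : ℤ) (a0 a1 b0 b1 : PtData) : Bool :=
  testT w a0 a1 b0 b1 ||
  (force (margin w) fun m => corners obtuseZ m a0 a1 b0 b1) ||
  -- Tangent lines at u = 26/32, 19/32, 12/32, 6/32: `r` is the slope u - u³/6, `l` fixes the height
  -- of the line, and `v` is `kap * r`, each rounded in the safe direction.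
  testB w a0 a1 b0 b1 1105453073 776426837 1148419772323283428 ||
  testB w a0 a1 b0 b1 854368543 600074922 685973126731687924 ||
  testB w a0 a1 b0 b1 559849059 393216000 95283210412132919 ||
  testB w a0 a1 b0 b1 284963170 200146944 (-497862020901364642)

/-- Adaptive bisection of a cell, until the test succeeds on each part. -/
def bisect (ga gb : ℤ → (PtData → Bool) → Bool) (skip : ℤ → ℤ → ℤ → ℤ → Bool)
    (test : ℤ → PtData → PtData → PtData → PtData → Bool) (n : ℕ) :
    Bool → ℤ → ℤ → ℤ → ℤ → PtData → PtData → PtData → PtData → Bool :=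
  Nat.rec (motive := fun _ =>
      Bool → ℤ → ℤ → ℤ → ℤ → PtData → PtData → PtData → PtData → Bool)
    (fun _ _ _ _ _ _ _ _ _ => false)
    (fun _ ih d x0 x1 y0 y1 a0 a1 b0 b1 =>
      skip x0 x1 y0 y1 ||
      (force ((x1 - x0) * (x1 - x0) + (y1 - y0) * (y1 - y0)) fun w => test w a0 a1 b0 b1) ||
      (match d with
       | true => force ((x0 + x1) / 2) fun m => ga m fun am =>
          ih false x0 m y0 y1 a0 am b0 b1 && ih false m x1 y0 y1 am a1 b0 b1
       | false => force ((y0 + y1) / 2) fun m => gb m fun bm =>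
          ih true x0 x1 y0 m a0 a1 b0 bm && ih true x0 x1 m y1 a0 a1 bm b1))
    n

/-- The number π · 2^30 lies strictly between 3373259426 and 3373259427, so a skipped cell is
disjoint from the triangle under consideration. -/
def skipLow (x0 _x1 y0 _y1 : ℤ) : Bool := nonnegZ (x0 + y0 - 3373259427)
def skipUp (_x0 x1 _y0 y1 : ℤ) : Bool := nonnegZ (3373259426 - x1 - y1)

/-- The upper bound 3373260800 = 2^13 · 411775 slightly exceeds π · 2^30, and its repeated halves
are integers; 182536110 is 0.17 · 2^30 rounded down. -/
def run (ga gb : ℤ → (PtData → Bool) → Bool) (skip : ℤ → ℤ → ℤ → ℤ → Bool)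
    (test : ℤ → PtData → PtData → PtData → PtData → Bool) : Bool :=
  ga 0 fun a0 => ga 3373260800 fun a1 => gb 182536110 fun b0 => gb 3373260800 fun b1 =>
    bisect ga gb skip test 22 true 0 3373260800 182536110 3373260800 a0 a1 b0 b1

end SDPIE.Certificate

/-! ### Errors of the fixed-point sine and cosine -/

namespace SDPIE.Certificate

theorem force_eq (x : ℤ) (k : ℤ → Bool) : force x k = k x := by
  cases x with
  | ofNat n => cases n <;> rfl
  | negSucc n => cases n <;> rfl

theorem forceNat_eq (n : ℕ) (k : ℕ → ℤ) : forceNat n k = k n := by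
  cases n <;> rfl

theorem nonnegZ_iff (x : ℤ) : nonnegZ x = true ↔ 0 ≤ x := by
  cases x with
  | ofNat n => simp [nonnegZ]
  | negSucc n => simp [nonnegZ]

theorem abs_ediv_sub_le (a b : ℤ) (hb : 0 < b) : |((a / b : ℤ) : ℝ) - (a : ℝ) / b| ≤ 1 := by
  have h1 : (b : ℝ) * ((a / b : ℤ) : ℝ) + ((a % b : ℤ) : ℝ) = a := by
    exact_mod_cast Int.mul_ediv_add_emod a b
  have h2 : (0 : ℝ) ≤ ((a % b : ℤ) : ℝ) := by exact_mod_cast Int.emod_nonneg a hb.ne'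
  have h3 : ((a % b : ℤ) : ℝ) ≤ b := by exact_mod_cast (Int.emod_lt_of_pos a hb).le
  have hb' : (0 : ℝ) < b := by exact_mod_cast hb
  have h4 : ((a / b : ℤ) : ℝ) - (a : ℝ) / b = -(((a % b : ℤ) : ℝ) / b) := by
    rw [← h1]; field_simp; ring
  rw [h4, abs_neg, abs_of_nonneg (by positivity)]
  exact (div_le_one hb').2 h3

def cosTaylor (x : ℝ) : ℝ :=
  1 - x ^ 2 / 2 + x ^ 4 / 24 - x ^ 6 / 720 +
    x ^ 8 / 40320 - x ^ 10 / 3628800 + x ^ 12 / 479001600 - x ^ 14 / 87178291200 +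
    x ^ 16 / 20922789888000 - x ^ 18 / 6402373705728000 + x ^ 20 / 2432902008176640000

def sinTaylor (x : ℝ) : ℝ :=
  x - x ^ 3 / 6 + x ^ 5 / 120 - x ^ 7 / 5040 +
    x ^ 9 / 362880 - x ^ 11 / 39916800 + x ^ 13 / 6227020800 - x ^ 15 / 1307674368000 +
    x ^ 17 / 355687428096000 - x ^ 19 / 121645100408832000

theorem exp_taylor (x : ℝ) :
    ∑ m ∈ Finset.range 21, ((x : ℂ) * Complex.I) ^ m / (m.factorial : ℂ) =
      (cosTaylor x : ℂ) + (sinTaylor x : ℂ) * Complex.I := by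
  simp only [Finset.sum_range_succ, Finset.sum_range_zero, mul_pow, Nat.factorial, cosTaylor, sinTaylor]
  have h3 : Complex.I ^ 3 = -Complex.I := by rw [pow_succ, Complex.I_sq]; ring
  simp [Complex.I_pow_eq_pow_mod]
  ring_nf
  rw [Complex.I_sq, h3]
  ring

theorem norm_taylor {x : ℝ} (hx : |x| ≤ 10 / 3) :
    ‖Complex.exp ((x : ℂ) * Complex.I) -
      ((cosTaylor x : ℂ) + (sinTaylor x : ℂ) * Complex.I)‖ ≤ 1 / 250000000 := by
  have hn : ‖(x : ℂ) * Complex.I‖ = |x| := by simp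
  have h := Complex.exp_bound' (x := (x : ℂ) * Complex.I) (n := 21) (by
    rw [hn]
    have : |x| / ((21 : ℕ).succ : ℝ) ≤ (10 / 3) / ((21 : ℕ).succ : ℝ) := by gcongr
    refine this.trans ?_
    norm_num)
  rw [exp_taylor, hn] at h
  refine h.trans ?_
  -- The right side is about 3.7 · 10⁻⁹.
  have : |x| ^ 21 / ((21 : ℕ).factorial : ℝ) * 2 ≤ (10 / 3) ^ 21 / ((21 : ℕ).factorial : ℝ) * 2 := by
    gcongr
  refine this.trans ?_
  norm_num [Nat.factorial]

theorem abs_cos_sub_taylor {x : ℝ} (hx : |x| ≤ 10 / 3) :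
    |Real.cos x - cosTaylor x| ≤ 1 / 250000000 := by
  have h := (Complex.abs_re_le_norm _).trans (norm_taylor hx)
  simpa [Complex.exp_ofReal_mul_I_re] using h

theorem abs_sin_sub_taylor {x : ℝ} (hx : |x| ≤ 10 / 3) :
    |Real.sin x - sinTaylor x| ≤ 1 / 250000000 := by
  have h := (Complex.abs_im_le_norm _).trans (norm_taylor hx)
  simpa [Complex.exp_ofReal_mul_I_im] using h

set_option exponentiation.threshold 700 in
theorem abs_cosZ_sub_le (n : ℤ) (hn : |(n : ℝ) / 2 ^ 30| ≤ 10 / 3) :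
    |(cosZ n : ℝ) / 2 ^ 30 - Real.cos (n / 2 ^ 30)| ≤ 1 / 200000000 := by
  have ht := abs_cos_sub_taylor hn
  rw [cosZ, forceNat_eq, forceNat_eq, Int.subNatNat_eq_coe]
  set P : ℤ := _ - _ with hP
  have h1 := abs_ediv_sub_le P (2432902008176640000 * 2 ^ 570) (by positivity)
  have h2 : (P : ℝ) / ((2432902008176640000 * 2 ^ 570 : ℤ) : ℝ) = 2 ^ 30 * cosTaylor (n / 2 ^ 30) := by
    rw [hP, cosTaylor]
    push_cast [sq_abs]
    generalize (n : ℝ) = y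
    ring
  rw [h2] at h1
  rw [abs_le] at *
  constructor <;> linarith [h1.1, h1.2, ht.1, ht.2]

set_option exponentiation.threshold 700 in
theorem abs_sinZ_sub_le (n : ℤ) (hn : |(n : ℝ) / 2 ^ 30| ≤ 10 / 3) :
    |(sinZ n : ℝ) / 2 ^ 30 - Real.sin (n / 2 ^ 30)| ≤ 1 / 200000000 := by
  have ht := abs_sin_sub_taylor hn
  rw [sinZ, forceNat_eq, forceNat_eq, Int.subNatNat_eq_coe]
  set P : ℤ := n * (_ - _) with hP
  have h1 := abs_ediv_sub_le P (121645100408832000 * 2 ^ 540) (by positivity)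
  have h2 : (P : ℝ) / ((121645100408832000 * 2 ^ 540 : ℤ) : ℝ) = 2 ^ 30 * sinTaylor (n / 2 ^ 30) := by
    rw [hP, sinTaylor]
    push_cast [sq_abs]
    generalize (n : ℝ) = y
    ring
  rw [h2] at h1
  rw [abs_le] at *
  constructor <;> linarith [h1.1, h1.2, ht.1, ht.2]

end SDPIE.Certificate

/-! ### Second-derivative bounds and the passage from corners to cells -/

namespace SDPIE.Certificate
open Set

/-- `φ` is twice differentiable, and on `[0, 16 / 5]` the absolute values of `φ` and of its first
two derivatives are at most `m₀`, `m₁`, `m₂`. -/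
def C2Bound (φ : ℝ → ℝ) (m₀ m₁ m₂ : ℝ) : Prop :=
  ∃ φ' φ'' : ℝ → ℝ, (∀ x, HasDerivAt φ (φ' x) x) ∧ (∀ x, HasDerivAt φ' (φ'' x) x) ∧
    ∀ x ∈ Icc (0 : ℝ) (16 / 5), |φ x| ≤ m₀ ∧ |φ' x| ≤ m₁ ∧ |φ'' x| ≤ m₂

namespace C2Bound

variable {φ ψ : ℝ → ℝ} {m₀ m₁ m₂ n₀ n₁ n₂ : ℝ}

theorem const {c m : ℝ} (h : |c| ≤ m) : C2Bound (fun _ => c) m 0 0 :=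
  ⟨fun _ => 0, fun _ => 0, fun x => hasDerivAt_const x c, fun x => hasDerivAt_const x 0,
    fun _ _ => ⟨h, by simp, by simp⟩⟩

theorem add (hφ : C2Bound φ m₀ m₁ m₂) (hψ : C2Bound ψ n₀ n₁ n₂) :
    C2Bound (fun x => φ x + ψ x) (m₀ + n₀) (m₁ + n₁) (m₂ + n₂) := by
  obtain ⟨φ', φ'', h1, h2, h3⟩ := hφ
  obtain ⟨ψ', ψ'', k1, k2, k3⟩ := hψ
  refine ⟨fun x => φ' x + ψ' x, fun x => φ'' x + ψ'' x, fun x => (h1 x).add (k1 x),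
    fun x => (h2 x).add (k2 x), fun x hx => ?_⟩
  obtain ⟨a, b, c⟩ := h3 x hx
  obtain ⟨d, e, f⟩ := k3 x hx
  exact ⟨(abs_add_le _ _).trans (add_le_add a d), (abs_add_le _ _).trans (add_le_add b e),
    (abs_add_le _ _).trans (add_le_add c f)⟩

theorem neg (hφ : C2Bound φ m₀ m₁ m₂) : C2Bound (fun x => -φ x) m₀ m₁ m₂ := by
  obtain ⟨φ', φ'', h1, h2, h3⟩ := hφ
  exact ⟨fun x => -φ' x, fun x => -φ'' x, fun x => (h1 x).neg, fun x => (h2 x).neg,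
    fun x hx => by simpa using h3 x hx⟩

theorem sub (hφ : C2Bound φ m₀ m₁ m₂) (hψ : C2Bound ψ n₀ n₁ n₂) :
    C2Bound (fun x => φ x - ψ x) (m₀ + n₀) (m₁ + n₁) (m₂ + n₂) := by
  simpa only [sub_eq_add_neg] using hφ.add hψ.neg

theorem mul (hφ : C2Bound φ m₀ m₁ m₂) (hψ : C2Bound ψ n₀ n₁ n₂) :
    C2Bound (fun x => φ x * ψ x) (m₀ * n₀) (m₁ * n₀ + m₀ * n₁)
      (m₂ * n₀ + 2 * (m₁ * n₁) + m₀ * n₂) := by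
  obtain ⟨φ', φ'', h1, h2, h3⟩ := hφ
  obtain ⟨ψ', ψ'', k1, k2, k3⟩ := hψ
  refine ⟨fun x => φ' x * ψ x + φ x * ψ' x,
    fun x => φ'' x * ψ x + 2 * (φ' x * ψ' x) + φ x * ψ'' x, fun x => (h1 x).mul (k1 x),
    fun x => ?_, fun x hx => ?_⟩
  · exact (((h2 x).mul (k1 x)).add ((h1 x).mul (k2 x))).congr_deriv (by ring)
  obtain ⟨a, b, c⟩ := h3 x hx
  obtain ⟨d, e, f⟩ := k3 x hx
  have key : ∀ {u v m n : ℝ}, |u| ≤ m → |v| ≤ n → |u * v| ≤ m * n := fun hu hv => by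
    rw [abs_mul]
    exact mul_le_mul hu hv (abs_nonneg _) ((abs_nonneg _).trans hu)
  refine ⟨key a d, (abs_add_le _ _).trans (add_le_add (key b d) (key a e)),
    (abs_add_le _ _).trans (add_le_add ((abs_add_le _ _).trans (add_le_add (key c d) ?_))
      (key a f))⟩
  rw [abs_mul, abs_two]
  exact mul_le_mul_of_nonneg_left (key b e) zero_le_two

theorem cos (hφ : C2Bound φ m₀ m₁ m₂) :
    C2Bound (fun x => Real.cos (φ x)) 1 m₁ (m₁ * m₁ + m₂) := by
  obtain ⟨φ', φ'', h1, h2, h3⟩ := hφ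
  refine ⟨fun x => -Real.sin (φ x) * φ' x,
    fun x => -(Real.cos (φ x) * φ' x) * φ' x + -Real.sin (φ x) * φ'' x, fun x => (h1 x).cos,
    fun x => ((h1 x).sin.neg).mul (h2 x), fun x hx => ?_⟩
  obtain ⟨-, b, c⟩ := h3 x hx
  have hs := Real.abs_sin_le_one (φ x)
  have hc := Real.abs_cos_le_one (φ x)
  refine ⟨hc, ?_, (abs_add_le _ _).trans (add_le_add ?_ ?_)⟩
  · rw [abs_mul, abs_neg]
    nlinarith [abs_nonneg (φ' x), abs_nonneg (Real.sin (φ x))]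
  · rw [abs_mul, abs_neg, abs_mul, mul_assoc]
    have : |φ' x| * |φ' x| ≤ m₁ * m₁ :=
      mul_le_mul b b (abs_nonneg _) ((abs_nonneg _).trans b)
    nlinarith [abs_nonneg (Real.cos (φ x)), mul_nonneg (abs_nonneg (φ' x)) (abs_nonneg (φ' x))]
  · rw [abs_mul, abs_neg]
    nlinarith [abs_nonneg (φ'' x), abs_nonneg (Real.sin (φ x))]

theorem sin (hφ : C2Bound φ m₀ m₁ m₂) :
    C2Bound (fun x => Real.sin (φ x)) 1 m₁ (m₁ * m₁ + m₂) := by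
  obtain ⟨φ', φ'', h1, h2, h3⟩ := hφ
  have h : C2Bound (fun x => φ x - Real.pi / 2) (m₀ + |Real.pi / 2|) m₁ m₂ :=
    ⟨φ', φ'', fun x => (h1 x).sub_const _, h2, fun x hx =>
      ⟨(abs_sub _ _).trans (add_le_add_left (h3 x hx).1 _), (h3 x hx).2⟩⟩
  simpa only [Real.cos_sub_pi_div_two] using h.cos

/-- A function with second derivative at most `16` exceeds its chord by at most `2 (x₁ - x₀) ^ 2`. -/
theorem min_sub_le (hφ : C2Bound φ m₀ m₁ m₂) (hm : m₂ ≤ 16) {x₀ x₁ x m : ℝ} (h0 : 0 ≤ x₀)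
    (h1 : x₁ ≤ 16 / 5) (hx₀ : x₀ ≤ x) (hx₁ : x ≤ x₁) (hm₀ : m ≤ φ x₀) (hm₁ : m ≤ φ x₁) :
    m - 2 * (x₁ - x₀) ^ 2 ≤ φ x := by
  obtain ⟨φ', φ'', d1, d2, hb⟩ := hφ
  have hψ1 : ∀ y, HasDerivAt (fun y => φ y + 8 * ((y - x₀) * (x₁ - y)))
      (φ' y + 8 * (x₀ + x₁ - 2 * y)) y := fun y =>
    ((d1 y).add ((((hasDerivAt_id' y).sub_const x₀).mul
      ((hasDerivAt_id' y).const_sub x₁)).const_mul 8)).congr_deriv (by ring)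
  have hψ2 : ∀ y, HasDerivAt (fun y => φ' y + 8 * (x₀ + x₁ - 2 * y)) (φ'' y - 16) y := fun y =>
    ((d2 y).add ((((hasDerivAt_id' y).const_mul 2).const_sub (x₀ + x₁)).const_mul 8)).congr_deriv
      (by ring)
  -- The added parabola has second derivative -16, vanishes at both ends and is at most `2 * (x₁ -
  -- x₀) ^ 2`; a concave function is at least the smaller of its end values.
  have hc : ConcaveOn ℝ (Icc x₀ x₁) (fun y => φ y + 8 * ((y - x₀) * (x₁ - y))) := by
    refine concaveOn_of_hasDerivWithinAt2_nonpos (convex_Icc _ _)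
      (fun y _ => (hψ1 y).continuousAt.continuousWithinAt)
      (fun y _ => (hψ1 y).hasDerivWithinAt) (fun y _ => (hψ2 y).hasDerivWithinAt) fun y hy => ?_
    have hy' := interior_subset hy
    have := (abs_le.1 (hb y ⟨h0.trans hy'.1, hy'.2.trans h1⟩).2.2).2
    linarith
  have h01 : x₀ ≤ x₁ := hx₀.trans hx₁
  have := hc.min_le_of_mem_Icc (left_mem_Icc.2 h01) (right_mem_Icc.2 h01) ⟨hx₀, hx₁⟩
  simp only [sub_self, zero_mul, mul_zero, add_zero] at this
  have h2 := (le_min hm₀ hm₁).trans this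
  nlinarith [sq_nonneg (2 * x - x₀ - x₁)]

theorem mono (hφ : C2Bound φ m₀ m₁ m₂) (h0 : m₀ ≤ n₀) (h1 : m₁ ≤ n₁) (h2 : m₂ ≤ n₂) :
    C2Bound φ n₀ n₁ n₂ := by
  obtain ⟨φ', φ'', d1, d2, hb⟩ := hφ
  exact ⟨φ', φ'', d1, d2, fun x hx =>
    ⟨(hb x hx).1.trans h0, (hb x hx).2.1.trans h1, (hb x hx).2.2.trans h2⟩⟩

end C2Bound

/-- `φ` satisfies `C2Bound` with second derivative at most `16`. -/
def Tame (φ : ℝ → ℝ) : Prop := ∃ m₀ m₁ m₂ : ℝ, m₂ ≤ 16 ∧ C2Bound φ m₀ m₁ m₂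

/-- The one-variable bound is used along the two sides x = x₀ and x = x₁, and then along the
horizontal segment through (x, y). Mixed derivatives play no role. -/
theorem cell_le {F : ℝ → ℝ → ℝ} (hx : ∀ y ∈ Icc (0 : ℝ) (16 / 5), Tame fun x => F x y)
    (hy : ∀ x ∈ Icc (0 : ℝ) (16 / 5), Tame fun y => F x y) {x₀ x₁ y₀ y₁ x y m : ℝ}
    (hx₀ : 0 ≤ x₀) (hx₁ : x₁ ≤ 16 / 5) (hy₀ : 0 ≤ y₀) (hy₁ : y₁ ≤ 16 / 5)
    (hxx : x ∈ Icc x₀ x₁) (hyy : y ∈ Icc y₀ y₁)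
    (h00 : m ≤ F x₀ y₀) (h01 : m ≤ F x₀ y₁) (h10 : m ≤ F x₁ y₀) (h11 : m ≤ F x₁ y₁) :
    m - 2 * ((x₁ - x₀) ^ 2 + (y₁ - y₀) ^ 2) ≤ F x y := by
  have hx01 := hxx.1.trans hxx.2
  obtain ⟨_, _, _, hm, h⟩ := hy x₀ ⟨hx₀, hx01.trans hx₁⟩
  obtain ⟨_, _, _, hm', h'⟩ := hy x₁ ⟨hx₀.trans hx01, hx₁⟩
  obtain ⟨_, _, _, hm'', h''⟩ := hx y ⟨hy₀.trans hyy.1, hyy.2.trans hy₁⟩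
  have := h''.min_sub_le hm'' hx₀ hx₁ hxx.1 hxx.2 (h.min_sub_le hm hy₀ hy₁ hyy.1 hyy.2 h00 h01)
    (h'.min_sub_le hm' hy₀ hy₁ hyy.1 hyy.2 h10 h11)
  linarith

end SDPIE.Certificate

/-! ### The real functions behind the tests, and their derivatives -/

namespace SDPIE.Certificate
open Set

/-- The rotation function for `γ = 0.722`. -/
def rot (x : ℝ) : ℝ := 278 / 1000 * x + 361 / 1000 * Real.pi * (1 - Real.cos x)

/-- `0.9064 * π / 2`. -/
def kap : ℝ := 4532 / 10000 * Real.pi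

/-- The real values that `PtData` approximates. -/
structure PtReal where
  (C S h k s t ct st A : ℝ)

/-- The univariate functions that depend on the face and on the end of the edge. -/
structure Side where
  (h k t : ℝ → ℝ)

def Side.pt (σ : Side) (x : ℝ) : PtReal :=
  ⟨Real.cos (rot x), Real.sin (rot x), σ.h x, σ.k x, Real.sin x, σ.t x, Real.cos (σ.t x),
    Real.sin (σ.t x), rot x⟩

def trivR₁ (a b : PtReal) : ℝ := b.A - a.A - a.t - b.t
def trivR₂ (a b : PtReal) : ℝ := a.A - b.A - a.t - b.t
def edgeR (a b : PtReal) : ℝ :=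
  a.h * b.h * (a.ct * b.ct - a.st * b.st - a.C * b.C) + a.S * b.S * (a.k * b.k)
def obtuseR (a b : PtReal) : ℝ :=
  a.h * b.h * (a.C * b.C + 709 / 1000) - a.S * b.S * (a.k * b.k)
def slopeR (v : ℝ) (a b : PtReal) : ℝ := v * (a.s * b.s) - a.S * b.S
def lineR (r l : ℝ) (a b : PtReal) : ℝ :=
  a.h * b.h * ((l - r * (a.t + b.t)) - a.C * b.C) + a.S * b.S * (a.k * b.k)

theorem edgeR_comm (a b : PtReal) : edgeR a b = edgeR b a := by unfold edgeR; ring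
theorem obtuseR_comm (a b : PtReal) : obtuseR a b = obtuseR b a := by unfold obtuseR; ring
theorem slopeR_comm (v : ℝ) (a b : PtReal) : slopeR v a b = slopeR v b a := by unfold slopeR; ring
theorem lineR_comm (r l : ℝ) (a b : PtReal) : lineR r l a b = lineR r l b a := by unfold lineR; ring
theorem trivR₁_comm (a b : PtReal) : trivR₁ a b = trivR₂ b a := by unfold trivR₁ trivR₂; ring

/-- On [0, 16/5] the sine stays in [-0.06, 1], so the derivative q - r sin x lies between its values
at these two extremes. This is sharper than |q| + |r|. -/
theorem c2Bound_affine_cos {p q r m₀ m₁ m₂ : ℝ} (h0 : |p| + |q| * (16 / 5) + |r| ≤ m₀)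
    (h1 : |q + 6 / 100 * r| ≤ m₁) (h1' : |q - r| ≤ m₁) (h2 : |r| ≤ m₂) :
    C2Bound (fun x => p + q * x + r * Real.cos x) m₀ m₁ m₂ := by
  refine ⟨fun x => q - r * Real.sin x, fun x => -(r * Real.cos x), fun x => ?_, fun x => ?_,
    fun x hx => ⟨?_, ?_, ?_⟩⟩
  · exact ((((hasDerivAt_id' x).const_mul q).const_add p).add
      ((Real.hasDerivAt_cos x).const_mul r)).congr_deriv (by ring)
  · exact (((Real.hasDerivAt_sin x).const_mul r).const_sub q).congr_deriv (by ring)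
  · refine ((abs_add_le _ _).trans (add_le_add ((abs_add_le _ _).trans
      (add_le_add le_rfl ?_)) ?_)).trans h0
    · rw [abs_mul, abs_of_nonneg hx.1]
      exact mul_le_mul_of_nonneg_left hx.2 (abs_nonneg _)
    · rw [abs_mul]
      exact mul_le_of_le_one_right (abs_nonneg _) (Real.abs_cos_le_one x)
  · have hs1 := Real.sin_le_one x
    have hs0 : -(6 / 100) ≤ Real.sin x := by
      rcases le_total x Real.pi with h | h
      · linarith [Real.sin_nonneg_of_nonneg_of_le_pi hx.1 h]
      · have := Real.sin_le (sub_nonneg.2 h)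
        rw [Real.sin_sub_pi] at this
        linarith [hx.2, Real.pi_gt_d2]
    rw [abs_le] at *
    constructor <;> rcases le_total 0 r with hr | hr <;> nlinarith
  · rw [abs_neg, abs_mul]
    exact (mul_le_of_le_one_right (abs_nonneg _) (Real.abs_cos_le_one x)).trans h2

theorem pi_bounds : 3.1415926535 < Real.pi ∧ Real.pi < 3.1415926536 :=
  ⟨by linarith [Real.pi_gt_d20], by linarith [Real.pi_lt_d20]⟩

theorem c2Bound_rot : C2Bound rot 4 (1413 / 1000) (1135 / 1000) := by
  have h : rot = fun x => 361 / 1000 * Real.pi + 278 / 1000 * x +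
      -(361 / 1000 * Real.pi) * Real.cos x := by
    funext x; unfold rot; ring
  obtain ⟨h1, h2⟩ := pi_bounds
  rw [h]
  apply c2Bound_affine_cos
  · rw [abs_neg, abs_of_pos (by positivity), abs_of_pos (by norm_num)]; linarith
  · rw [abs_le]; constructor <;> linarith
  · rw [abs_le]; constructor <;> linarith
  · rw [abs_neg, abs_of_pos (by positivity)]; linarith

/-- These bounds keep every second derivative in the `tame` lemmas below 16; `edgeR` is the
tightest, at about 15.4. -/
structure Side.Good (σ : Side) : Prop where
  h : C2Bound σ.h 1 (1 / 2) (1 / 4)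
  k : C2Bound σ.k 1 (1 / 2) (1 / 4)
  t : C2Bound σ.t 6 (29 / 20) (201 / 100)

theorem c2Bound_half : C2Bound (fun x => 0 + 1 / 2 * x + 0 * Real.cos x) 2 (1 / 2) 0 := by
  apply c2Bound_affine_cos <;> norm_num [abs_of_pos]

theorem c2Bound_cos_half : C2Bound (fun x => Real.cos (x / 2)) 1 (1 / 2) (1 / 4) := by
  have := c2Bound_half.cos
  norm_num at this
  simpa only [div_eq_inv_mul, one_div, mul_one] using this

theorem c2Bound_sin_half : C2Bound (fun x => Real.sin (x / 2)) 1 (1 / 2) (1 / 4) := by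
  have := c2Bound_half.sin
  norm_num at this
  simpa only [div_eq_inv_mul, one_div, mul_one] using this

/-- For a + b ≤ π the binding constraint is z ≥ cos a + cos b - 1, which gives c₀ = -tan (a/2) tan
(b/2). For a + b ≥ π it is z ≥ -1 - cos a - cos b, and the tangents become cotangents. In both cases
L(c₀) separates into a function of a plus a function of b, the two `t` fields. -/
def lowSideA : Side := ⟨fun x => Real.cos (x / 2), fun x => Real.sin (x / 2), rot⟩
def lowSideB : Side := ⟨fun x => Real.cos (x / 2), fun x => Real.sin (x / 2),
  fun x => -2 * rot x + 3 * kap * (1 - Real.cos x)⟩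
def upSideA : Side := ⟨fun x => Real.sin (x / 2), fun x => Real.cos (x / 2),
  fun x => rot x + 2 * kap * Real.cos x⟩
def upSideB : Side := ⟨fun x => Real.sin (x / 2), fun x => Real.cos (x / 2),
  fun x => -2 * rot x + kap * (3 - Real.cos x)⟩

theorem lowSideA_good : lowSideA.Good :=
  ⟨c2Bound_cos_half, c2Bound_sin_half, c2Bound_rot.mono (by norm_num) (by norm_num) (by norm_num)⟩

theorem lowSideB_good : lowSideB.Good := by
  refine ⟨c2Bound_cos_half, c2Bound_sin_half, ?_⟩
  have h : lowSideB.t = fun x => 6376 / 10000 * Real.pi + -(556 / 1000) * x +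
      -(6376 / 10000 * Real.pi) * Real.cos x := by
    funext x; simp only [lowSideB, rot, kap]; ring
  obtain ⟨h1, h2⟩ := pi_bounds
  rw [h]
  apply c2Bound_affine_cos
  · rw [abs_neg, abs_neg, abs_of_pos (by positivity), abs_of_pos (by norm_num)]; linarith
  · rw [abs_le]; constructor <;> linarith
  · rw [abs_le]; constructor <;> linarith
  · rw [abs_neg, abs_of_pos (by positivity)]; linarith

theorem upSideA_good : upSideA.Good := by
  refine ⟨c2Bound_sin_half, c2Bound_cos_half, ?_⟩
  have h : upSideA.t = fun x => 361 / 1000 * Real.pi + 278 / 1000 * x +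
      5454 / 10000 * Real.pi * Real.cos x := by
    funext x; simp only [upSideA, rot, kap]; ring
  obtain ⟨h1, h2⟩ := pi_bounds
  rw [h]
  apply c2Bound_affine_cos
  · rw [abs_of_pos (by positivity), abs_of_pos (by norm_num), abs_of_pos (by positivity)]; linarith
  · rw [abs_le]; constructor <;> linarith
  · rw [abs_le]; constructor <;> linarith
  · rw [abs_of_pos (by positivity)]; linarith

theorem upSideB_good : upSideB.Good := by
  refine ⟨c2Bound_sin_half, c2Bound_cos_half, ?_⟩
  have h : upSideB.t = fun x => 6376 / 10000 * Real.pi + -(556 / 1000) * x +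
      2688 / 10000 * Real.pi * Real.cos x := by
    funext x; simp only [upSideB, rot, kap]; ring
  obtain ⟨h1, h2⟩ := pi_bounds
  rw [h]
  apply c2Bound_affine_cos
  · rw [abs_neg, abs_of_pos (by positivity), abs_of_pos (by norm_num), abs_of_pos (by positivity)]
    linarith
  · rw [abs_le]; constructor <;> linarith
  · rw [abs_le]; constructor <;> linarith
  · rw [abs_of_pos (by positivity)]; linarith

/-- The bounds on the entries of `PtReal` that the error analysis needs. -/
structure PtReal.Bdd (p : PtReal) : Prop where
  C : |p.C| ≤ 1
  S : |p.S| ≤ 1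
  h : |p.h| ≤ 1
  k : |p.k| ≤ 1
  s : |p.s| ≤ 1
  t : |p.t| ≤ 6
  ct : |p.ct| ≤ 1
  st : |p.st| ≤ 1

theorem Side.Good.bdd {σ : Side} (hσ : σ.Good) {x : ℝ} (hx : x ∈ Icc (0 : ℝ) (16 / 5)) :
    (σ.pt x).Bdd := by
  obtain ⟨_, _, _, _, hh⟩ := hσ.h
  obtain ⟨_, _, _, _, hk⟩ := hσ.k
  obtain ⟨_, _, _, _, ht⟩ := hσ.t
  exact ⟨Real.abs_cos_le_one _, Real.abs_sin_le_one _, (hh x hx).1, (hk x hx).1,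
    Real.abs_sin_le_one _, (ht x hx).1, Real.abs_cos_le_one _, Real.abs_sin_le_one _⟩

theorem tame_edgeR {σ : Side} (hσ : σ.Good) {τ : Side} (hτ : τ.Good) {y : ℝ}
    (hy : y ∈ Icc (0 : ℝ) (16 / 5)) :
    Tame fun x => edgeR (σ.pt x) (τ.pt y) := by
  have hq := hτ.bdd hy
  have h : (fun x => edgeR (σ.pt x) (τ.pt y)) = fun x =>
      σ.h x * (τ.pt y).h * (Real.cos (σ.t x + τ.t y) - Real.cos (rot x) * (τ.pt y).C) +
        Real.sin (rot x) * (τ.pt y).S * (σ.k x * (τ.pt y).k) := by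
    funext x; rw [Real.cos_add]; rfl
  rw [h]
  obtain ⟨_, _, _, _, ht⟩ := hτ.t
  refine ⟨_, _, _, ?_, ((hσ.h.mul (.const hq.h)).mul
    ((hσ.t.add (.const (ht y hy).1)).cos.sub (c2Bound_rot.cos.mul (.const hq.C)))).add
    ((c2Bound_rot.sin.mul (.const hq.S)).mul (hσ.k.mul (.const hq.k)))⟩
  norm_num

theorem tame_obtuseR {σ : Side} (hσ : σ.Good) {q : PtReal} (hq : q.Bdd) :
    Tame fun x => obtuseR (σ.pt x) q := by
  refine ⟨_, _, _, ?_, ((hσ.h.mul (.const hq.h)).mul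
    ((c2Bound_rot.cos.mul (.const hq.C)).add (.const (m := 1) ?_))).sub
    ((c2Bound_rot.sin.mul (.const hq.S)).mul (hσ.k.mul (.const hq.k)))⟩
  · norm_num
  · norm_num [abs_of_pos]

theorem tame_slopeR (σ : Side) {q : PtReal} (hq : q.Bdd) {v : ℝ} (hv : |v| ≤ 11 / 10) :
    Tame fun x => slopeR v (σ.pt x) q := by
  have h1 : C2Bound (fun x => 0 + 1 * x + 0 * Real.cos x) 4 1 0 := by
    apply c2Bound_affine_cos <;> norm_num
  have hs : C2Bound (fun x => Real.sin x) 1 1 1 := by simpa using h1.sin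
  refine ⟨_, _, _, ?_, ((C2Bound.const hv).mul (hs.mul (.const hq.s))).sub
    (c2Bound_rot.sin.mul (.const hq.S))⟩
  norm_num

theorem tame_lineR {σ : Side} (hσ : σ.Good) {q : PtReal} (hq : q.Bdd) {r l : ℝ} (hr : |r| ≤ 3 / 4) (hl : |l| ≤ 11 / 10) :
    Tame fun x => lineR r l (σ.pt x) q := by
  refine ⟨_, _, _, ?_, ((hσ.h.mul (.const hq.h)).mul
    (((C2Bound.const hl).sub ((C2Bound.const hr).mul (hσ.t.add (.const hq.t)))).sub
      (c2Bound_rot.cos.mul (.const hq.C)))).add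
    ((c2Bound_rot.sin.mul (.const hq.S)).mul (hσ.k.mul (.const hq.k)))⟩
  norm_num

theorem tame_trivR₁ {σ : Side} (hσ : σ.Good) (q : PtReal) : Tame fun x => trivR₁ (σ.pt x) q := by
  refine ⟨_, _, _, ?_, (((C2Bound.const le_rfl).sub c2Bound_rot).sub hσ.t).sub (.const le_rfl)⟩
  norm_num

theorem tame_trivR₂ {σ : Side} (hσ : σ.Good) (q : PtReal) : Tame fun x => trivR₂ (σ.pt x) q := by
  refine ⟨_, _, _, ?_, ((c2Bound_rot.sub (.const le_rfl)).sub hσ.t).sub (.const le_rfl)⟩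
  norm_num

end SDPIE.Certificate

/-! ### Error propagation through the tests -/

namespace SDPIE.Certificate
open Set

theorem abs_mul_sub_mul_le {x y x' y' X Y e e' : ℝ} (hx : |x' - x| ≤ e) (hy : |y' - y| ≤ e')
    (hX : |x| ≤ X) (hY : |y| ≤ Y) : |x' * y' - x * y| ≤ e * (Y + e') + X * e' := by
  have h : x' * y' - x * y = (x' - x) * (y + (y' - y)) + x * (y' - y) := by ring
  rw [h]
  refine (abs_add_le _ _).trans (add_le_add ?_ ?_)
  · rw [abs_mul]
    exact mul_le_mul hx ((abs_add_le _ _).trans (add_le_add hY hy)) (abs_nonneg _)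
      ((abs_nonneg _).trans hx)
  · rw [abs_mul]
    exact mul_le_mul hX hy (abs_nonneg _) ((abs_nonneg _).trans hX)

theorem abs_mul_le_one {x y : ℝ} (hx : |x| ≤ 1) (hy : |y| ≤ 1) : |x * y| ≤ 1 := by
  rw [abs_mul]; exact mul_le_one₀ hx (abs_nonneg _) hy

theorem abs_mul_sub_mul_le_of_le_one {x y x' y' e : ℝ} (he : e ≤ 1 / 1000) (hx : |x' - x| ≤ e)
    (hy : |y' - y| ≤ e) (hX : |x| ≤ 1) (hY : |y| ≤ 1) : |x' * y' - x * y| ≤ 2001 / 1000 * e := by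
  have he0 : 0 ≤ e := (abs_nonneg _).trans hx
  refine (abs_mul_sub_mul_le hx hy hX hY).trans ?_
  nlinarith

/-- The data `d` approximate the values `p`. -/
structure IsApprox (d : PtData) (p : PtReal) : Prop where
  C : |(d.C : ℝ) / 2 ^ 30 - p.C| ≤ 1 / 10 ^ 7
  S : |(d.S : ℝ) / 2 ^ 30 - p.S| ≤ 1 / 10 ^ 7
  h : |(d.h : ℝ) / 2 ^ 30 - p.h| ≤ 1 / 10 ^ 7
  k : |(d.k : ℝ) / 2 ^ 30 - p.k| ≤ 1 / 10 ^ 7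
  s : |(d.s : ℝ) / 2 ^ 30 - p.s| ≤ 1 / 10 ^ 7
  t : |(d.t : ℝ) / 2 ^ 30 - p.t| ≤ 1 / 10 ^ 7
  ct : |(d.ct : ℝ) / 2 ^ 30 - p.ct| ≤ 1 / 10 ^ 7
  st : |(d.st : ℝ) / 2 ^ 30 - p.st| ≤ 1 / 10 ^ 7
  A : |(d.A : ℝ) / 2 ^ 30 - p.A| ≤ 1 / 10 ^ 7

variable {a b : PtData} {p q : PtReal}

theorem trivZ₁_approx (ha : IsApprox a p) (hb : IsApprox b q) :
    (trivZ₁ a b : ℝ) / 2 ^ 30 ≤ trivR₁ p q + 1 / 2 ^ 17 := by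
  have h1 := abs_le.1 ha.A
  have h2 := abs_le.1 hb.A
  have h3 := abs_le.1 ha.t
  have h4 := abs_le.1 hb.t
  simp only [trivZ₁, trivR₁]
  push_cast
  linarith [h1.1, h1.2, h2.1, h2.2, h3.1, h3.2, h4.1, h4.2]

theorem trivZ₂_approx (ha : IsApprox a p) (hb : IsApprox b q) :
    (trivZ₂ a b : ℝ) / 2 ^ 30 ≤ trivR₂ p q + 1 / 2 ^ 17 := by
  have h1 := abs_le.1 ha.A
  have h2 := abs_le.1 hb.A
  have h3 := abs_le.1 ha.t
  have h4 := abs_le.1 hb.t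
  simp only [trivZ₂, trivR₂]
  push_cast
  linarith [h1.1, h1.2, h2.1, h2.2, h3.1, h3.2, h4.1, h4.2]

/-- The shape common to `edgeR`, `lineR` (sum) and `obtuseR` (difference). The bound 14 on the inner
factor is needed for `lineR`; the total error is about 4.2 · 10⁻⁶, below `1 / 2 ^ 17`. -/
theorem abs_product_sum_sub_le {H I S K H' I' S' K' e : ℝ} (he : e = 2001 / 1000 * (1 / 10 ^ 7))
    (hH : |H' - H| ≤ e) (hI : |I' - I| ≤ 1 / 10 ^ 6) (hS : |S' - S| ≤ e) (hK : |K' - K| ≤ e)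
    (bH : |H| ≤ 1) (bI : |I| ≤ 14) (bS : |S| ≤ 1) (bK : |K| ≤ 1) :
    H' * I' + S' * K' ≤ H * I + S * K + 1 / 2 ^ 17 ∧
      H' * I' - S' * K' ≤ H * I - S * K + 1 / 2 ^ 17 := by
  have h1 := abs_le.1 (abs_mul_sub_mul_le hH hI bH bI)
  have h2 := abs_le.1 (abs_mul_sub_mul_le_of_le_one (by rw [he]; norm_num) hS hK bS bK)
  subst he
  constructor <;> linarith [h1.2, h2.1, h2.2]

theorem edgeZ_approx (ha : IsApprox a p) (hb : IsApprox b q) (hp : p.Bdd) (hq : q.Bdd) :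
    (edgeZ a b : ℝ) / 2 ^ 120 ≤ edgeR p q + 1 / 2 ^ 17 := by
  have e0 : (1 : ℝ) / 10 ^ 7 ≤ 1 / 1000 := by norm_num
  have hC := abs_le.1 (abs_mul_sub_mul_le_of_le_one e0 ha.C hb.C hp.C hq.C)
  have hct := abs_le.1 (abs_mul_sub_mul_le_of_le_one e0 ha.ct hb.ct hp.ct hq.ct)
  have hst := abs_le.1 (abs_mul_sub_mul_le_of_le_one e0 ha.st hb.st hp.st hq.st)
  have mC := abs_le.1 (abs_mul_le_one hp.C hq.C)
  have mct := abs_le.1 (abs_mul_le_one hp.ct hq.ct)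
  have mst := abs_le.1 (abs_mul_le_one hp.st hq.st)
  have key := abs_product_sum_sub_le rfl (abs_mul_sub_mul_le_of_le_one e0 ha.h hb.h hp.h hq.h)
    (I := p.ct * q.ct - p.st * q.st - p.C * q.C)
    (I' := (a.ct / 2 ^ 30 : ℝ) * (b.ct / 2 ^ 30) - (a.st / 2 ^ 30 : ℝ) * (b.st / 2 ^ 30) -
      (a.C / 2 ^ 30 : ℝ) * (b.C / 2 ^ 30))
    (abs_le.2 ⟨by linarith [hC.2, hct.1, hst.2], by linarith [hC.1, hct.2, hst.1]⟩)
    (abs_mul_sub_mul_le_of_le_one e0 ha.S hb.S hp.S hq.S)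
    (abs_mul_sub_mul_le_of_le_one e0 ha.k hb.k hp.k hq.k)
    (abs_mul_le_one hp.h hq.h)
    (abs_le.2 ⟨by linarith [mC.2, mct.1, mst.2], by linarith [mC.1, mct.2, mst.1]⟩)
    (abs_mul_le_one hp.S hq.S) (abs_mul_le_one hp.k hq.k)
  refine (Eq.le ?_).trans key.1
  simp only [edgeZ]; push_cast; ring

theorem obtuseZ_approx (ha : IsApprox a p) (hb : IsApprox b q) (hp : p.Bdd) (hq : q.Bdd) :
    (obtuseZ a b : ℝ) / 2 ^ 120 ≤ obtuseR p q + 1 / 2 ^ 17 := by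
  have e0 : (1 : ℝ) / 10 ^ 7 ≤ 1 / 1000 := by norm_num
  have hC := abs_le.1 (abs_mul_sub_mul_le_of_le_one e0 ha.C hb.C hp.C hq.C)
  have mC := abs_le.1 (abs_mul_le_one hp.C hq.C)
  have key := abs_product_sum_sub_le rfl (abs_mul_sub_mul_le_of_le_one e0 ha.h hb.h hp.h hq.h)
    (I := p.C * q.C + 709 / 1000)
    (I' := (a.C / 2 ^ 30 : ℝ) * (b.C / 2 ^ 30) + 817421346766254464 / 2 ^ 60)
    (abs_le.2 ⟨by linarith [hC.1], by linarith [hC.2]⟩)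
    (abs_mul_sub_mul_le_of_le_one e0 ha.S hb.S hp.S hq.S)
    (abs_mul_sub_mul_le_of_le_one e0 ha.k hb.k hp.k hq.k)
    (abs_mul_le_one hp.h hq.h) (abs_le.2 ⟨by linarith [mC.1], by linarith [mC.2]⟩)
    (abs_mul_le_one hp.S hq.S) (abs_mul_le_one hp.k hq.k)
  refine (Eq.le ?_).trans key.2
  simp only [obtuseZ]; push_cast; ring

theorem lineZ_approx {r l : ℤ} (hr : |(r : ℝ) / 2 ^ 30| ≤ 3 / 4) (hl : |(l : ℝ) / 2 ^ 60| ≤ 11 / 10)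
    (ha : IsApprox a p) (hb : IsApprox b q) (hp : p.Bdd) (hq : q.Bdd) :
    (lineZ r l a b : ℝ) / 2 ^ 120 ≤ lineR (r / 2 ^ 30) (l / 2 ^ 60) p q + 1 / 2 ^ 17 := by
  have e0 : (1 : ℝ) / 10 ^ 7 ≤ 1 / 1000 := by norm_num
  have hC := abs_le.1 (abs_mul_sub_mul_le_of_le_one e0 ha.C hb.C hp.C hq.C)
  have mC := abs_le.1 (abs_mul_le_one hp.C hq.C)
  have ht : |((a.t / 2 ^ 30 : ℝ) + b.t / 2 ^ 30) - (p.t + q.t)| ≤ 2 / 10 ^ 7 := by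
    have h1 := abs_le.1 ha.t
    have h2 := abs_le.1 hb.t
    exact abs_le.2 ⟨by linarith [h1.1, h2.1], by linarith [h1.2, h2.2]⟩
  have mt : |p.t + q.t| ≤ 12 := (abs_add_le _ _).trans (by linarith [hp.t, hq.t])
  have h0 : |(r : ℝ) / 2 ^ 30 - r / 2 ^ 30| ≤ 0 := by simp
  have hrt := abs_le.1 (abs_mul_sub_mul_le h0 ht hr mt)
  have mrt : |(r : ℝ) / 2 ^ 30 * (p.t + q.t)| ≤ 3 / 4 * 12 := by
    rw [abs_mul]; exact mul_le_mul hr mt (abs_nonneg _) (by norm_num)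
  have mrt := abs_le.1 mrt
  have hl := abs_le.1 hl
  have key := abs_product_sum_sub_le rfl (abs_mul_sub_mul_le_of_le_one e0 ha.h hb.h hp.h hq.h)
    (I := l / 2 ^ 60 - r / 2 ^ 30 * (p.t + q.t) - p.C * q.C)
    (I' := (l / 2 ^ 60 - r / 2 ^ 30 * ((a.t / 2 ^ 30 : ℝ) + b.t / 2 ^ 30)) -
      (a.C / 2 ^ 30 : ℝ) * (b.C / 2 ^ 30))
    (abs_le.2 ⟨by linarith [hC.2, hrt.2], by linarith [hC.1, hrt.1]⟩)
    (abs_mul_sub_mul_le_of_le_one e0 ha.S hb.S hp.S hq.S)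
    (abs_mul_sub_mul_le_of_le_one e0 ha.k hb.k hp.k hq.k)
    (abs_mul_le_one hp.h hq.h)
    (abs_le.2 ⟨by linarith [mC.2, mrt.2, hl.1], by linarith [mC.1, mrt.1, hl.2]⟩)
    (abs_mul_le_one hp.S hq.S) (abs_mul_le_one hp.k hq.k)
  refine (Eq.le ?_).trans key.1
  simp only [lineZ]; push_cast; ring

theorem slopeZ_approx {v : ℤ} (hv : |(v : ℝ) / 2 ^ 30| ≤ 11 / 10)
    (ha : IsApprox a p) (hb : IsApprox b q) (hp : p.Bdd) (hq : q.Bdd) :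
    (slopeZ v a b : ℝ) / 2 ^ 90 ≤ slopeR (v / 2 ^ 30) p q + 1 / 2 ^ 17 := by
  have e0 : (1 : ℝ) / 10 ^ 7 ≤ 1 / 1000 := by norm_num
  have h0 : |(v : ℝ) / 2 ^ 30 - v / 2 ^ 30| ≤ 0 := by simp
  have hs := abs_mul_sub_mul_le_of_le_one e0 ha.s hb.s hp.s hq.s
  have hvs := abs_le.1 (abs_mul_sub_mul_le h0 hs hv (abs_mul_le_one hp.s hq.s))
  have hS := abs_le.1 (abs_mul_sub_mul_le_of_le_one e0 ha.S hb.S hp.S hq.S)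
  have h : (slopeZ v a b : ℝ) / 2 ^ 90 = v / 2 ^ 30 * ((a.s / 2 ^ 30 : ℝ) * (b.s / 2 ^ 30)) -
      (a.S / 2 ^ 30 : ℝ) * (b.S / 2 ^ 30) := by
    simp only [slopeZ]; push_cast; ring
  rw [h, slopeR]
  linarith [hvs.2, hS.1]

end SDPIE.Certificate

/-! ### Accuracy of the data at grid points -/

namespace SDPIE.Certificate
open Set

theorem cosZ_near {m : ℤ} {y e : ℝ} (h : |(m : ℝ) / 2 ^ 30 - y| ≤ e) (hy : |y| ≤ 332 / 100)
    (he : e ≤ 1 / 100) : |(cosZ m : ℝ) / 2 ^ 30 - Real.cos y| ≤ e + 1 / 200000000 := by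
  have hm : |(m : ℝ) / 2 ^ 30| ≤ 10 / 3 := by
    rw [abs_le] at *; constructor <;> linarith [h.1, h.2, hy.1, hy.2]
  have h1 := abs_le.1 (abs_cosZ_sub_le m hm)
  have h2 := abs_le.1 (Real.abs_cos_sub_cos_le ((m : ℝ) / 2 ^ 30) y)
  exact abs_le.2 ⟨by linarith [h1.1, h2.1], by linarith [h1.2, h2.2]⟩

theorem sinZ_near {m : ℤ} {y e : ℝ} (h : |(m : ℝ) / 2 ^ 30 - y| ≤ e) (hy : |y| ≤ 332 / 100)
    (he : e ≤ 1 / 100) : |(sinZ m : ℝ) / 2 ^ 30 - Real.sin y| ≤ e + 1 / 200000000 := by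
  have hm : |(m : ℝ) / 2 ^ 30| ≤ 10 / 3 := by
    rw [abs_le] at *; constructor <;> linarith [h.1, h.2, hy.1, hy.2]
  have h1 := abs_le.1 (abs_sinZ_sub_le m hm)
  have h2 := abs_le.1 (Real.abs_sin_sub_sin_le ((m : ℝ) / 2 ^ 30) y)
  exact abs_le.2 ⟨by linarith [h1.1, h2.1], by linarith [h1.2, h2.2]⟩

/-- The range of the grid points. -/
def InGrid (n : ℤ) : Prop := 0 ≤ n ∧ n ≤ 3373260800

variable {n : ℤ}

theorem InGrid.real (hn : InGrid n) : (0 : ℝ) ≤ n / 2 ^ 30 ∧ (n : ℝ) / 2 ^ 30 ≤ 315 / 100 := by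
  have h1 : (0 : ℝ) ≤ n := by exact_mod_cast hn.1
  have h2 : (n : ℝ) ≤ 3373260800 := by exact_mod_cast hn.2
  exact ⟨by positivity, by linarith⟩

theorem InGrid.mem (hn : InGrid n) : (n : ℝ) / 2 ^ 30 ∈ Icc (0 : ℝ) (16 / 5) :=
  ⟨hn.real.1, hn.real.2.trans (by norm_num)⟩

theorem cosZ_grid (hn : InGrid n) :
    |(cosZ n : ℝ) / 2 ^ 30 - Real.cos (n / 2 ^ 30)| ≤ 1 / 200000000 := by
  have h := hn.real
  exact abs_cosZ_sub_le n (abs_le.2 ⟨by linarith [h.1], by linarith [h.2]⟩)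

theorem sinZ_grid (hn : InGrid n) :
    |(sinZ n : ℝ) / 2 ^ 30 - Real.sin (n / 2 ^ 30)| ≤ 1 / 10 ^ 7 := by
  have h := hn.real
  refine (abs_sinZ_sub_le n (abs_le.2 ⟨by linarith [h.1], by linarith [h.2]⟩)).trans ?_
  norm_num

theorem half_near : |((n / 2 : ℤ) : ℝ) / 2 ^ 30 - n / 2 ^ 30 / 2| ≤ 1 / 10 ^ 8 := by
  have h := abs_le.1 (abs_ediv_sub_le n 2 (by norm_num))
  push_cast at h
  exact abs_le.2 ⟨by linarith [h.1], by linarith [h.2]⟩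

theorem cos_half_grid (hn : InGrid n) :
    |(cosZ (n / 2) : ℝ) / 2 ^ 30 - Real.cos (n / 2 ^ 30 / 2)| ≤ 1 / 10 ^ 7 := by
  have h := hn.real
  refine (cosZ_near half_near (abs_le.2 ⟨by linarith [h.1], by linarith [h.2]⟩)
    (by norm_num)).trans ?_
  norm_num

theorem sin_half_grid (hn : InGrid n) :
    |(sinZ (n / 2) : ℝ) / 2 ^ 30 - Real.sin (n / 2 ^ 30 / 2)| ≤ 1 / 10 ^ 7 := by
  have h := hn.real
  refine (sinZ_near half_near (abs_le.2 ⟨by linarith [h.1], by linarith [h.2]⟩)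
    (by norm_num)).trans ?_
  norm_num

theorem fZ_grid (hn : InGrid n) :
    |(fZ n (cosZ n) : ℝ) / 2 ^ 30 - rot (n / 2 ^ 30)| ≤ 1 / 10 ^ 8 := by
  have hc := abs_le.1 (cosZ_grid hn)
  have h := abs_le.1 (abs_ediv_sub_le (2780000000 * n + 11341149479 * (2 ^ 30 - cosZ n))
    10000000000 (by norm_num))
  have h1 := Real.cos_le_one ((n : ℝ) / 2 ^ 30)
  have h2 := Real.neg_one_le_cos ((n : ℝ) / 2 ^ 30)
  obtain ⟨p1, p2⟩ := pi_bounds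
  rw [fZ, rot]
  set y := Real.cos ((n : ℝ) / 2 ^ 30)
  push_cast at h
  have q1 : (361 / 1000 * Real.pi - 11341149479 / 10000000000) * (1 - y) ≤ 1 / 10 ^ 9 := by
    nlinarith
  have q2 : -(1 / 10 ^ 9) ≤ (361 / 1000 * Real.pi - 11341149479 / 10000000000) * (1 - y) := by
    nlinarith
  exact abs_le.2 ⟨by linarith [h.1, hc.1, hc.2], by linarith [h.2, hc.1, hc.2]⟩

theorem rot_grid (hn : InGrid n) : |rot (n / 2 ^ 30)| ≤ 332 / 100 := by
  have h := hn.real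
  have h1 := Real.cos_le_one ((n : ℝ) / 2 ^ 30)
  have h2 := Real.neg_one_le_cos ((n : ℝ) / 2 ^ 30)
  obtain ⟨p1, p2⟩ := pi_bounds
  rw [rot, abs_le]
  constructor <;> nlinarith [h.1, h.2]

theorem cosZ_fZ_grid (hn : InGrid n) :
    |(cosZ (fZ n (cosZ n)) : ℝ) / 2 ^ 30 - Real.cos (rot (n / 2 ^ 30))| ≤ 1 / 10 ^ 7 :=
  (cosZ_near (fZ_grid hn) (rot_grid hn) (by norm_num)).trans (by norm_num)

theorem sinZ_fZ_grid (hn : InGrid n) :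
    |(sinZ (fZ n (cosZ n)) : ℝ) / 2 ^ 30 - Real.sin (rot (n / 2 ^ 30))| ≤ 1 / 10 ^ 7 :=
  (sinZ_near (fZ_grid hn) (rot_grid hn) (by norm_num)).trans (by norm_num)

/-- `g` computes approximations of the values of `σ` at the grid points. -/
def Sound (g : ℤ → (PtData → Bool) → Bool) (σ : Side) : Prop :=
  ∀ n, InGrid n → ∃ d, (∀ K, g n K = K d) ∧ IsApprox d (σ.pt (n / 2 ^ 30))

theorem lowA_sound : Sound lowA lowSideA := fun n hn => by
  refine ⟨_, fun K => by simp only [lowA, force_eq]; rfl, ?_⟩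
  exact ⟨cosZ_fZ_grid hn, sinZ_fZ_grid hn, cos_half_grid hn, sin_half_grid hn, sinZ_grid hn,
    (fZ_grid hn).trans (by norm_num), cosZ_fZ_grid hn, sinZ_fZ_grid hn,
    (fZ_grid hn).trans (by norm_num)⟩

theorem lowB_sound : Sound lowB lowSideB := fun n hn => by
  have hr := hn.real
  have hc := abs_le.1 (cosZ_grid hn)
  have hf := abs_le.1 (fZ_grid hn)
  have h1 := Real.cos_le_one ((n : ℝ) / 2 ^ 30)
  have h2 := Real.neg_one_le_cos ((n : ℝ) / 2 ^ 30)
  obtain ⟨p1, p2⟩ := pi_bounds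
  have h := abs_le.1 (abs_ediv_sub_le (3 * 14237697906 * (2 ^ 30 - cosZ n)) 10000000000
    (by norm_num))
  have ht : |((-2 * fZ n (cosZ n) + (3 * 14237697906 * (2 ^ 30 - cosZ n)) / 10000000000 : ℤ) : ℝ) /
      2 ^ 30 - lowSideB.t (n / 2 ^ 30)| ≤ 6 / 10 ^ 8 := by
    simp only [lowSideB, kap]
    set y := Real.cos ((n : ℝ) / 2 ^ 30)
    push_cast at h ⊢
    have q1 : (4532 / 10000 * Real.pi - 14237697906 / 10000000000) * (1 - y) ≤ 1 / 10 ^ 9 := by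
      nlinarith
    have q2 : -(1 / 10 ^ 9) ≤ (4532 / 10000 * Real.pi - 14237697906 / 10000000000) * (1 - y) := by
      nlinarith
    exact abs_le.2 ⟨by linarith [h.1, hc.1, hc.2, hf.1, hf.2],
      by linarith [h.2, hc.1, hc.2, hf.1, hf.2]⟩
  have hb : |lowSideB.t (n / 2 ^ 30)| ≤ 332 / 100 := by
    simp only [lowSideB, kap, rot]
    rw [abs_le]
    refine ⟨by nlinarith, ?_⟩
    -- The cosine term alone can reach 0.6376 · 2π, about 4, beyond the range of the Taylor bounds.
    -- On the left half cos ≥ 0 halves it; on the right half the negative linear term compensates.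
    rcases le_total ((n : ℝ) / 2 ^ 30) (Real.pi / 2) with h' | h'
    · have := Real.cos_nonneg_of_neg_pi_div_two_le_of_le (by linarith) h'
      nlinarith
    · nlinarith
  refine ⟨_, fun K => by simp only [lowB, force_eq]; rfl, ?_⟩
  exact ⟨cosZ_fZ_grid hn, sinZ_fZ_grid hn, cos_half_grid hn, sin_half_grid hn, sinZ_grid hn,
    ht.trans (by norm_num), (cosZ_near ht hb (by norm_num)).trans (by norm_num),
    (sinZ_near ht hb (by norm_num)).trans (by norm_num), (fZ_grid hn).trans (by norm_num)⟩

theorem upA_sound : Sound upA upSideA := fun n hn => by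
  have hr := hn.real
  have hc := abs_le.1 (cosZ_grid hn)
  have hf := abs_le.1 (fZ_grid hn)
  have h1 := Real.cos_le_one ((n : ℝ) / 2 ^ 30)
  have h2 := Real.neg_one_le_cos ((n : ℝ) / 2 ^ 30)
  obtain ⟨p1, p2⟩ := pi_bounds
  have h := abs_le.1 (abs_ediv_sub_le (2 * 14237697906 * cosZ n) 10000000000
    (by norm_num))
  have ht : |((fZ n (cosZ n) + (2 * 14237697906 * cosZ n) / 10000000000 : ℤ) : ℝ) /
      2 ^ 30 - upSideA.t (n / 2 ^ 30)| ≤ 6 / 10 ^ 8 := by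
    simp only [upSideA, kap]
    set y := Real.cos ((n : ℝ) / 2 ^ 30)
    push_cast at h ⊢
    have q1 : (4532 / 10000 * Real.pi - 14237697906 / 10000000000) * y ≤ 1 / 10 ^ 9 := by
      nlinarith
    have q2 : -(1 / 10 ^ 9) ≤ (4532 / 10000 * Real.pi - 14237697906 / 10000000000) * y := by
      nlinarith
    exact abs_le.2 ⟨by linarith [h.1, hc.1, hc.2, hf.1, hf.2],
      by linarith [h.2, hc.1, hc.2, hf.1, hf.2]⟩
  have hb : |upSideA.t (n / 2 ^ 30)| ≤ 332 / 100 := by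
    simp only [upSideA, kap, rot]
    rw [abs_le]
    refine ⟨by nlinarith, ?_⟩
    rcases le_total ((n : ℝ) / 2 ^ 30) (Real.pi / 2) with h' | h'
    · nlinarith
    · have := Real.cos_nonpos_of_pi_div_two_le_of_le h' (by linarith)
      nlinarith
  refine ⟨_, fun K => by simp only [upA, force_eq]; rfl, ?_⟩
  exact ⟨cosZ_fZ_grid hn, sinZ_fZ_grid hn, sin_half_grid hn, cos_half_grid hn, sinZ_grid hn,
    ht.trans (by norm_num), (cosZ_near ht hb (by norm_num)).trans (by norm_num),
    (sinZ_near ht hb (by norm_num)).trans (by norm_num), (fZ_grid hn).trans (by norm_num)⟩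

theorem upB_sound : Sound upB upSideB := fun n hn => by
  have hr := hn.real
  have hc := abs_le.1 (cosZ_grid hn)
  have hf := abs_le.1 (fZ_grid hn)
  have h1 := Real.cos_le_one ((n : ℝ) / 2 ^ 30)
  have h2 := Real.neg_one_le_cos ((n : ℝ) / 2 ^ 30)
  obtain ⟨p1, p2⟩ := pi_bounds
  have h := abs_le.1 (abs_ediv_sub_le (14237697906 * (3 * 2 ^ 30 - cosZ n)) 10000000000
    (by norm_num))
  have ht : |((-2 * fZ n (cosZ n) + (14237697906 * (3 * 2 ^ 30 - cosZ n)) / 10000000000 : ℤ) : ℝ) /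
      2 ^ 30 - upSideB.t (n / 2 ^ 30)| ≤ 6 / 10 ^ 8 := by
    simp only [upSideB, kap]
    set y := Real.cos ((n : ℝ) / 2 ^ 30)
    push_cast at h ⊢
    have q1 : (4532 / 10000 * Real.pi - 14237697906 / 10000000000) * (3 - y) ≤ 1 / 10 ^ 9 := by
      nlinarith
    have q2 : -(1 / 10 ^ 9) ≤ (4532 / 10000 * Real.pi - 14237697906 / 10000000000) * (3 - y) := by
      nlinarith
    exact abs_le.2 ⟨by linarith [h.1, hc.1, hc.2, hf.1, hf.2],
      by linarith [h.2, hc.1, hc.2, hf.1, hf.2]⟩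
  have hb : |upSideB.t (n / 2 ^ 30)| ≤ 332 / 100 := by
    simp only [upSideB, kap, rot]
    rw [abs_le]
    constructor <;> nlinarith
  refine ⟨_, fun K => by simp only [upB, force_eq]; rfl, ?_⟩
  exact ⟨cosZ_fZ_grid hn, sinZ_fZ_grid hn, sin_half_grid hn, cos_half_grid hn, sinZ_grid hn,
    ht.trans (by norm_num), (cosZ_near ht hb (by norm_num)).trans (by norm_num),
    (sinZ_near ht hb (by norm_num)).trans (by norm_num), (fZ_grid hn).trans (by norm_num)⟩

end SDPIE.Certificate

/-! ### Soundness of the tests and of the bisection; the kernel computations -/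

namespace SDPIE.Certificate
open Set

/-- The half-angle formula turns the cubic lower bound for the sine into this quartic upper bound.
-/
theorem cos_le_quartic {u : ℝ} (h0 : 0 ≤ u) (h1 : u ≤ 8 / 5) :
    Real.cos u ≤ 1 - u ^ 2 / 2 + u ^ 4 / 24 := by
  have h2 := Real.sin_ge_sub_cube (x := u / 2) (by positivity)
  have h3 : 0 ≤ u / 2 - (u / 2) ^ 3 / 6 := by nlinarith [mul_nonneg h0 h0]
  have h4 : Real.cos u = 1 - 2 * Real.sin (u / 2) ^ 2 := by
    rw [← Real.cos_sq_add_sin_sq (u / 2)]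
    have := Real.cos_two_mul' (u / 2)
    rw [show 2 * (u / 2) = u by ring] at this
    linarith
  have h5 := pow_le_pow_left₀ h3 h2 2
  rw [h4]
  nlinarith [sq_nonneg (u ^ 3)]

/-- The line `r (π - u) - l` is above the graph of the cosine on `[0, π / 2]`. -/
def IsLine (r l : ℝ) : Prop :=
  0 < r ∧ ∀ u : ℝ, 0 ≤ u → u ≤ Real.pi / 2 → Real.cos u ≤ r * (Real.pi - u) - l

theorem isLine_of_tangent {r l u₀ : ℝ} (h0 : 0 ≤ u₀) (h1 : u₀ ≤ 82 / 100) (hr : 0 < r)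
    (hr' : r ≤ u₀ - u₀ ^ 3 / 6)
    (hl : 1 - u₀ ^ 2 / 2 + u₀ ^ 4 / 24 + (u₀ - u₀ ^ 3 / 6) * u₀ ≤ r * 3.1415926535 - l) :
    IsLine r l := by
  refine ⟨hr, fun u hu0 hu1 => ?_⟩
  obtain ⟨p1, p2⟩ := pi_bounds
  have hu : u ≤ 8 / 5 := by linarith
  refine (cos_le_quartic hu0 hu).trans ?_
  -- The quartic minus its tangent at `u₀` equals `(u - u₀) ^ 2` times this factor.
  have hq : (u ^ 2 + 2 * (u * u₀) + 3 * u₀ ^ 2) / 24 - 1 / 2 ≤ 0 := by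
    nlinarith [mul_le_mul hu h1 h0 (by norm_num : (0 : ℝ) ≤ 8 / 5)]
  have h2 : 1 - u ^ 2 / 2 + u ^ 4 / 24 ≤
      1 - u₀ ^ 2 / 2 + u₀ ^ 4 / 24 - (u₀ - u₀ ^ 3 / 6) * (u - u₀) := by
    have := mul_nonpos_of_nonneg_of_nonpos (sq_nonneg (u - u₀)) hq
    nlinarith [this]
  nlinarith [mul_nonneg (sub_nonneg.2 hr') hu0, mul_pos hr (sub_pos.2 p1)]

variable {σ τ : Side}

/-- The corners of a cell and approximations of the values there. -/
structure IsCell (σ τ : Side) (x₀ x₁ y₀ y₁ : ℤ) (a₀ a₁ b₀ b₁ : PtData) : Prop where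
  hx₀ : InGrid x₀
  hx₁ : InGrid x₁
  hy₀ : InGrid y₀
  hy₁ : InGrid y₁
  ha₀ : IsApprox a₀ (σ.pt (x₀ / 2 ^ 30))
  ha₁ : IsApprox a₁ (σ.pt (x₁ / 2 ^ 30))
  hb₀ : IsApprox b₀ (τ.pt (y₀ / 2 ^ 30))
  hb₁ : IsApprox b₁ (τ.pt (y₁ / 2 ^ 30))

variable {x₀ x₁ y₀ y₁ : ℤ} {a₀ a₁ b₀ b₁ : PtData}

/-- The margin pays for both losses: the interpolation error of `cell_le`, twice the squared
diagonal, and the rounding error `1 / 2 ^ 17`. The number `s` is the fixed-point scale of `F`. -/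
theorem corners_sound {F : PtData → PtData → ℤ} {R : PtReal → PtReal → ℝ} {s : ℝ} (hs : 0 < s)
    (hF : ∀ a b p q, IsApprox a p → IsApprox b q → p.Bdd → q.Bdd →
      (F a b : ℝ) / s ≤ R p q + 1 / 2 ^ 17)
    (hσ : σ.Good) (hτ : τ.Good)
    (hx : ∀ y ∈ Icc (0 : ℝ) (16 / 5), Tame fun x => R (σ.pt x) (τ.pt y))
    (hy : ∀ x ∈ Icc (0 : ℝ) (16 / 5), Tame fun y => R (σ.pt x) (τ.pt y))
    (hc : IsCell σ τ x₀ x₁ y₀ y₁ a₀ a₁ b₀ b₁) {m : ℤ} (h : corners F m a₀ a₁ b₀ b₁ = true)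
    (hm : 2 * ((((x₁ - x₀) * (x₁ - x₀) + (y₁ - y₀) * (y₁ - y₀) : ℤ) : ℝ) / 2 ^ 60) + 1 / 2 ^ 17 ≤
      m / s) {x y : ℝ}
    (hxx : x ∈ Icc ((x₀ : ℝ) / 2 ^ 30) ((x₁ : ℝ) / 2 ^ 30))
    (hyy : y ∈ Icc ((y₀ : ℝ) / 2 ^ 30) ((y₁ : ℝ) / 2 ^ 30)) : 0 ≤ R (σ.pt x) (τ.pt y) := by
  simp only [corners, Bool.and_eq_true, nonnegZ_iff, sub_nonneg] at h
  obtain ⟨⟨⟨h00, h01⟩, h10⟩, h11⟩ := h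
  have key : ∀ {a b : PtData} {x y : ℝ}, IsApprox a (σ.pt x) → IsApprox b (τ.pt y) →
      x ∈ Icc (0 : ℝ) (16 / 5) → y ∈ Icc (0 : ℝ) (16 / 5) → m ≤ F a b →
      m / s - 1 / 2 ^ 17 ≤ R (σ.pt x) (τ.pt y) := fun {a b x y} ha hb hx hy h => by
    have h1 := hF _ _ _ _ ha hb (hσ.bdd hx) (hτ.bdd hy)
    have h2 : (m : ℝ) / s ≤ F a b / s := by
      have : (m : ℝ) ≤ F a b := by exact_mod_cast h
      gcongr
    linarith
  have := cell_le hx hy hc.hx₀.mem.1 hc.hx₁.mem.2 hc.hy₀.mem.1 hc.hy₁.mem.2 hxx hyy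
    (key hc.ha₀ hc.hb₀ hc.hx₀.mem hc.hy₀.mem h00) (key hc.ha₀ hc.hb₁ hc.hx₀.mem hc.hy₁.mem h01)
    (key hc.ha₁ hc.hb₀ hc.hx₁.mem hc.hy₀.mem h10) (key hc.ha₁ hc.hb₁ hc.hx₁.mem hc.hy₁.mem h11)
  refine le_trans ?_ this
  have e : (((x₁ : ℝ) / 2 ^ 30 - x₀ / 2 ^ 30) ^ 2 + ((y₁ : ℝ) / 2 ^ 30 - y₀ / 2 ^ 30) ^ 2) =
      (((x₁ - x₀) * (x₁ - x₀) + (y₁ - y₀) * (y₁ - y₀) : ℤ) : ℝ) / 2 ^ 60 := by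
    push_cast; ring
  rw [e]
  linarith

theorem margin_le (w : ℤ) : 2 * ((w : ℝ) / 2 ^ 60) + 1 / 2 ^ 17 ≤ (margin w : ℝ) / 2 ^ 120 := by
  have h : (margin w : ℝ) / 2 ^ 120 = 2 * (w / 2 ^ 60) + 1 / 2 ^ 16 := by
    rw [margin]; push_cast; ring
  rw [h]
  norm_num

/-- One of the two bounds from the triangle inequality for angles suffices. -/
def Triv (p q : PtReal) : Prop := 0 ≤ trivR₁ p q ∨ 0 ≤ trivR₂ p q

theorem testT_sound (hσ : σ.Good) (hτ : τ.Good) (hc : IsCell σ τ x₀ x₁ y₀ y₁ a₀ a₁ b₀ b₁)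
    (h : testT ((x₁ - x₀) * (x₁ - x₀) + (y₁ - y₀) * (y₁ - y₀)) a₀ a₁ b₀ b₁ = true) {x y : ℝ}
    (hx : x ∈ Icc ((x₀ : ℝ) / 2 ^ 30) ((x₁ : ℝ) / 2 ^ 30))
    (hy : y ∈ Icc ((y₀ : ℝ) / 2 ^ 30) ((y₁ : ℝ) / 2 ^ 30)) : Triv (σ.pt x) (τ.pt y) := by
  simp only [testT, force_eq, Bool.or_eq_true] at h
  have hm : ∀ w : ℤ, 2 * ((w : ℝ) / 2 ^ 60) + 1 / 2 ^ 17 ≤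
      ((2 * w / 2 ^ 30 + 2 ^ 14 : ℤ) : ℝ) / 2 ^ 30 := fun w => by
    have := abs_le.1 (abs_ediv_sub_le (2 * w) (2 ^ 30) (by positivity))
    push_cast at this ⊢
    linarith [this.1]
  rcases h with h | h
  · exact .inl (corners_sound (by positivity) (fun _ _ _ _ ha hb _ _ => trivZ₁_approx ha hb) hσ hτ
      (fun y _ => tame_trivR₁ hσ _) (fun x _ => by
        simpa only [trivR₁_comm] using tame_trivR₂ hτ _) hc h (hm _) hx hy)
  · exact .inr (corners_sound (by positivity) (fun _ _ _ _ ha hb _ _ => trivZ₂_approx ha hb) hσ hτ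
      (fun y _ => tame_trivR₂ hσ _) (fun x _ => by
        simpa only [← trivR₁_comm] using tame_trivR₁ hτ _) hc h (hm _) hx hy)

theorem testE_sound (hσ : σ.Good) (hτ : τ.Good) (hc : IsCell σ τ x₀ x₁ y₀ y₁ a₀ a₁ b₀ b₁)
    (h : testE ((x₁ - x₀) * (x₁ - x₀) + (y₁ - y₀) * (y₁ - y₀)) a₀ a₁ b₀ b₁ = true) {x y : ℝ}
    (hx : x ∈ Icc ((x₀ : ℝ) / 2 ^ 30) ((x₁ : ℝ) / 2 ^ 30))
    (hy : y ∈ Icc ((y₀ : ℝ) / 2 ^ 30) ((y₁ : ℝ) / 2 ^ 30)) :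
    Triv (σ.pt x) (τ.pt y) ∨ 0 ≤ edgeR (σ.pt x) (τ.pt y) := by
  simp only [testE, force_eq, Bool.or_eq_true] at h
  rcases h with h | h
  · exact .inl (testT_sound hσ hτ hc h hx hy)
  · exact .inr (corners_sound (by positivity) (fun _ _ _ _ => edgeZ_approx) hσ hτ
      (fun y hy => tame_edgeR hσ hτ hy)
      (fun x hx => by simpa only [edgeR_comm] using tame_edgeR hτ hσ hx) hc h (margin_le _) hx hy)

/-- The tests of `testB` succeed for some line. -/
def Tangent (p q : PtReal) : Prop :=
  ∃ r l v : ℝ, IsLine r l ∧ v ≤ kap * r ∧ 0 ≤ slopeR v p q ∧ 0 ≤ lineR r l p q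

theorem testB_sound (hσ : σ.Good) (hτ : τ.Good) {v r l : ℤ} {u : ℝ} (h0 : 0 ≤ u)
    (h1 : u ≤ 82 / 100) (hr : 0 < (r : ℝ) / 2 ^ 30) (hr' : (r : ℝ) / 2 ^ 30 ≤ u - u ^ 3 / 6)
    (hl : 1 - u ^ 2 / 2 + u ^ 4 / 24 + (u - u ^ 3 / 6) * u ≤
      (r : ℝ) / 2 ^ 30 * 3.1415926535 - (l : ℝ) / 2 ^ 60)
    (hv : (v : ℝ) / 2 ^ 30 ≤ 14237697905 / 10000000000 * (r / 2 ^ 30))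
    (hb : |(l : ℝ) / 2 ^ 60| ≤ 11 / 10 ∧ |(v : ℝ) / 2 ^ 30| ≤ 11 / 10 ∧ |(r : ℝ) / 2 ^ 30| ≤ 3 / 4)
    (hc : IsCell σ τ x₀ x₁ y₀ y₁ a₀ a₁ b₀ b₁)
    (h : testB ((x₁ - x₀) * (x₁ - x₀) + (y₁ - y₀) * (y₁ - y₀)) a₀ a₁ b₀ b₁ v r l = true) {x y : ℝ}
    (hx : x ∈ Icc ((x₀ : ℝ) / 2 ^ 30) ((x₁ : ℝ) / 2 ^ 30))
    (hy : y ∈ Icc ((y₀ : ℝ) / 2 ^ 30) ((y₁ : ℝ) / 2 ^ 30)) : Tangent (σ.pt x) (τ.pt y) := by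
  simp only [testB, force_eq, Bool.and_eq_true] at h
  have hm : ∀ w : ℤ, 2 * ((w : ℝ) / 2 ^ 60) + 1 / 2 ^ 17 ≤
      ((2 * w * 2 ^ 30 + 2 ^ 74 : ℤ) : ℝ) / 2 ^ 90 := fun w => by
    push_cast
    linarith
  refine ⟨r / 2 ^ 30, l / 2 ^ 60, v / 2 ^ 30, isLine_of_tangent h0 h1 hr hr' hl, ?_, ?_, ?_⟩
  · refine hv.trans (mul_le_mul_of_nonneg_right ?_ hr.le)
    rw [kap]
    linarith [pi_bounds.1]
  · exact corners_sound (by positivity) (fun _ _ _ _ => slopeZ_approx hb.2.1) hσ hτ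
      (fun y hy => tame_slopeR σ (hτ.bdd hy) hb.2.1)
      (fun x hx => by simpa only [slopeR_comm] using tame_slopeR τ (hσ.bdd hx) hb.2.1) hc h.1
      (hm _) hx hy
  · exact corners_sound (by positivity) (fun _ _ _ _ => lineZ_approx hb.2.2 hb.1) hσ hτ
      (fun y hy => tame_lineR hσ (hτ.bdd hy) hb.2.2 hb.1)
      (fun x hx => by simpa only [lineR_comm] using tame_lineR hτ (hσ.bdd hx) hb.2.2 hb.1) hc h.2
      (margin_le _) hx hy

theorem testI_sound (hσ : σ.Good) (hτ : τ.Good) (hc : IsCell σ τ x₀ x₁ y₀ y₁ a₀ a₁ b₀ b₁)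
    (h : testI ((x₁ - x₀) * (x₁ - x₀) + (y₁ - y₀) * (y₁ - y₀)) a₀ a₁ b₀ b₁ = true) {x y : ℝ}
    (hx : x ∈ Icc ((x₀ : ℝ) / 2 ^ 30) ((x₁ : ℝ) / 2 ^ 30))
    (hy : y ∈ Icc ((y₀ : ℝ) / 2 ^ 30) ((y₁ : ℝ) / 2 ^ 30)) :
    Triv (σ.pt x) (τ.pt y) ∨ 0 ≤ obtuseR (σ.pt x) (τ.pt y) ∨ Tangent (σ.pt x) (τ.pt y) := by
  simp only [testI, force_eq, Bool.or_eq_true] at h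
  rcases h with ((((h | h) | h) | h) | h) | h
  · exact .inl (testT_sound hσ hτ hc h hx hy)
  · exact .inr (.inl (corners_sound (by positivity) (fun _ _ _ _ => obtuseZ_approx) hσ hτ
      (fun y hy => tame_obtuseR hσ (hτ.bdd hy))
      (fun x hx => by simpa only [obtuseR_comm] using tame_obtuseR hτ (hσ.bdd hx)) hc h
      (margin_le _) hx hy))
  · exact .inr (.inr (testB_sound hσ hτ (u := 26 / 32)
      (by norm_num) (by norm_num) (by norm_num) (by norm_num)
      (by norm_num) (by norm_num) (by norm_num) hc h hx hy))
  · exact .inr (.inr (testB_sound hσ hτ (u := 19 / 32)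
      (by norm_num) (by norm_num) (by norm_num) (by norm_num)
      (by norm_num) (by norm_num) (by norm_num) hc h hx hy))
  · exact .inr (.inr (testB_sound hσ hτ (u := 12 / 32)
      (by norm_num) (by norm_num) (by norm_num) (by norm_num)
      (by norm_num) (by norm_num) (by norm_num) hc h hx hy))
  · exact .inr (.inr (testB_sound hσ hτ (u := 6 / 32)
      (by norm_num) (by norm_num) (by norm_num) (by norm_num)
      (by norm_num) (by norm_num) (by norm_num) hc h hx hy))

theorem bisect_succ (ga gb : ℤ → (PtData → Bool) → Bool) (skip : ℤ → ℤ → ℤ → ℤ → Bool)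
    (test : ℤ → PtData → PtData → PtData → PtData → Bool) (n : ℕ) (d : Bool) (x₀ x₁ y₀ y₁ : ℤ)
    (a₀ a₁ b₀ b₁ : PtData) : bisect ga gb skip test (n + 1) d x₀ x₁ y₀ y₁ a₀ a₁ b₀ b₁ =
      (skip x₀ x₁ y₀ y₁ ||
      (force ((x₁ - x₀) * (x₁ - x₀) + (y₁ - y₀) * (y₁ - y₀)) fun w => test w a₀ a₁ b₀ b₁) ||
      (match d with
       | true => force ((x₀ + x₁) / 2) fun m => ga m fun am =>
          bisect ga gb skip test n false x₀ m y₀ y₁ a₀ am b₀ b₁ &&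
            bisect ga gb skip test n false m x₁ y₀ y₁ am a₁ b₀ b₁
       | false => force ((y₀ + y₁) / 2) fun m => gb m fun bm =>
          bisect ga gb skip test n true x₀ x₁ y₀ m a₀ a₁ b₀ bm &&
            bisect ga gb skip test n true x₀ x₁ m y₁ a₀ a₁ bm b₁)) := by
  cases d <;> rfl

theorem bisect_sound {ga gb : ℤ → (PtData → Bool) → Bool} {skip : ℤ → ℤ → ℤ → ℤ → Bool}
    {test : ℤ → PtData → PtData → PtData → PtData → Bool} {P : ℝ → ℝ → Prop}
    (hga : Sound ga σ) (hgb : Sound gb τ)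
    (hskip : ∀ x₀ x₁ y₀ y₁, skip x₀ x₁ y₀ y₁ = true →
      ∀ x ∈ Icc ((x₀ : ℝ) / 2 ^ 30) ((x₁ : ℝ) / 2 ^ 30),
        ∀ y ∈ Icc ((y₀ : ℝ) / 2 ^ 30) ((y₁ : ℝ) / 2 ^ 30), P x y)
    (htest : ∀ x₀ x₁ y₀ y₁ a₀ a₁ b₀ b₁, IsCell σ τ x₀ x₁ y₀ y₁ a₀ a₁ b₀ b₁ →
      test ((x₁ - x₀) * (x₁ - x₀) + (y₁ - y₀) * (y₁ - y₀)) a₀ a₁ b₀ b₁ = true →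
      ∀ x ∈ Icc ((x₀ : ℝ) / 2 ^ 30) ((x₁ : ℝ) / 2 ^ 30),
        ∀ y ∈ Icc ((y₀ : ℝ) / 2 ^ 30) ((y₁ : ℝ) / 2 ^ 30), P x y)
    (n : ℕ) : ∀ d x₀ x₁ y₀ y₁ a₀ a₁ b₀ b₁, IsCell σ τ x₀ x₁ y₀ y₁ a₀ a₁ b₀ b₁ →
      bisect ga gb skip test n d x₀ x₁ y₀ y₁ a₀ a₁ b₀ b₁ = true →
      ∀ x ∈ Icc ((x₀ : ℝ) / 2 ^ 30) ((x₁ : ℝ) / 2 ^ 30),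
        ∀ y ∈ Icc ((y₀ : ℝ) / 2 ^ 30) ((y₁ : ℝ) / 2 ^ 30),
        P x y := by
  have mid : ∀ {u v : ℤ}, InGrid u → InGrid v → InGrid ((u + v) / 2) := fun hu hv => by
    unfold InGrid at *; omega
  induction n with
  | zero => intro d x₀ x₁ y₀ y₁ a₀ a₁ b₀ b₁ _ h; exact absurd h (by simp [bisect])
  | succ n ih =>
    intro d x₀ x₁ y₀ y₁ a₀ a₁ b₀ b₁ hc h x hx y hy
    rw [bisect_succ, force_eq, Bool.or_eq_true, Bool.or_eq_true] at h
    rcases h with (h | h) | h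
    · exact hskip _ _ _ _ h x hx y hy
    · exact htest _ _ _ _ _ _ _ _ hc h x hx y hy
    · cases d with
      | true =>
        simp only [force_eq] at h
        have hm := mid hc.hx₀ hc.hx₁
        obtain ⟨am, hK, ham⟩ := hga _ hm
        rw [hK, Bool.and_eq_true] at h
        rcases le_total x ((((x₀ + x₁) / 2 : ℤ) : ℝ) / 2 ^ 30) with hxm | hxm
        · exact ih _ _ _ _ _ _ _ _ _ ⟨hc.hx₀, hm, hc.hy₀, hc.hy₁, hc.ha₀, ham, hc.hb₀, hc.hb₁⟩ h.1
            x ⟨hx.1, hxm⟩ y hy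
        · exact ih _ _ _ _ _ _ _ _ _ ⟨hm, hc.hx₁, hc.hy₀, hc.hy₁, ham, hc.ha₁, hc.hb₀, hc.hb₁⟩ h.2
            x ⟨hxm, hx.2⟩ y hy
      | false =>
        simp only [force_eq] at h
        have hm := mid hc.hy₀ hc.hy₁
        obtain ⟨bm, hK, hbm⟩ := hgb _ hm
        rw [hK, Bool.and_eq_true] at h
        rcases le_total y ((((y₀ + y₁) / 2 : ℤ) : ℝ) / 2 ^ 30) with hym | hym
        · exact ih _ _ _ _ _ _ _ _ _ ⟨hc.hx₀, hc.hx₁, hc.hy₀, hm, hc.ha₀, hc.ha₁, hc.hb₀, hbm⟩ h.1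
            x hx y ⟨hy.1, hym⟩
        · exact ih _ _ _ _ _ _ _ _ _ ⟨hc.hx₀, hc.hx₁, hm, hc.hy₁, hc.ha₀, hc.ha₁, hbm, hc.hb₁⟩ h.2
            x hx y ⟨hym, hy.2⟩

theorem run_sound {ga gb : ℤ → (PtData → Bool) → Bool} {skip : ℤ → ℤ → ℤ → ℤ → Bool}
    {test : ℤ → PtData → PtData → PtData → PtData → Bool} {P : ℝ → ℝ → Prop}
    (hga : Sound ga σ) (hgb : Sound gb τ)
    (hskip : ∀ x₀ x₁ y₀ y₁, skip x₀ x₁ y₀ y₁ = true →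
      ∀ x ∈ Icc ((x₀ : ℝ) / 2 ^ 30) ((x₁ : ℝ) / 2 ^ 30),
        ∀ y ∈ Icc ((y₀ : ℝ) / 2 ^ 30) ((y₁ : ℝ) / 2 ^ 30), P x y)
    (htest : ∀ x₀ x₁ y₀ y₁ a₀ a₁ b₀ b₁, IsCell σ τ x₀ x₁ y₀ y₁ a₀ a₁ b₀ b₁ →
      test ((x₁ - x₀) * (x₁ - x₀) + (y₁ - y₀) * (y₁ - y₀)) a₀ a₁ b₀ b₁ = true →
      ∀ x ∈ Icc ((x₀ : ℝ) / 2 ^ 30) ((x₁ : ℝ) / 2 ^ 30),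
        ∀ y ∈ Icc ((y₀ : ℝ) / 2 ^ 30) ((y₁ : ℝ) / 2 ^ 30), P x y)
    (h : run ga gb skip test = true) {x y : ℝ} (hx : x ∈ Icc 0 Real.pi)
    (hy : y ∈ Icc (17 / 100) Real.pi) : P x y := by
  have g0 : InGrid 0 := by norm_num [InGrid]
  have g1 : InGrid 3373260800 := by norm_num [InGrid]
  have g2 : InGrid 182536110 := by norm_num [InGrid]
  obtain ⟨a₀, ka₀, ha₀⟩ := hga _ g0
  obtain ⟨a₁, ka₁, ha₁⟩ := hga _ g1
  obtain ⟨b₀, kb₀, hb₀⟩ := hgb _ g2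
  obtain ⟨b₁, kb₁, hb₁⟩ := hgb _ g1
  rw [run, ka₀, ka₁, kb₀, kb₁] at h
  obtain ⟨-, p2⟩ := pi_bounds
  refine bisect_sound hga hgb hskip htest _ _ _ _ _ _ _ _ _ _
    ⟨g0, g1, g2, g1, ha₀, ha₁, hb₀, hb₁⟩ h x ⟨?_, ?_⟩ y ⟨?_, ?_⟩
  · simpa using hx.1
  · refine hx.2.trans (p2.le.trans ?_); norm_num
  · refine le_trans ?_ hy.1; norm_num
  · refine hy.2.trans (p2.le.trans ?_); norm_num

theorem skipLow_sound {Q : ℝ → ℝ → Prop} (x₀ x₁ y₀ y₁ : ℤ) (h : skipLow x₀ x₁ y₀ y₁ = true) :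
    ∀ x ∈ Icc ((x₀ : ℝ) / 2 ^ 30) ((x₁ : ℝ) / 2 ^ 30),
        ∀ y ∈ Icc ((y₀ : ℝ) / 2 ^ 30) ((y₁ : ℝ) / 2 ^ 30),
      x + y ≤ Real.pi → Q x y := by
  intro x hx y hy hxy
  rw [skipLow, nonnegZ_iff] at h
  have h' : (0 : ℝ) ≤ x₀ + y₀ - 3373259427 := by exact_mod_cast h
  have : (3373259427 : ℝ) / 2 ^ 30 ≤ x + y := by linarith [hx.1, hy.1]
  have p2 := Real.pi_lt_d20
  norm_num at this p2
  linarith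

theorem skipUp_sound {Q : ℝ → ℝ → Prop} (x₀ x₁ y₀ y₁ : ℤ) (h : skipUp x₀ x₁ y₀ y₁ = true) :
    ∀ x ∈ Icc ((x₀ : ℝ) / 2 ^ 30) ((x₁ : ℝ) / 2 ^ 30),
        ∀ y ∈ Icc ((y₀ : ℝ) / 2 ^ 30) ((y₁ : ℝ) / 2 ^ 30),
      Real.pi ≤ x + y → Q x y := by
  intro x hx y hy hxy
  rw [skipUp, nonnegZ_iff] at h
  have h' : (0 : ℝ) ≤ 3373259426 - x₁ - y₁ := by exact_mod_cast h
  have : x + y ≤ (3373259426 : ℝ) / 2 ^ 30 := by linarith [hx.2, hy.2]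
  have p1 := Real.pi_gt_d20
  norm_num at this p1
  linarith

-- The numerical core: one evaluation for each case of a + b against π and for each of the two
-- conditions, at c₀ and in the convex region.
set_option maxRecDepth 100000 in
theorem run_lowE : run lowA lowB skipLow testE = true := by decide +kernel
set_option maxRecDepth 100000 in
theorem run_upE : run upA upB skipUp testE = true := by decide +kernel
set_option maxRecDepth 100000 in
theorem run_lowI : run lowA lowB skipLow testI = true := by decide +kernel
set_option maxRecDepth 100000 in
theorem run_upI : run upA upB skipUp testI = true := by decide +kernel

theorem low_edge {x y : ℝ} (hx : x ∈ Icc 0 Real.pi) (hy : y ∈ Icc (17 / 100) Real.pi)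
    (h : x + y ≤ Real.pi) : Triv (lowSideA.pt x) (lowSideB.pt y) ∨
      0 ≤ edgeR (lowSideA.pt x) (lowSideB.pt y) :=
  run_sound (P := fun x y => x + y ≤ Real.pi → Triv (lowSideA.pt x) (lowSideB.pt y) ∨
      0 ≤ edgeR (lowSideA.pt x) (lowSideB.pt y)) lowA_sound lowB_sound skipLow_sound
    (fun _ _ _ _ _ _ _ _ hc ht _ hx _ hy _ =>
      testE_sound lowSideA_good lowSideB_good hc ht hx hy) run_lowE hx hy h

theorem up_edge {x y : ℝ} (hx : x ∈ Icc 0 Real.pi) (hy : y ∈ Icc (17 / 100) Real.pi)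
    (h : Real.pi ≤ x + y) : Triv (upSideA.pt x) (upSideB.pt y) ∨
      0 ≤ edgeR (upSideA.pt x) (upSideB.pt y) :=
  run_sound (P := fun x y => Real.pi ≤ x + y → Triv (upSideA.pt x) (upSideB.pt y) ∨
      0 ≤ edgeR (upSideA.pt x) (upSideB.pt y)) upA_sound upB_sound skipUp_sound
    (fun _ _ _ _ _ _ _ _ hc ht _ hx _ hy _ =>
      testE_sound upSideA_good upSideB_good hc ht hx hy) run_upE hx hy h

theorem low_interior {x y : ℝ} (hx : x ∈ Icc 0 Real.pi) (hy : y ∈ Icc (17 / 100) Real.pi)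
    (h : x + y ≤ Real.pi) : Triv (lowSideA.pt x) (lowSideB.pt y) ∨
      0 ≤ obtuseR (lowSideA.pt x) (lowSideB.pt y) ∨ Tangent (lowSideA.pt x) (lowSideB.pt y) :=
  run_sound (P := fun x y => x + y ≤ Real.pi → Triv (lowSideA.pt x) (lowSideB.pt y) ∨
      0 ≤ obtuseR (lowSideA.pt x) (lowSideB.pt y) ∨ Tangent (lowSideA.pt x) (lowSideB.pt y))
    lowA_sound lowB_sound skipLow_sound (fun _ _ _ _ _ _ _ _ hc ht _ hx _ hy _ =>
      testI_sound lowSideA_good lowSideB_good hc ht hx hy) run_lowI hx hy h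

theorem up_interior {x y : ℝ} (hx : x ∈ Icc 0 Real.pi) (hy : y ∈ Icc (17 / 100) Real.pi)
    (h : Real.pi ≤ x + y) : Triv (upSideA.pt x) (upSideB.pt y) ∨
      0 ≤ obtuseR (upSideA.pt x) (upSideB.pt y) ∨ Tangent (upSideA.pt x) (upSideB.pt y) :=
  run_sound (P := fun x y => Real.pi ≤ x + y → Triv (upSideA.pt x) (upSideB.pt y) ∨
      0 ≤ obtuseR (upSideA.pt x) (upSideB.pt y) ∨ Tangent (upSideA.pt x) (upSideB.pt y))
    upA_sound upB_sound skipUp_sound (fun _ _ _ _ _ _ _ _ hc ht _ hx _ hy _ =>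
      testI_sound upSideA_good upSideB_good hc ht hx hy) run_upI hx hy h

end SDPIE.Certificate

/-! ### The arccosine against an affine function of the dihedral cosine -/

namespace SDPIE.Certificate
open Set

theorem cos_le_tangent {u v : ℝ} (hu0 : 0 ≤ u) (hu : u ≤ Real.pi / 2) (hv0 : 0 ≤ v)
    (hv : v ≤ Real.pi / 2) : Real.cos u ≤ Real.cos v - Real.sin v * (u - v) := by
  rcases le_total u v with h | h
  · have h1 : Real.cos u = Real.cos v * Real.cos (v - u) + Real.sin v * Real.sin (v - u) := by
      rw [← Real.cos_sub]; ring_nf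
    have h2 := Real.sin_le (sub_nonneg.2 h)
    have h3 := Real.cos_le_one (v - u)
    have h4 := Real.cos_nonneg_of_neg_pi_div_two_le_of_le (by linarith) hv
    have h5 := Real.sin_nonneg_of_nonneg_of_le_pi hv0 (by linarith)
    nlinarith [mul_nonneg h5 (sub_nonneg.2 h2), mul_nonneg h4 (sub_nonneg.2 h3)]
  · have h2 : ∀ t ∈ interior (Icc v u), deriv Real.cos t ≤ -Real.sin v := fun t ht => by
      rw [interior_Icc] at ht
      rw [Real.deriv_cos]
      have := Real.sin_le_sin_of_le_of_le_pi_div_two (by linarith) (by linarith [ht.2]) ht.1.le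
      linarith
    have := Convex.image_sub_le_mul_sub_of_deriv_le (convex_Icc v u) Real.continuous_cos.continuousOn
      Real.differentiable_cos.differentiableOn h2 v ⟨le_rfl, h⟩ u ⟨h, le_rfl⟩ h
    linarith

theorem one_sub_cos_le {t : ℝ} (h0 : 0 ≤ t) (h1 : t ≤ Real.pi) :
    1 - Real.cos t ≤ 83 / 100 * t := by
  obtain ⟨p1, p2⟩ := pi_bounds
  rcases le_total t (Real.pi / 2) with h | h
  · have := Real.one_sub_sq_div_two_le_cos (x := t)
    nlinarith
  · have := Real.sin_le (sub_nonneg.2 h)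
    rw [Real.sin_sub_pi_div_two] at this
    linarith

/-- The first term cancels against the objective; what matters afterwards is the sign and growth of
the bracketed excess. -/
theorem rot_eq (t : ℝ) : rot t = kap * (1 - Real.cos t) + (278 / 1000 * t -
    922 / 10000 * Real.pi * (1 - Real.cos t)) := by
  rw [rot, kap]; ring

/-- The constant 0.024 is 2 · (0.29 - 0.278), twice the bound on the rate at which the excess can
decrease; `upper_face_le` needs exactly this ratio. -/
theorem excess_ge {t : ℝ} (h0 : 0 ≤ t) (h1 : t ≤ Real.pi) :
    24 / 1000 * t ≤ 278 / 1000 * t - 922 / 10000 * Real.pi * (1 - Real.cos t) := by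
  have h2 := one_sub_cos_le h0 h1
  have h3 : 922 / 10000 * Real.pi ≤ 29 / 100 := by linarith [pi_bounds.2]
  have := mul_le_mul h3 h2 (by linarith [Real.cos_le_one t]) (by norm_num)
  linarith

theorem kap_mul_le_rot {t : ℝ} (h0 : 0 ≤ t) (h1 : t ≤ Real.pi) :
    kap * (1 - Real.cos t) ≤ rot t := by
  rw [rot_eq]; linarith [excess_ge h0 h1]

theorem rot_pi_sub (t : ℝ) : rot (Real.pi - t) = Real.pi - rot t := by
  rw [rot, rot, Real.cos_pi_sub]; ring

theorem rot_mono {s t : ℝ} (h0 : 0 ≤ s) (h : s ≤ t) (h1 : t ≤ Real.pi) : rot s ≤ rot t := by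
  have := Real.cos_le_cos_of_nonneg_of_le_pi h0 h1 h
  unfold rot
  nlinarith [Real.pi_pos]

theorem rot_zero : rot 0 = 0 := by simp [rot]

theorem rot_pi : rot Real.pi = Real.pi := by
  have := rot_pi_sub 0
  rwa [sub_zero, rot_zero, sub_zero] at this

theorem rot_mem {t : ℝ} (ht : t ∈ Icc 0 Real.pi) : rot t ∈ Icc 0 Real.pi :=
  ⟨rot_zero.symm.trans_le (rot_mono le_rfl ht.1 ht.2), (rot_mono ht.1 ht.2 le_rfl).trans_eq rot_pi⟩

theorem sin_rot_nonneg {t : ℝ} (ht : t ∈ Icc 0 Real.pi) : 0 ≤ Real.sin (rot t) :=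
  Real.sin_nonneg_of_nonneg_of_le_pi (rot_mem ht).1 (rot_mem ht).2

/-- Jordan's inequality cos t ≥ 1 - 2t/π gives `rot t ≤ t` on [0, π/2], and t ↦ π - t covers the
other half. This yields M ≤ sin a sin b. -/
theorem sin_rot_le {t : ℝ} (ht : t ∈ Icc 0 Real.pi) : Real.sin (rot t) ≤ Real.sin t := by
  have key : ∀ s, 0 ≤ s → s ≤ Real.pi / 2 → Real.sin (rot s) ≤ Real.sin s := fun s h0 h1 => by
    have hp := Real.pi_pos
    refine Real.sin_le_sin_of_le_of_le_pi_div_two ?_ h1 ?_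
    · linarith [(rot_mem (t := s) ⟨h0, by linarith⟩).1]
    · have := Real.one_sub_mul_le_cos h0 h1
      have h2 : Real.pi * (1 - Real.cos s) ≤ 2 * s := by
        have h3 := mul_le_mul_of_nonneg_left this hp.le
        have h4 : Real.pi * (1 - 2 / Real.pi * s) = Real.pi - 2 * s := by field_simp
        linarith
      unfold rot
      linarith
  rcases le_total t (Real.pi / 2) with h | h
  · exact key t ht.1 h
  · have := key (Real.pi - t) (by linarith [ht.2]) (by linarith)
    rwa [rot_pi_sub, Real.sin_pi_sub, Real.sin_pi_sub] at this

theorem kap_pos : 0 < kap := by unfold kap; positivity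

/-- On [-0.709, 0] the arccosine has slope at most 1/√(1 - 0.709²) < 1/0.705 < `kap` in absolute
value, so it falls no faster than the affine side. -/
theorem le_arccos_of_obtuse {P M s T₀ c₀ c : ℝ} (hM0 : 0 ≤ M) (hM : M ≤ s) (h₀ : c₀ ≤ c)
    (hob : -(709 / 1000) ≤ P + M * c₀) (hw : P + M * c ≤ 0) (hT : T₀ ≤ Real.arccos (P + M * c₀)) :
    T₀ - kap * s * (c - c₀) ≤ Real.arccos (P + M * c) := by
  have hd : 0 ≤ M * (c - c₀) := mul_nonneg hM0 (sub_nonneg.2 h₀)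
  have hM' : M * (c - c₀) ≤ s * (c - c₀) := mul_le_mul_of_nonneg_right hM (sub_nonneg.2 h₀)
  have e : M * (c - c₀) = (P + M * c) - (P + M * c₀) := by ring
  have e' : kap * s * (c - c₀) = kap * (s * (c - c₀)) := by ring
  rw [e] at hd hM'
  rw [e']
  generalize P + M * c₀ = w₀ at *
  generalize P + M * c = w at *
  generalize s * (c - c₀) = m at *
  have hφ0 : Real.pi / 2 ≤ Real.arccos w := by
    rw [← not_lt, Real.arccos_lt_pi_div_two]; linarith
  have hψ0 : Real.pi / 2 ≤ Real.arccos w₀ := by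
    rw [← not_lt, Real.arccos_lt_pi_div_two]; linarith
  have hsψ : 705 / 1000 ≤ Real.sin (Real.arccos w₀) := by
    refine (Real.le_sqrt_of_sq_le ?_).trans_eq (Real.sin_arccos _).symm
    nlinarith
  have ht := cos_le_tangent (u := Real.pi - Real.arccos w) (v := Real.pi - Real.arccos w₀)
    (by linarith [Real.arccos_le_pi w]) (by linarith) (by linarith [Real.arccos_le_pi w₀])
    (by linarith)
  rw [Real.cos_pi_sub, Real.cos_pi_sub, Real.sin_pi_sub, Real.cos_arccos (by linarith) (by linarith),
    Real.cos_arccos (by linarith) (by linarith)] at ht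
  have hge : 0 ≤ Real.arccos w₀ - Real.arccos w :=
    sub_nonneg.2 (Real.arccos_le_arccos (by linarith))
  have h2 := mul_le_mul_of_nonneg_right hsψ hge
  have h3 : 1 ≤ kap * (705 / 1000) := by
    unfold kap; linarith [pi_bounds.1]
  have h5 := mul_le_mul_of_nonneg_right h3 hge
  have h6 : 705 / 1000 * (Real.arccos w₀ - Real.arccos w) ≤ m := by linarith
  have h4 := mul_le_mul_of_nonneg_left h6 kap_pos.le
  linarith

/-- With u = π - arccos w, `IsLine` says arccos w ≥ (l - w) / r for w ∈ [-1, 0]. This line dominates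
the affine side at c₀ and is no steeper in c. -/
theorem le_arccos_of_tangent {P M s T₀ c₀ c r l : ℝ} (hM : M ≤ kap * r * s)
    (h₀ : c₀ ≤ c) (hw1 : -1 ≤ P + M * c) (hw : P + M * c ≤ 0) (hr : IsLine r l)
    (hT : P + M * c₀ ≤ l - r * T₀) :
    T₀ - kap * s * (c - c₀) ≤ Real.arccos (P + M * c) := by
  have hφ0 : Real.pi / 2 ≤ Real.arccos (P + M * c) := by
    rw [← not_lt, Real.arccos_lt_pi_div_two]; linarith
  have h2 := hr.2 (Real.pi - Real.arccos (P + M * c)) (by linarith [Real.arccos_le_pi (P + M * c)])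
    (by linarith)
  rw [Real.cos_pi_sub, Real.cos_arccos hw1 (by linarith)] at h2
  have h5 := mul_le_mul_of_nonneg_right hM (sub_nonneg.2 h₀)
  have h6 : r * (T₀ - kap * s * (c - c₀)) ≤ r * Real.arccos (P + M * c) := by linarith
  exact le_of_mul_le_mul_left h6 hr.1

/-- Below a concave function at both ends, a linear function is below it in between. -/
theorem le_arccos_of_endpoints {P M T K c' c₁ c : ℝ} (hM : 0 ≤ M) (h' : c' ≤ c) (h₁ : c ≤ c₁)
    (hw' : 0 ≤ P + M * c') (hw₁ : P + M * c₁ ≤ 1) (hT' : T - K * c' ≤ Real.arccos (P + M * c'))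
    (hT₁ : T - K * c₁ ≤ Real.arccos (P + M * c₁)) : T - K * c ≤ Real.arccos (P + M * c) := by
  rcases h'.eq_or_lt with rfl | hlt
  · exact hT'
  have hw₁' : 0 ≤ P + M * c₁ := by nlinarith
  have hw'' : P + M * c' ≤ 1 := by nlinarith
  have e₁ := Real.cos_arccos (by linarith) hw₁
  have e' := Real.cos_arccos (by linarith) hw''
  have g1 := Real.arccos_nonneg (P + M * c₁)
  have g2 := Real.arccos_nonneg (P + M * c')
  have g3 := Real.arccos_le_pi_div_two.2 hw₁'
  have g4 := Real.arccos_le_pi_div_two.2 hw'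
  set φ₁ := Real.arccos (P + M * c₁)
  set φ' := Real.arccos (P + M * c')
  have hpi := Real.pi_pos
  obtain ⟨x, y, hx, hy, hxy, hc⟩ : ∃ x y : ℝ, 0 ≤ x ∧ 0 ≤ y ∧ x + y = 1 ∧ c = x * c' + y * c₁ := by
    have hpos' : 0 < c₁ - c' := by linarith
    exact ⟨(c₁ - c) / (c₁ - c'), (c - c') / (c₁ - c'), div_nonneg (by linarith) hpos'.le,
      div_nonneg (by linarith) hpos'.le, by field_simp; ring, by field_simp; ring⟩
  -- Concavity of the arccosine on [0, 1] is obtained from that of the cosine on [0, π/2], since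
  -- both are decreasing there.
  have hcc := strictConcaveOn_cos_Icc.concaveOn.2 (x := φ') ⟨by linarith, g4⟩ (y := φ₁)
    ⟨by linarith, g3⟩ hx hy hxy
  simp only [smul_eq_mul] at hcc
  rw [e₁, e'] at hcc
  obtain rfl : x = 1 - y := by linarith
  have h7 : P + M * c ≤ Real.cos ((1 - y) * φ' + y * φ₁) := by
    refine le_trans (le_of_eq ?_) hcc
    rw [hc]; ring
  have h8 : (1 - y) * φ' + y * φ₁ ≤ Real.arccos (P + M * c) := by
    rw [← Real.arccos_cos (x := (1 - y) * φ' + y * φ₁) (by positivity) (by nlinarith)]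
    exact Real.arccos_le_arccos h7
  refine le_trans ?_ h8
  have h9 := mul_le_mul_of_nonneg_left hT' hx
  have h10 := mul_le_mul_of_nonneg_left hT₁ hy
  have h11 : T - K * c = (1 - y) * (T - K * c') + y * (T - K * c₁) := by rw [hc]; ring
  linarith

/-- The convex region is crossed from c₀ by one of the two preceding lemmas, up to the zero of P + M
c; the concave region is then bridged between that zero and c₁. -/
theorem le_arccos_of_face {p q : PtReal} {D c₀ c₁ c : ℝ} (hh : 0 < p.h * q.h)
    (hk : p.k * q.k = -c₀ * (p.h * q.h)) (hS : 0 ≤ p.S * q.S) (hs : p.S * q.S ≤ p.s * q.s)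
    (hct : p.ct * q.ct - p.st * q.st = Real.cos (p.t + q.t))
    (hw1 : p.C * q.C + p.S * q.S ≤ 1)
    (hD : ∀ c ≤ 1, D ≤ Real.arccos (p.C * q.C + p.S * q.S * c))
    (hT₀ : p.t + q.t ≤ Real.pi) (hT₁ : p.t + q.t - kap * (p.s * q.s) * (c₁ - c₀) ≤ D)
    (h₀ : c₀ ≤ c) (h₁ : c ≤ c₁) (h1 : c₁ ≤ 1) (hE : 0 ≤ edgeR p q)
    (hI : 0 ≤ obtuseR p q ∨ Tangent p q) :
    p.t + q.t - kap * (p.s * q.s) * (c - c₀) ≤ Real.arccos (p.C * q.C + p.S * q.S * c) := by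
  have hE' : p.C * q.C + p.S * q.S * c₀ ≤ Real.cos (p.t + q.t) := by
    have : 0 ≤ p.h * q.h * (Real.cos (p.t + q.t) - (p.C * q.C + p.S * q.S * c₀)) := by
      rw [edgeR, hct, hk] at hE; linarith
    linarith [nonneg_of_mul_nonneg_right this hh]
  have hI' : -(709 / 1000) ≤ p.C * q.C + p.S * q.S * c₀ ∨ ∃ r l : ℝ, IsLine r l ∧
      p.S * q.S ≤ kap * r * (p.s * q.s) ∧ p.C * q.C + p.S * q.S * c₀ ≤ l - r * (p.t + q.t) := by
    rcases hI with hI | ⟨r, l, v, hr, hv, hI1, hI2⟩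
    · left
      have : 0 ≤ p.h * q.h * ((p.C * q.C + p.S * q.S * c₀) + 709 / 1000) := by
        rw [obtuseR, hk] at hI; linarith
      linarith [nonneg_of_mul_nonneg_right this hh]
    · refine .inr ⟨r, l, hr, ?_, ?_⟩
      · rw [slopeR] at hI1
        linarith [mul_le_mul_of_nonneg_right hv (hS.trans hs)]
      · have : 0 ≤ p.h * q.h * ((l - r * (p.t + q.t)) - (p.C * q.C + p.S * q.S * c₀)) := by
          rw [lineR, hk] at hI2; linarith
        linarith [nonneg_of_mul_nonneg_right this hh]
  clear hI hE hh hk hct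
  generalize p.t + q.t = T₀ at *
  generalize p.C * q.C = P at *
  generalize p.S * q.S = M at *
  generalize p.s * q.s = s at *
  have hks : ∀ {c}, c₀ ≤ c → 0 ≤ kap * s * (c - c₀) := fun h =>
    mul_nonneg (mul_nonneg kap_pos.le (hS.trans hs)) (sub_nonneg.2 h)
  have hwle : ∀ c ≤ 1, P + M * c ≤ 1 := fun c hc => by nlinarith
  have hstart : 0 ≤ T₀ → T₀ ≤ Real.arccos (P + M * c₀) := fun h =>
    (Real.arccos_cos h hT₀).symm.trans_le (Real.arccos_le_arccos hE')
  rcases lt_or_ge T₀ 0 with hneg | hpos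
  · linarith [Real.arccos_nonneg (P + M * c), hks h₀]
  have hle : ∀ c, c₀ ≤ c → c ≤ 1 → P + M * c ≤ 0 →
      T₀ - kap * s * (c - c₀) ≤ Real.arccos (P + M * c) := fun c h₀ h1 hw => by
    rcases lt_or_ge (P + M * c) (-1) with hlt | hge
    · rw [Real.arccos_of_le_neg_one hlt.le]
      linarith [hks h₀]
    rcases hI' with hI | ⟨r, l, hr, hI1, hI2⟩
    · exact le_arccos_of_obtuse hS hs h₀ hI hw (hstart hpos)
    · exact le_arccos_of_tangent hI1 h₀ hge hw hr hI2
  rcases le_or_gt (P + M * c) 0 with hw | hw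
  · exact hle c h₀ (h₁.trans h1) hw
  -- The start of the concave region: c₀ itself if P + M c₀ ≥ 0, otherwise the zero -P / M, where
  -- `hle` still applies.
  obtain ⟨c', hc', hw', hT'⟩ : ∃ c', c' ≤ c ∧ 0 ≤ P + M * c' ∧
      T₀ - kap * s * (c' - c₀) ≤ Real.arccos (P + M * c') := by
    rcases le_or_gt 0 (P + M * c₀) with h | h
    · exact ⟨c₀, h₀, h, by simpa using hstart hpos⟩
    · have hMp : 0 < M := by
        rcases hS.lt_or_eq with h' | h'
        · exact h'
        · rw [← h'] at h hw; linarith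
      have he : P + M * (-P / M) = 0 := by field_simp; ring
      have h3 : c₀ ≤ -P / M := by rw [le_div_iff₀ hMp]; linarith
      have h4 : -P / M ≤ c := by rw [div_le_iff₀ hMp]; linarith
      exact ⟨-P / M, h4, he.ge, hle _ h3 (h4.trans (h₁.trans h1)) he.le⟩
  have := le_arccos_of_endpoints (T := T₀ + kap * s * c₀) (K := kap * s) hS hc' h₁ hw'
    (hwle _ h1) (by linarith) (by linarith [hD c₁ h1])
  linarith

end SDPIE.Certificate

/-! ### The ends of the range of c, and the key inequality -/

namespace SDPIE.Certificate
open Set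

theorem abs_sub_le_arccos {A B c : ℝ} (hA : A ∈ Icc 0 Real.pi) (hB : B ∈ Icc 0 Real.pi)
    (hc : c ≤ 1) :
    |A - B| ≤ Real.arccos (Real.cos A * Real.cos B + Real.sin A * Real.sin B * c) := by
  have h : |A - B| ≤ Real.pi := by
    rw [abs_le]; constructor <;> linarith [hA.1, hA.2, hB.1, hB.2]
  rw [← Real.arccos_cos (abs_nonneg (A - B)) h, Real.cos_abs, Real.cos_sub]
  refine Real.arccos_le_arccos ?_
  have := mul_nonneg (Real.sin_nonneg_of_nonneg_of_le_pi hA.1 hA.2)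
    (Real.sin_nonneg_of_nonneg_of_le_pi hB.1 hB.2)
  linarith [mul_le_of_le_one_right this hc]

theorem Triv.le {p q : PtReal} (h : Triv p q) : p.t + q.t ≤ |p.A - q.A| := by
  rcases h with h | h
  · rw [trivR₁] at h; linarith [neg_abs_le (p.A - q.A)]
  · rw [trivR₂] at h; linarith [le_abs_self (p.A - q.A)]

variable {a b : ℝ}

/-- With e the excess of `rot_eq`, the case b ≤ a reduces to e(b) ≥ 0 and the case a ≤ b to 2 e(a) ≤
3 e(b). The latter holds since e(b) ≥ 0.024 b and e(a) - e(b) ≤ 0.012 (b - a). -/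
theorem upper_face_le (ha : a ∈ Icc 0 Real.pi) (hb : b ∈ Icc 0 Real.pi) :
    rot a - 2 * rot b + kap * (2 + Real.cos a - 2 * Real.cos b - (1 - |Real.cos a - Real.cos b|)) ≤
      |rot a - rot b| := by
  have ra := excess_ge ha.1 ha.2
  have rb := excess_ge hb.1 hb.2
  rcases le_total b a with h | h
  · have hx := Real.cos_le_cos_of_nonneg_of_le_pi hb.1 ha.2 h
    rw [abs_of_nonpos (sub_nonpos.2 hx)]
    linarith [le_abs_self (rot a - rot b), kap_mul_le_rot hb.1 hb.2]
  · have hx := Real.cos_le_cos_of_nonneg_of_le_pi ha.1 hb.2 h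
    rw [abs_of_nonneg (sub_nonneg.2 hx)]
    have hl : Real.cos a - Real.cos b ≤ b - a := by
      have := Real.abs_cos_sub_cos_le a b
      rw [abs_sub_comm a b, abs_of_nonneg (sub_nonneg.2 h)] at this
      exact (le_abs_self _).trans this
    have h3 : 922 / 10000 * Real.pi ≤ 29 / 100 := by linarith [pi_bounds.2]
    have h4 := mul_le_mul h3 hl (sub_nonneg.2 hx) (by norm_num)
    have ea := rot_eq a
    have eb := rot_eq b
    linarith [neg_abs_le (rot a - rot b), ha.1, hb.1]

/-- L(c₀) ≤ π is what allows P + M c₀ ≤ cos L(c₀) to be inverted by the arccosine. -/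
theorem lower_face_le_pi (ha : a ∈ Icc 0 Real.pi) (hb : b ∈ Icc 0 Real.pi)
    (h : a + b ≤ Real.pi) : rot a + (-2 * rot b + 3 * kap * (1 - Real.cos b)) ≤ Real.pi := by
  have h1 := rot_mono (t := Real.pi - b) ha.1 (by linarith) (by linarith [hb.1])
  rw [rot_pi_sub] at h1
  linarith [kap_mul_le_rot hb.1 hb.2]

theorem lower_face_le_pi' (ha : a ∈ Icc 0 Real.pi) (hb : b ∈ Icc 0 Real.pi)
    (h : Real.pi ≤ a + b) :
    rot a + 2 * kap * Real.cos a + (-2 * rot b + kap * (3 - Real.cos b)) ≤ Real.pi := by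
  have h1 := kap_mul_le_rot hb.1 hb.2
  have h2 := kap_mul_le_rot (t := Real.pi - a) (by linarith [ha.2]) (by linarith [ha.1])
  have h3 := Real.cos_le_cos_of_nonneg_of_le_pi (x := Real.pi - a) (by linarith [ha.2]) hb.2
    (by linarith)
  rw [rot_pi_sub] at h2
  rw [Real.cos_pi_sub] at h2 h3
  linarith [mul_le_mul_of_nonneg_left h3 kap_pos.le]

/-- At b = 0 the key inequality is an equality, so no positive margin exists near it and small b
needs this direct argument. -/
theorem three_kap_le_rot (h0 : 0 ≤ b) (h1 : b ≤ 17 / 100) :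
    3 * kap * (1 - Real.cos b) ≤ rot b := by
  have h2 := Real.one_sub_sq_div_two_le_cos (x := b)
  have h3 : 1 - Real.cos b ≤ 17 / 200 * b := by nlinarith
  have h4 : 9986 / 10000 * Real.pi ≤ 314 / 100 := by linarith [pi_bounds.2]
  have := mul_le_mul h4 h3 (by linarith [Real.cos_le_one b]) (by norm_num)
  unfold rot kap
  linarith

/-- A bound for the cosine of the dihedral angle from a triangle inequality. -/
theorem upper_face_cos_le (ha : a ∈ Icc 0 Real.pi) (hb : b ∈ Icc 0 Real.pi) :
    1 - |Real.cos a - Real.cos b| - Real.cos a * Real.cos b ≤ Real.sin a * Real.sin b := by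
  have hs := mul_nonneg (Real.sin_nonneg_of_nonneg_of_le_pi ha.1 ha.2)
    (Real.sin_nonneg_of_nonneg_of_le_pi hb.1 hb.2)
  have e : (Real.sin a * Real.sin b) ^ 2 = (1 - Real.cos a ^ 2) * (1 - Real.cos b ^ 2) := by
    rw [mul_pow, Real.sin_sq, Real.sin_sq]
  have := Real.cos_le_one a
  have := Real.cos_le_one b
  have := Real.neg_one_le_cos a
  have := Real.neg_one_le_cos b
  refine le_of_sq_le_sq ?_ hs
  rw [e]
  generalize Real.cos a = x at *
  generalize Real.cos b = y at *
  rcases le_total x y with h | h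
  · rw [abs_of_nonpos (sub_nonpos.2 h)]
    -- The left side is this product, and the difference of the squares is 2 (1 - y)(1 + x)(y - x).
    have h1 : 0 ≤ (1 - y) * (1 + x) := mul_nonneg (by linarith) (by linarith)
    nlinarith [mul_nonneg h1 (sub_nonneg.2 h)]
  · rw [abs_of_nonneg (sub_nonneg.2 h)]
    have h1 : 0 ≤ (1 - x) * (1 + y) := mul_nonneg (by linarith) (by linarith)
    nlinarith [mul_nonneg h1 (sub_nonneg.2 h)]

theorem key_of_side {σ τ : Side} (ha : a ∈ Ioo 0 Real.pi) (hb : b ∈ Ioo 0 Real.pi)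
    (hh : 0 < σ.h a * τ.h b)
    (hlo : ∀ z, -1 ≤ z + Real.cos a + Real.cos b → -1 ≤ z - Real.cos a - Real.cos b →
      -(4 * (σ.k a * τ.k b) ^ 2) ≤ z - Real.cos a * Real.cos b)
    (hs : Real.sin a * Real.sin b = 4 * (σ.h a * τ.h b) * (σ.k a * τ.k b))
    (ht : σ.t a + τ.t b = rot a - 2 * rot b + kap * (2 + Real.cos a - 2 * Real.cos b -
      (Real.cos a * Real.cos b - 4 * (σ.k a * τ.k b) ^ 2)))
    (hpi : σ.t a + τ.t b ≤ Real.pi)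
    (hE : Triv (σ.pt a) (τ.pt b) ∨ 0 ≤ edgeR (σ.pt a) (τ.pt b))
    (hI : Triv (σ.pt a) (τ.pt b) ∨ 0 ≤ obtuseR (σ.pt a) (τ.pt b) ∨ Tangent (σ.pt a) (τ.pt b))
    {c z : ℝ} (hc : c ≤ 1) (hz : z = Real.cos a * Real.cos b + Real.sin a * Real.sin b * c)
    (h1 : -1 ≤ z + Real.cos a + Real.cos b) (h2 : -1 ≤ z - Real.cos a - Real.cos b)
    (h3 : -1 ≤ -z - Real.cos a + Real.cos b) (h4 : -1 ≤ -z + Real.cos a - Real.cos b) :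
    rot a - 2 * rot b + kap * (2 + Real.cos a - 2 * Real.cos b - z) ≤
      Real.arccos (Real.cos (rot a) * Real.cos (rot b) +
        Real.sin (rot a) * Real.sin (rot b) * c) := by
  have ha' : a ∈ Icc 0 Real.pi := Ioo_subset_Icc_self ha
  have hb' : b ∈ Icc 0 Real.pi := Ioo_subset_Icc_self hb
  have hD := fun {c : ℝ} (hc : c ≤ 1) => abs_sub_le_arccos (rot_mem ha') (rot_mem hb') hc
  have hspos : 0 < Real.sin a * Real.sin b :=
    mul_pos (Real.sin_pos_of_pos_of_lt_pi ha.1 ha.2) (Real.sin_pos_of_pos_of_lt_pi hb.1 hb.2)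
  have hz₀ := hlo z h1 h2
  have hT : Triv (σ.pt a) (τ.pt b) → rot a - 2 * rot b +
      kap * (2 + Real.cos a - 2 * Real.cos b - z) ≤ |rot a - rot b| := fun h => by
    have h5 : σ.t a + τ.t b ≤ |rot a - rot b| := h.le
    have h6 := mul_le_mul_of_nonneg_left hz₀ kap_pos.le
    linarith
  rcases hE with hE | hE
  · exact (hT hE).trans (hD hc)
  rcases hI with hI | hI
  · exact (hT hI).trans (hD hc)
  have hSa := sin_rot_nonneg ha'
  have hSb := sin_rot_nonneg hb'
  have hsz : ∀ w, Real.sin a * Real.sin b * (w / (Real.sin a * Real.sin b)) = w :=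
    fun w => mul_div_cancel₀ w hspos.ne'
  have e₀ : Real.sin a * Real.sin b * (-(σ.k a * τ.k b) / (σ.h a * τ.h b)) =
      -(4 * (σ.k a * τ.k b) ^ 2) := by
    rw [hs, mul_div_assoc', div_eq_iff hh.ne']; ring
  -- The value of c at which z = 1 - |cos a - cos b|, the upper bound from `h3` and `h4`.
  set c₁ := (1 - |Real.cos a - Real.cos b| - Real.cos a * Real.cos b) /
    (Real.sin a * Real.sin b) with hc₁
  have e₁ := hsz (1 - |Real.cos a - Real.cos b| - Real.cos a * Real.cos b)
  rw [← hc₁] at e₁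
  have key := le_arccos_of_face (p := σ.pt a) (q := τ.pt b) (D := |rot a - rot b|)
    (c₀ := -(σ.k a * τ.k b) / (σ.h a * τ.h b)) (c₁ := c₁) (c := c) hh
    (by simp only [Side.pt]; rw [neg_div, neg_neg, div_mul_cancel₀ _ hh.ne']) (mul_nonneg hSa hSb)
    (mul_le_mul (sin_rot_le ha') (sin_rot_le hb') hSb
      (Real.sin_nonneg_of_nonneg_of_le_pi ha'.1 ha'.2))
    (Real.cos_add _ _).symm
    ((Real.cos_sub (rot a) (rot b)).symm.trans_le (Real.cos_le_one _))
    (fun c hc => hD hc) hpi ?_ ?_ ?_ ?_ hE hI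
  · simp only [Side.pt] at key
    refine le_trans (le_of_eq ?_) key
    rw [mul_assoc kap, mul_sub (Real.sin a * Real.sin b), e₀, ht, hz]; ring
  · simp only [Side.pt]
    have := upper_face_le ha' hb'
    rw [mul_assoc kap, mul_sub (Real.sin a * Real.sin b), e₀, e₁, ht]
    linarith
  · refine le_of_mul_le_mul_left ?_ hspos
    rw [e₀]; linarith
  · refine le_of_mul_le_mul_left ?_ hspos
    rw [e₁]
    have : |Real.cos a - Real.cos b| ≤ 1 - z := by
      rw [abs_le]; constructor <;> linarith
    linarith
  · rw [hc₁, div_le_one hspos]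
    exact upper_face_cos_le ha' hb'

theorem cos_eq_half (t : ℝ) : Real.cos t = 2 * Real.cos (t / 2) ^ 2 - 1 := by
  rw [← Real.cos_two_mul]; ring_nf

theorem cos_eq_half' (t : ℝ) : Real.cos t = 1 - 2 * Real.sin (t / 2) ^ 2 := by
  have := cos_eq_half t
  have := Real.sin_sq_add_cos_sq (t / 2)
  linarith

theorem sin_eq_half (t : ℝ) : Real.sin t = 2 * Real.sin (t / 2) * Real.cos (t / 2) := by
  rw [← Real.sin_two_mul]; ring_nf

/-- The inequality between the angles of the rotated vectors and the summand of the relaxation that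
yields the approximation ratio. -/
theorem key_inequality (ha : a ∈ Icc 0 Real.pi) (hb : b ∈ Icc 0 Real.pi) {c z : ℝ} (hc : c ≤ 1)
    (hz : z = Real.cos a * Real.cos b + Real.sin a * Real.sin b * c)
    (h1 : -1 ≤ z + Real.cos a + Real.cos b) (h2 : -1 ≤ z - Real.cos a - Real.cos b)
    (h3 : -1 ≤ -z - Real.cos a + Real.cos b) (h4 : -1 ≤ -z + Real.cos a - Real.cos b) :
    rot a - 2 * rot b + kap * (2 + Real.cos a - 2 * Real.cos b - z) ≤
      Real.arccos (Real.cos (rot a) * Real.cos (rot b) +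
        Real.sin (rot a) * Real.sin (rot b) * c) := by
  have hD := abs_sub_le_arccos (rot_mem ha) (rot_mem hb) hc
  have rb := kap_mul_le_rot hb.1 hb.2
  rcases le_or_gt b (17 / 100) with hb17 | hb17
  · have := three_kap_le_rot hb.1 hb17
    have := mul_le_mul_of_nonneg_left h2 kap_pos.le
    linarith [le_abs_self (rot a - rot b)]
  -- When sin a sin b = 0 the dihedral angle is meaningless and c₀, c₁ are undefined; z and the
  -- arccosine are then explicit.
  rcases ha.1.eq_or_lt with rfl | ha0
  · simp only [Real.cos_zero, Real.sin_zero, rot_zero, zero_mul, one_mul, add_zero] at hz ⊢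
    rw [hz, Real.arccos_cos (rot_mem hb).1 (rot_mem hb).2]
    linarith
  rcases ha.2.eq_or_lt with rfl | haπ
  · simp only [Real.cos_pi, Real.sin_pi, rot_pi, zero_mul, add_zero] at hz ⊢
    rw [hz, neg_one_mul, neg_one_mul, Real.arccos_neg,
      Real.arccos_cos (rot_mem hb).1 (rot_mem hb).2]
    linarith
  rcases hb.2.eq_or_lt with rfl | hbπ
  · simp only [Real.cos_pi, Real.sin_pi, rot_pi, zero_mul, mul_zero, add_zero] at hz ⊢
    rw [hz, mul_neg_one (Real.cos a), mul_neg_one (Real.cos (rot a)), Real.arccos_neg,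
      Real.arccos_cos (rot_mem ha).1 (rot_mem ha).2]
    have := kap_mul_le_rot (t := Real.pi - a) (by linarith) (by linarith)
    rw [Real.cos_pi_sub, rot_pi_sub] at this
    have h5 : 2 * kap ≤ Real.pi := by unfold kap; linarith [Real.pi_pos]
    linarith
  have hb17' : b ∈ Icc (17 / 100) Real.pi := ⟨hb17.le, hb.2⟩
  have hb0 : 0 < b := by linarith
  have hca : 0 < Real.cos (a / 2) := Real.cos_pos_of_mem_Ioo ⟨by linarith, by linarith⟩
  have hcb : 0 < Real.cos (b / 2) := Real.cos_pos_of_mem_Ioo ⟨by linarith, by linarith⟩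
  have hsa : 0 < Real.sin (a / 2) := Real.sin_pos_of_pos_of_lt_pi (by linarith) (by linarith)
  have hsb : 0 < Real.sin (b / 2) := Real.sin_pos_of_pos_of_lt_pi (by linarith) (by linarith)
  have hss : Real.sin a * Real.sin b = 4 * (Real.cos (a / 2) * Real.cos (b / 2)) *
      (Real.sin (a / 2) * Real.sin (b / 2)) := by
    rw [sin_eq_half a, sin_eq_half b]; ring
  rcases le_total (a + b) Real.pi with hab | hab
  · have e : 4 * (Real.sin (a / 2) * Real.sin (b / 2)) ^ 2 =
        (1 - Real.cos a) * (1 - Real.cos b) := by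
      rw [cos_eq_half' a, cos_eq_half' b]; ring
    have ht : rot a + (-2 * rot b + 3 * kap * (1 - Real.cos b)) = rot a - 2 * rot b +
        kap * (2 + Real.cos a - 2 * Real.cos b - (Real.cos a * Real.cos b -
          4 * (Real.sin (a / 2) * Real.sin (b / 2)) ^ 2)) := by
      rw [e]; ring
    exact key_of_side (σ := lowSideA) (τ := lowSideB) ⟨ha0, haπ⟩ ⟨hb0, hbπ⟩ (mul_pos hca hcb)
      (fun z _ h => by
        change -(4 * (Real.sin (a / 2) * Real.sin (b / 2)) ^ 2) ≤ _
        rw [e]; linarith)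
      hss ht (lower_face_le_pi ha hb hab) (low_edge ha hb17' hab) (low_interior ha hb17' hab)
      hc hz h1 h2 h3 h4
  · have e : 4 * (Real.cos (a / 2) * Real.cos (b / 2)) ^ 2 =
        (1 + Real.cos a) * (1 + Real.cos b) := by
      rw [cos_eq_half a, cos_eq_half b]; ring
    have ht : rot a + 2 * kap * Real.cos a + (-2 * rot b + kap * (3 - Real.cos b)) =
        rot a - 2 * rot b + kap * (2 + Real.cos a - 2 * Real.cos b - (Real.cos a * Real.cos b -
          4 * (Real.cos (a / 2) * Real.cos (b / 2)) ^ 2)) := by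
      rw [e]; ring
    exact key_of_side (σ := upSideA) (τ := upSideB) ⟨ha0, haπ⟩ ⟨hb0, hbπ⟩ (mul_pos hsa hsb)
      (fun z h _ => by
        change -(4 * (Real.cos (a / 2) * Real.cos (b / 2)) ^ 2) ≤ _
        rw [e]; linarith)
      (hss.trans (by simp only [upSideA, upSideB]; ring)) ht (lower_face_le_pi' ha hb hab)
      (up_edge ha hb17' hab) (up_interior ha hb17' hab) hc hz h1 h2 h3 h4

end SDPIE.Certificate

/-! ### Random hyperplanes and the angle formula -/

namespace SDPIE
open scoped Pointwise

/-- A bounded function that is additive on `[0, L]` is linear there. -/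
theorem eq_linear_of_additive {g : ℝ → ℝ} {L M : ℝ} (hL : 0 < L)
    (hadd : ∀ s t, 0 ≤ s → 0 ≤ t → s + t ≤ L → g (s + t) = g s + g t)
    (hb : ∀ t, 0 ≤ t → t ≤ L → |g t| ≤ M) {t : ℝ} (h0 : 0 ≤ t) (h1 : t ≤ L) :
    g t = t / L * g L := by
  set h : ℝ → ℝ := fun t => g t - t / L * g L with hh
  have hadd' : ∀ s t, 0 ≤ s → 0 ≤ t → s + t ≤ L → h (s + t) = h s + h t := fun s t hs ht hst => by
    simp only [hh, hadd s t hs ht hst]; ring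
  have hhL : h L = 0 := by simp only [hh, div_self hL.ne']; ring
  -- Each round halves the bound: on [0, L/2] because h(2t) = 2 h(t), on the other half because h(t)
  -- = -h(L - t).
  have hbd : ∀ n : ℕ, ∀ t, 0 ≤ t → t ≤ L → |h t| ≤ 2 * M / 2 ^ n := by
    intro n
    induction n with
    | zero =>
      intro t h0 h1
      have e : |t / L * g L| ≤ M := by
        rw [abs_mul, abs_of_nonneg (div_nonneg h0 hL.le)]
        exact (mul_le_of_le_one_left (abs_nonneg _) ((div_le_one hL).2 h1)).trans
          (hb L hL.le le_rfl)
      have := (abs_sub (g t) (t / L * g L)).trans (add_le_add (hb t h0 h1) e)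
      simpa [hh, two_mul] using this
    | succ n ih =>
      have half : ∀ t, 0 ≤ t → t ≤ L / 2 → |h t| ≤ 2 * M / 2 ^ (n + 1) := fun t h0 h1 => by
        have e := ih (t + t) (by linarith) (by linarith)
        rw [hadd' t t h0 h0 (by linarith), ← two_mul, abs_mul, abs_of_pos two_pos] at e
        rw [pow_succ, ← div_div]
        linarith
      intro t h0 h1
      rcases le_total t (L / 2) with h2 | h2
      · exact half t h0 h2
      · have e := hadd' t (L - t) h0 (by linarith) (by linarith)
        rw [add_sub_cancel, hhL] at e
        rw [show h t = -h (L - t) by linarith, abs_neg]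
        exact half _ (by linarith) (by linarith)
  have hz : |h t| ≤ 0 := by
    refine ge_of_tendsto' (x := Filter.atTop) (f := fun n : ℕ => 2 * M / (2 : ℝ) ^ n) ?_
      fun n => hbd n t h0 h1
    simpa [div_eq_mul_inv] using
      (tendsto_pow_atTop_nhds_zero_of_lt_one (r := (2 : ℝ)⁻¹) (by norm_num) (by norm_num)).const_mul
        (2 * M)
  have := abs_nonpos_iff.1 hz
  simp only [hh] at this
  linarith

section Cone

variable {E : Type*} [NormedAddCommGroup E] [InnerProductSpace ℝ E]

theorem sgn_eq_iff {x y : ℝ} : sgn x = sgn y ↔ (0 ≤ x ↔ 0 ≤ y) := by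
  unfold sgn
  split_ifs with h h' h' <;> simp [h, h']

/-- The points of the unit ball that the hyperplanes orthogonal to `a` and `b` separate from each
other. -/
def wedge (a b : E) : Set E := {x | ‖x‖ < 1 ∧ sgn ⟪a, x⟫ ≠ sgn ⟪b, x⟫}

theorem wedge_comm (a b : E) : wedge a b = wedge b a := by
  ext x; simp only [wedge, Set.mem_ofPred_eq, ne_comm]

theorem wedge_self (a : E) : wedge a a = ∅ := by ext x; simp [wedge]

theorem wedge_subset_ball (a b : E) : wedge a b ⊆ Metric.ball 0 1 :=
  fun x hx => by simpa using hx.1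

theorem measurable_sgn : Measurable sgn :=
  Measurable.ite measurableSet_Ici measurable_const measurable_const

/-- The unit vector at angle `t` in the plane of `u` and `w`. -/
def circ (u w : E) (t : ℝ) : E := Real.cos t • u + Real.sin t • w

variable {u w : E}

theorem inner_circ (hu : ⟪u, u⟫ = 1) (hw : ⟪w, w⟫ = 1) (huw : ⟪u, w⟫ = 0) (s t : ℝ) :
    ⟪circ u w s, circ u w t⟫ = Real.cos (s - t) := by
  have hwu : ⟪w, u⟫ = 0 := by rw [real_inner_comm]; exact huw
  simp only [circ, inner_add_left, inner_add_right, real_inner_smul_left, real_inner_smul_right,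
    hu, hw, huw, hwu, Real.cos_sub]
  ring

theorem reflection_circ (hu : ⟪u, u⟫ = 1) (hw : ⟪w, w⟫ = 1) (huw : ⟪u, w⟫ = 0) (m s : ℝ) :
    (ℝ ∙ circ u w m).reflection (circ u w s) = circ u w (2 * m - s) := by
  have h1 : ‖circ u w m‖ ^ 2 = 1 := by
    rw [← real_inner_self_eq_norm_sq, inner_circ hu hw huw]; simp
  rw [Submodule.reflection_singleton_apply]
  simp only [RCLike.ofReal_real_eq_id, id, h1, inner_circ hu hw huw, div_one]
  have e1 : Real.cos (2 * m - s) = 2 * Real.cos (m - s) * Real.cos m - Real.cos s := by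
    have : Real.cos s = Real.cos (m - (m - s)) := by ring_nf
    rw [this, show 2 * m - s = m + (m - s) by ring, Real.cos_add, Real.cos_sub m (m - s)]; ring
  have e2 : Real.sin (2 * m - s) = 2 * Real.cos (m - s) * Real.sin m - Real.sin s := by
    have : Real.sin s = Real.sin (m - (m - s)) := by ring_nf
    rw [this, show 2 * m - s = m + (m - s) by ring, Real.sin_add, Real.sin_sub m (m - s)]; ring
  simp only [circ, e1, e2]
  module

theorem circ_zero : circ u w 0 = u := by simp [circ]
theorem circ_pi : circ u w Real.pi = -u := by simp [circ]

variable [MeasurableSpace E] [BorelSpace E]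

theorem measurable_sgn_inner (a : E) : Measurable fun x : E => sgn ⟪a, x⟫ :=
  measurable_sgn.comp (continuous_const.inner continuous_id).measurable

theorem measurableSet_wedge (a b : E) : MeasurableSet (wedge a b) := by
  have h1 : MeasurableSet {x : E | ‖x‖ < 1} := measurableSet_lt measurable_norm measurable_const
  have h2 := measurableSet_eq_fun (measurable_sgn_inner a) (measurable_sgn_inner b)
  exact h1.inter h2.compl

variable [FiniteDimensional ℝ E]

theorem wedge_ne_top (a b : E) : volume (wedge a b) ≠ ⊤ :=
  ((measure_mono (wedge_subset_ball a b)).trans_lt measure_ball_lt_top).ne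

theorem volume_wedge_map (L : E ≃ₗᵢ[ℝ] E) (a b : E) :
    volume.real (wedge (L a) (L b)) = volume.real (wedge a b) := by
  have h : L ⁻¹' wedge (L a) (L b) = wedge a b := by
    ext x
    simp [wedge]
  rw [← h, measureReal_def, measureReal_def,
    L.measurePreserving.measure_preimage (measurableSet_wedge _ _).nullMeasurableSet]

theorem ae_inner_ne_zero {a : E} (ha : a ≠ 0) : ∀ᵐ x : E, ⟪a, x⟫ ≠ 0 := by
  have h : (ℝ ∙ a)ᗮ ≠ ⊤ := fun h => by
    have : a ∈ (ℝ ∙ a)ᗮ := by rw [h]; trivial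
    rw [Submodule.mem_orthogonal_singleton_iff_inner_right] at this
    exact ha (inner_self_eq_zero.1 this)
  have := Measure.addHaar_submodule volume _ h
  refine measure_mono_null (fun x hx => ?_) this
  simpa [Submodule.mem_orthogonal_singleton_iff_inner_right] using hx

theorem volume_wedge_neg {a : E} (ha : a ≠ 0) :
    volume.real (wedge a (-a)) = volume.real (Metric.ball (0 : E) 1) := by
  refine measureReal_congr ?_
  filter_upwards [ae_inner_ne_zero ha] with x hx
  refine propext ⟨fun h => wedge_subset_ball _ _ h, fun h => ⟨mem_ball_zero_iff.1 h, ?_⟩⟩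
  rw [Ne, sgn_eq_iff, inner_neg_left]
  rcases lt_or_gt_of_ne hx with h | h
  · simp [h.not_ge, h.le]
  · simp [h.not_ge, h.le]

/-- As `sgn` has two values, a point in both smaller wedges has equal signs at `a` and `c` but
another sign at `b`; the hypothesis makes such points negligible. -/
theorem volume_wedge_add {a b c : E} (h : ∀ᵐ x : E, sgn ⟪a, x⟫ = sgn ⟪c, x⟫ →
    sgn ⟪a, x⟫ = sgn ⟪b, x⟫) :
    volume.real (wedge a c) = volume.real (wedge a b) + volume.real (wedge b c) := by
  have hd : AEDisjoint volume (wedge a b) (wedge b c) := by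
    rw [AEDisjoint]
    refine measure_mono_null (fun x hx => ?_) h
    intro h'
    obtain ⟨⟨-, h1⟩, -, h2⟩ := hx
    rcases eq_or_ne (sgn ⟪a, x⟫) (sgn ⟪c, x⟫) with h3 | h3
    · exact h1 (h' h3)
    · unfold sgn at *
      split_ifs at * <;> simp_all
  have hu : wedge a c =ᵐ[volume] (wedge a b ∪ wedge b c : Set E) := by
    filter_upwards [h] with x hx
    refine propext ⟨fun ⟨h1, h2⟩ => ?_, ?_⟩
    · by_cases h3 : sgn ⟪a, x⟫ = sgn ⟪b, x⟫
      · exact .inr ⟨h1, h3 ▸ h2⟩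
      · exact .inl ⟨h1, h3⟩
    · rintro (⟨h1, h2⟩ | ⟨h1, h2⟩)
      · exact ⟨h1, fun h3 => h2 (hx h3)⟩
      · exact ⟨h1, fun h3 => h2 ((hx h3).symm.trans h3)⟩
  rw [measureReal_congr hu, measureReal_def, measureReal_def, measureReal_def,
    measure_union₀ (measurableSet_wedge _ _).nullMeasurableSet hd,
    ENNReal.toReal_add (wedge_ne_top _ _) (wedge_ne_top _ _)]

/-- The reflection in the direction at angle (s + t)/2 maps the wedge between the angles s and s + t
to the one between t and 0, so wedge volume depends only on the angle. -/
theorem volume_wedge_circ_add (hu : ⟪u, u⟫ = 1) (hw : ⟪w, w⟫ = 1) (huw : ⟪u, w⟫ = 0) {s t : ℝ}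
    (hs : 0 ≤ s) (ht : 0 ≤ t) (hst : s + t ≤ Real.pi) :
    volume.real (wedge u (circ u w (s + t))) =
      volume.real (wedge u (circ u w s)) + volume.real (wedge u (circ u w t)) := by
  have hu0 : u ≠ 0 := fun h => by simp [h] at hu
  have hrefl : volume.real (wedge u (circ u w t)) =
      volume.real (wedge (circ u w s) (circ u w (s + t))) := by
    have := volume_wedge_map (ℝ ∙ circ u w ((s + t) / 2)).reflection (circ u w (s + t)) (circ u w s)
    rw [reflection_circ hu hw huw, reflection_circ hu hw huw,
      show 2 * ((s + t) / 2) - (s + t) = 0 by ring, show 2 * ((s + t) / 2) - s = t by ring,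
      circ_zero] at this
    rw [this, wedge_comm]
  rw [hrefl]
  refine volume_wedge_add ?_
  filter_upwards [ae_inner_ne_zero hu0] with x hx
  rw [sgn_eq_iff, sgn_eq_iff]
  rcases hst.eq_or_lt with he | hlt
  · rw [he, circ_pi, inner_neg_left]
    intro h
    rcases lt_or_gt_of_ne hx with h' | h' <;> simp [h'.not_ge, h'.le] at h
  rcases (add_nonneg hs ht).eq_or_lt with he | hpos
  · obtain rfl : s = 0 := by linarith
    simp [circ_zero]
  have h1 : 0 < Real.sin (s + t) := Real.sin_pos_of_pos_of_lt_pi hpos hlt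
  have h2 : 0 ≤ Real.sin s := Real.sin_nonneg_of_nonneg_of_le_pi hs (by linarith)
  have h3 : 0 ≤ Real.sin t := Real.sin_nonneg_of_nonneg_of_le_pi ht (by linarith)
  -- The middle vector is a nonnegative combination of the outer two, so it shares their sign when
  -- they agree.
  have key : Real.sin (s + t) * ⟪circ u w s, x⟫ =
      Real.sin t * ⟪u, x⟫ + Real.sin s * ⟪circ u w (s + t), x⟫ := by
    simp only [circ, inner_add_left, real_inner_smul_left, Real.sin_add, Real.cos_add]
    linear_combination (Real.sin t * ⟪u, x⟫) * Real.sin_sq_add_cos_sq s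
  intro h
  rcases lt_or_gt_of_ne hx with h' | h'
  · have h4 : ⟪circ u w (s + t), x⟫ < 0 := lt_of_not_ge fun h4 => h'.not_ge (h.2 h4)
    have h5 : ⟪circ u w s, x⟫ < 0 := by
      refine (pos_iff_neg_of_mul_neg ?_).1 h1
      rw [key]
      rcases h3.eq_or_lt with h6 | h6
      · have : 0 < Real.sin s := by
          rw [Real.sin_add, ← h6] at h1
          rcases h2.eq_or_lt with h7 | h7
          · rw [← h7] at h1; simp at h1
          · exact h7
        rw [← h6, zero_mul, zero_add]
        exact mul_neg_of_pos_of_neg this h4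
      · have := mul_neg_of_pos_of_neg h6 h'
        have := mul_nonpos_of_nonneg_of_nonpos h2 h4.le
        linarith
    simp [h'.not_ge, h5.not_ge]
  · have h4 : 0 ≤ ⟪circ u w (s + t), x⟫ := h.1 h'.le
    have h5 : 0 ≤ ⟪circ u w s, x⟫ := by
      refine nonneg_of_mul_nonneg_right ?_ h1
      rw [key]; positivity
    simp [h'.le, h5]

theorem volume_wedge_circ (hu : ⟪u, u⟫ = 1) (hw : ⟪w, w⟫ = 1) (huw : ⟪u, w⟫ = 0) {t : ℝ}
    (h0 : 0 ≤ t) (h1 : t ≤ Real.pi) :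
    volume.real (wedge u (circ u w t)) = t / Real.pi * volume.real (Metric.ball (0 : E) 1) := by
  have hu0 : u ≠ 0 := fun h => by simp [h] at hu
  have := eq_linear_of_additive (g := fun t => volume.real (wedge u (circ u w t))) Real.pi_pos
    (fun s t hs ht => volume_wedge_circ_add hu hw huw hs ht)
    (M := volume.real (Metric.ball (0 : E) 1)) (fun t _ _ => by
      rw [abs_of_nonneg measureReal_nonneg]
      exact measureReal_mono (wedge_subset_ball _ _) measure_ball_lt_top.ne) h0 h1
  simpa only [circ_pi, volume_wedge_neg hu0] using this

theorem volume_wedge {a b : E} (ha : ⟪a, a⟫ = 1) (hb : ⟪b, b⟫ = 1) :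
    volume.real (wedge a b) =
      vecAngle a b / Real.pi * volume.real (Metric.ball (0 : E) 1) := by
  have ha0 : a ≠ 0 := fun h => by simp [h] at ha
  have hna : ‖a‖ = 1 := by
    rw [real_inner_self_eq_norm_sq] at ha
    exact (pow_eq_one_iff_of_nonneg (norm_nonneg _) two_ne_zero).1 ha
  have hnb : ‖b‖ = 1 := by
    rw [real_inner_self_eq_norm_sq] at hb
    exact (pow_eq_one_iff_of_nonneg (norm_nonneg _) two_ne_zero).1 hb
  have hle : ⟪a, b⟫ ≤ 1 := by simpa [hna, hnb] using real_inner_le_norm a b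
  have hge : -1 ≤ ⟪a, b⟫ := by
    have := abs_real_inner_le_norm a b
    rw [hna, hnb, mul_one] at this
    exact (abs_le.1 this).1
  have hnorm : ‖b - ⟪a, b⟫ • a‖ ^ 2 = 1 - ⟪a, b⟫ ^ 2 := by
    rw [← real_inner_self_eq_norm_sq]
    simp only [inner_sub_left, inner_sub_right, real_inner_smul_left, real_inner_smul_right, ha, hb,
      real_inner_comm a b]
    ring
  rcases eq_or_ne (b - ⟪a, b⟫ • a) 0 with h | h
  · rw [h, norm_zero] at hnorm
    have hb' : b = ⟪a, b⟫ • a := sub_eq_zero.1 h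
    have : (⟪a, b⟫ - 1) * (⟪a, b⟫ + 1) = 0 := by linarith
    rcases mul_eq_zero.1 this with h1 | h1
    · have h2 : ⟪a, b⟫ = 1 := by linarith
      rw [h2, one_smul] at hb'
      rw [vecAngle, h2, Real.arccos_one, hb', wedge_self]
      simp
    · have h2 : ⟪a, b⟫ = -1 := by linarith
      rw [h2, neg_one_smul] at hb'
      rw [vecAngle, h2, Real.arccos_neg_one, hb', volume_wedge_neg ha0, div_self Real.pi_ne_zero,
        one_mul]
  · have hn : ‖b - ⟪a, b⟫ • a‖ ≠ 0 := norm_ne_zero_iff.2 h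
    have hsin : Real.sin (vecAngle a b) = ‖b - ⟪a, b⟫ • a‖ := by
      rw [vecAngle, Real.sin_arccos, ← hnorm, Real.sqrt_sq (norm_nonneg _)]
    have hb' : b = circ a (‖b - ⟪a, b⟫ • a‖⁻¹ • (b - ⟪a, b⟫ • a)) (vecAngle a b) := by
      rw [circ, hsin, smul_inv_smul₀ hn, vecAngle, Real.cos_arccos hge hle]
      abel
    conv_lhs => rw [hb']
    refine volume_wedge_circ ha ?_ ?_ (Real.arccos_nonneg _) (Real.arccos_le_pi _)
    · rw [real_inner_smul_left, real_inner_smul_right, real_inner_self_eq_norm_sq]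
      field_simp
    · rw [real_inner_smul_right, inner_sub_right, real_inner_smul_right, ha, mul_one, sub_self,
        mul_zero]

end Cone

/-- `toSphere` measures a subset of the sphere by the volume of the cone over it inside the ball,
which here is a wedge. -/
theorem smul_sphere_eq_wedge {m : ℕ} (a b : EuclideanSpace ℝ (Fin m)) :
    Set.Ioo (0 : ℝ) 1 • (Subtype.val '' {r : Metric.sphere (0 : EuclideanSpace ℝ (Fin m)) 1 |
      sgn ⟪a, (r : EuclideanSpace ℝ (Fin m))⟫ ≠ sgn ⟪b, (r : EuclideanSpace ℝ (Fin m))⟫}) =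
      wedge a b := by
  have hs : ∀ {c : ℝ} (_ : 0 < c) (a x : EuclideanSpace ℝ (Fin m)),
      sgn ⟪a, c • x⟫ = sgn ⟪a, x⟫ := fun hc a x => by
    rw [sgn_eq_iff, real_inner_smul_right, mul_nonneg_iff_of_pos_left hc]
  ext x
  constructor
  · rintro ⟨c, ⟨hc0, hc1⟩, _, ⟨r, hr, rfl⟩, rfl⟩
    refine ⟨?_, ?_⟩
    · change ‖c • (r : EuclideanSpace ℝ (Fin m))‖ < 1
      rw [norm_smul, norm_eq_of_mem_sphere r, mul_one, Real.norm_of_nonneg hc0.le]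
      exact hc1
    · change sgn ⟪a, c • (r : EuclideanSpace ℝ (Fin m))⟫ ≠ sgn ⟪b, c • (r : EuclideanSpace ℝ (Fin m))⟫
      rw [hs hc0, hs hc0]
      exact hr
  · rintro ⟨h1, h2⟩
    have hx : x ≠ 0 := by
      rintro rfl
      simp at h2
    have hn : 0 < ‖x‖ := norm_pos_iff.2 hx
    have hsm : ‖x‖ • (‖x‖⁻¹ • x) = x := smul_inv_smul₀ hn.ne' x
    refine ⟨‖x‖, ⟨hn, h1⟩, ‖x‖⁻¹ • x, ⟨⟨‖x‖⁻¹ • x, ?_⟩, ?_, rfl⟩, hsm⟩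
    · simp [norm_smul, hn.ne']
    · change sgn ⟪a, ‖x‖⁻¹ • x⟫ ≠ sgn ⟪b, ‖x‖⁻¹ • x⟫
      rw [hs (inv_pos.2 hn), hs (inv_pos.2 hn)]
      exact h2

theorem measurableSet_sgn_ne {m : ℕ} (a b : EuclideanSpace ℝ (Fin m)) :
    MeasurableSet {r : Metric.sphere (0 : EuclideanSpace ℝ (Fin m)) 1 |
      sgn ⟪a, (r : EuclideanSpace ℝ (Fin m))⟫ ≠ sgn ⟪b, (r : EuclideanSpace ℝ (Fin m))⟫} :=
  (measurableSet_eq_fun ((measurable_sgn_inner a).comp measurable_subtype_coe)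
    ((measurable_sgn_inner b).comp measurable_subtype_coe)).compl

instance {m : ℕ} : IsProbabilityMeasure (uniformSphere (m + 1)) := by
  have h0 : (volume : Measure (EuclideanSpace ℝ (Fin (m + 1)))).toSphere ≠ 0 :=
    Measure.toSphere_ne_zero _
  refine ⟨?_⟩
  rw [uniformSphere, Measure.smul_apply, smul_eq_mul]
  exact ENNReal.inv_mul_cancel (fun h => h0 (Measure.measure_univ_eq_zero.1 h)) (measure_ne_top _ _)

/-- The probability that a random hyperplane separates two unit vectors. -/
theorem uniformSphere_sgn_ne {m : ℕ} {a b : EuclideanSpace ℝ (Fin (m + 1))} (ha : ⟪a, a⟫ = 1)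
    (hb : ⟪b, b⟫ = 1) :
    (uniformSphere (m + 1)).real {r | sgn ⟪a, (r : EuclideanSpace ℝ (Fin (m + 1)))⟫ ≠
      sgn ⟪b, (r : EuclideanSpace ℝ (Fin (m + 1)))⟫} = vecAngle a b / Real.pi := by
  have hball : 0 < volume.real (Metric.ball (0 : EuclideanSpace ℝ (Fin (m + 1))) 1) :=
    ENNReal.toReal_pos (Metric.measure_ball_pos _ _ one_pos).ne' measure_ball_lt_top.ne
  rw [measureReal_def, uniformSphere, Measure.smul_apply, smul_eq_mul, ENNReal.toReal_mul,
    Measure.toSphere_apply' _ (measurableSet_sgn_ne a b), smul_sphere_eq_wedge,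
    Measure.toSphere_apply_univ, ENNReal.toReal_inv, ENNReal.toReal_mul, ENNReal.toReal_mul,
    ← measureReal_def, ← measureReal_def, volume_wedge ha hb]
  have hd : ((Module.finrank ℝ (EuclideanSpace ℝ (Fin (m + 1))) : ENNReal)).toReal ≠ 0 := by
    simp only [finrank_euclideanSpace, Fintype.card_fin, ENNReal.toReal_natCast]
    positivity
  field_simp

end SDPIE

/-! ### The rotation, the relaxation and the revenue -/

namespace SDPIE

section Rotate

variable {E : Type*} [NormedAddCommGroup E] [InnerProductSpace ℝ E]

/-- The normalized component of `x` orthogonal to `v₀`. -/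
def orthDir (v₀ x : E) : E := ‖x - ⟪v₀, x⟫ • v₀‖⁻¹ • (x - ⟪v₀, x⟫ • v₀)

variable {v₀ x y : E}

theorem inner_orthDir_right (h₀ : ⟪v₀, v₀⟫ = 1) : ⟪v₀, orthDir v₀ x⟫ = 0 := by
  rw [orthDir, real_inner_smul_right, inner_sub_right, real_inner_smul_right, h₀, mul_one, sub_self,
    mul_zero]

theorem norm_eq_one_of_inner (h : ⟪x, x⟫ = 1) : ‖x‖ = 1 := by
  rw [real_inner_self_eq_norm_sq] at h
  exact (pow_eq_one_iff_of_nonneg (norm_nonneg _) two_ne_zero).1 h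

theorem cos_vecAngle (h₀ : ⟪v₀, v₀⟫ = 1) (hx : ⟪x, x⟫ = 1) :
    Real.cos (vecAngle v₀ x) = ⟪v₀, x⟫ := by
  have := abs_real_inner_le_norm v₀ x
  rw [norm_eq_one_of_inner h₀, norm_eq_one_of_inner hx, mul_one, abs_le] at this
  exact Real.cos_arccos this.1 this.2

theorem sin_vecAngle (h₀ : ⟪v₀, v₀⟫ = 1) (hx : ⟪x, x⟫ = 1) :
    Real.sin (vecAngle v₀ x) = ‖x - ⟪v₀, x⟫ • v₀‖ := by
  have h : ‖x - ⟪v₀, x⟫ • v₀‖ ^ 2 = 1 - ⟪v₀, x⟫ ^ 2 := by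
    rw [← real_inner_self_eq_norm_sq]
    simp only [inner_sub_left, inner_sub_right, real_inner_smul_left, real_inner_smul_right, h₀, hx,
      real_inner_comm v₀ x]
    ring
  rw [vecAngle, Real.sin_arccos, ← h, Real.sqrt_sq (norm_nonneg _)]

theorem eq_cos_add_sin (h₀ : ⟪v₀, v₀⟫ = 1) (hx : ⟪x, x⟫ = 1) :
    x = Real.cos (vecAngle v₀ x) • v₀ + Real.sin (vecAngle v₀ x) • orthDir v₀ x := by
  rw [cos_vecAngle h₀ hx, sin_vecAngle h₀ hx, orthDir]
  rcases eq_or_ne (x - ⟪v₀, x⟫ • v₀) 0 with h | h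
  · rw [h]; simpa using sub_eq_zero.1 h
  · rw [smul_inv_smul₀ (norm_ne_zero_iff.2 h)]; abel

theorem inner_combination (h₀ : ⟪v₀, v₀⟫ = 1) (c s c' s' : ℝ) :
    ⟪c • v₀ + s • orthDir v₀ x, c' • v₀ + s' • orthDir v₀ y⟫ =
      c * c' + s * s' * ⟪orthDir v₀ x, orthDir v₀ y⟫ := by
  have h1 := inner_orthDir_right (x := y) h₀
  have h2 : ⟪orthDir v₀ x, v₀⟫ = 0 := by rw [real_inner_comm]; exact inner_orthDir_right h₀
  simp only [inner_add_left, inner_add_right, real_inner_smul_left, real_inner_smul_right, h₀, h1, h2]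
  ring

theorem rotate_eq (γ : ℝ) (v₀ x : E) : rotate γ v₀ x =
    Real.cos (rotAngle γ (vecAngle v₀ x)) • v₀ +
      Real.sin (rotAngle γ (vecAngle v₀ x)) • orthDir v₀ x := rfl

theorem inner_rotate (h₀ : ⟪v₀, v₀⟫ = 1) (γ : ℝ) : ⟪rotate γ v₀ x, rotate γ v₀ y⟫ =
    Real.cos (rotAngle γ (vecAngle v₀ x)) * Real.cos (rotAngle γ (vecAngle v₀ y)) +
      Real.sin (rotAngle γ (vecAngle v₀ x)) * Real.sin (rotAngle γ (vecAngle v₀ y)) *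
        ⟪orthDir v₀ x, orthDir v₀ y⟫ := by
  rw [rotate_eq, rotate_eq, inner_combination h₀]

/-- The spherical law of cosines. The same dihedral factor appears in `inner_rotate`, so only the
two angles with `v₀` change. -/
theorem inner_eq_cos_add_sin (h₀ : ⟪v₀, v₀⟫ = 1) (hx : ⟪x, x⟫ = 1) (hy : ⟪y, y⟫ = 1) : ⟪x, y⟫ =
    Real.cos (vecAngle v₀ x) * Real.cos (vecAngle v₀ y) +
      Real.sin (vecAngle v₀ x) * Real.sin (vecAngle v₀ y) * ⟪orthDir v₀ x, orthDir v₀ y⟫ := by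
  conv_lhs => rw [eq_cos_add_sin h₀ hx, eq_cos_add_sin h₀ hy]
  rw [inner_combination h₀]

theorem inner_left_rotate (h₀ : ⟪v₀, v₀⟫ = 1) (γ : ℝ) :
    ⟪v₀, rotate γ v₀ x⟫ = Real.cos (rotAngle γ (vecAngle v₀ x)) := by
  rw [rotate_eq, inner_add_right, real_inner_smul_right, real_inner_smul_right, h₀,
    inner_orthDir_right h₀]
  ring

theorem inner_orthDir_le_one : ⟪orthDir v₀ x, orthDir v₀ y⟫ ≤ 1 := by
  have h : ∀ x : E, ‖orthDir v₀ x‖ ≤ 1 := fun x => by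
    rw [orthDir, norm_smul, norm_inv, norm_norm]
    exact inv_mul_le_one
  exact (real_inner_le_norm _ _).trans (mul_le_one₀ (h x) (norm_nonneg _) (h y))

theorem inner_rotate_self (h₀ : ⟪v₀, v₀⟫ = 1) (hx : ⟪x, x⟫ = 1) (γ : ℝ) :
    ⟪rotate γ v₀ x, rotate γ v₀ x⟫ = 1 := by
  rw [inner_rotate h₀]
  rcases eq_or_ne (x - ⟪v₀, x⟫ • v₀) 0 with h | h
  -- Here `x = ± v₀`, and `orthDir v₀ x` is 0 rather than a unit vector; `rotAngle` fixes 0 and π,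
  -- so its coefficient vanishes as well.
  · have h1 : Real.sin (vecAngle v₀ x) = 0 := by rw [sin_vecAngle h₀ hx, h, norm_zero]
    have h2 : Real.sin (rotAngle γ (vecAngle v₀ x)) = 0 := by
      have h3 := Real.cos_sq_add_sin_sq (vecAngle v₀ x)
      rcases Real.arccos_nonneg ⟪v₀, x⟫ |>.eq_or_lt with h4 | h4
      · rw [vecAngle, ← h4]; simp [rotAngle]
      · rcases Real.arccos_le_pi ⟪v₀, x⟫ |>.eq_or_lt with h5 | h5
        · rw [vecAngle, h5]
          have : rotAngle γ Real.pi = Real.pi := by rw [rotAngle, Real.cos_pi]; ring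
          rw [this, Real.sin_pi]
        · exact absurd h1 (Real.sin_pos_of_pos_of_lt_pi h4 h5).ne'
    have h3 := Real.cos_sq_add_sin_sq (rotAngle γ (vecAngle v₀ x))
    rw [h2] at h3 ⊢
    linarith
  · have hn : ‖x - ⟪v₀, x⟫ • v₀‖ ≠ 0 := norm_ne_zero_iff.2 h
    have : ⟪orthDir v₀ x, orthDir v₀ x⟫ = 1 := by
      rw [orthDir, real_inner_smul_left, real_inner_smul_right, real_inner_self_eq_norm_sq]
      field_simp
    rw [this, mul_one]
    linarith [Real.cos_sq_add_sin_sq (rotAngle γ (vecAngle v₀ x))]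

theorem rotAngle_eq_rot (t : ℝ) : rotAngle 0.722 t = Certificate.rot t := by
  rw [rotAngle, Certificate.rot]; ring

theorem vecAngle_rotate (h₀ : ⟪v₀, v₀⟫ = 1) :
    vecAngle v₀ (rotate 0.722 v₀ x) = Certificate.rot (vecAngle v₀ x) := by
  have := Certificate.rot_mem ⟨Real.arccos_nonneg ⟪v₀, x⟫, Real.arccos_le_pi ⟪v₀, x⟫⟩
  rw [vecAngle, inner_left_rotate h₀, rotAngle_eq_rot]
  exact Real.arccos_cos this.1 this.2

end Rotate

open DirectedNetwork

variable {V : Type*} [Fintype V]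

theorem mem_influenceSet_iff {γ : ℝ} {v₀ : SDPSpace V} {v : V → SDPSpace V} {r : SDPSpace V}
    {i : V} :
    i ∈ influenceSet γ v₀ v r ↔ sgn ⟪rotate γ v₀ (v i), r⟫ = sgn ⟪v₀, r⟫ := by
  simp [influenceSet]

/-- The rounding directions for which the hyperplane separates `a` and `b`. -/
def separating (a b : SDPSpace V) : Set (Metric.sphere (0 : SDPSpace V) 1) :=
  {r | sgn ⟪a, (r : SDPSpace V)⟫ ≠ sgn ⟪b, (r : SDPSpace V)⟫}

/-- The indicator function of `separating a b`. -/
def sepIndicator (a b : SDPSpace V) : Metric.sphere (0 : SDPSpace V) 1 → ℝ :=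
  (separating a b).indicator 1

theorem integrable_sepIndicator (c : ℝ) (a b : SDPSpace V) :
    Integrable (fun r => c * sepIndicator a b r) (uniformSphere (Fintype.card V + 1)) :=
  ((integrable_const (1 : ℝ)).indicator (measurableSet_sgn_ne a b)).const_mul c

theorem integral_sepIndicator (c : ℝ) {a b : SDPSpace V} (ha : ⟪a, a⟫ = 1) (hb : ⟪b, b⟫ = 1) :
    ∫ r, c * sepIndicator a b r ∂(uniformSphere (Fintype.card V + 1)) =
      c * (vecAngle a b / Real.pi) := by
  rw [integral_const_mul]
  exact congrArg _ ((integral_indicator_one (measurableSet_sgn_ne a b)).trans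
    (uniformSphere_sgn_ne ha hb))

theorem isCompact_feasible :
    IsCompact {x : SDPSpace V × (V → SDPSpace V) | IsFeasible x.1 x.2} := by
  refine Metric.isCompact_of_isClosed_isBounded ?_ ?_
  · have h : {x : SDPSpace V × (V → SDPSpace V) | IsFeasible x.1 x.2} =
        {x | ⟪x.1, x.1⟫ = 1} ∩ {x | ∀ i, ⟪x.2 i, x.2 i⟫ = 1} ∩
        {x | ∀ i j, -1 ≤ ⟪x.2 i, x.2 j⟫ + ⟪x.1, x.2 i⟫ + ⟪x.1, x.2 j⟫} ∩
        {x | ∀ i j, -1 ≤ ⟪x.2 i, x.2 j⟫ - ⟪x.1, x.2 i⟫ - ⟪x.1, x.2 j⟫} ∩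
        {x | ∀ i j, -1 ≤ -⟪x.2 i, x.2 j⟫ - ⟪x.1, x.2 i⟫ + ⟪x.1, x.2 j⟫} ∩
        {x | ∀ i j, -1 ≤ -⟪x.2 i, x.2 j⟫ + ⟪x.1, x.2 i⟫ - ⟪x.1, x.2 j⟫} := by
      ext x
      exact ⟨fun ⟨h1, h2, h3, h4, h5, h6⟩ => ⟨⟨⟨⟨⟨h1, h2⟩, h3⟩, h4⟩, h5⟩, h6⟩,
        fun ⟨⟨⟨⟨⟨h1, h2⟩, h3⟩, h4⟩, h5⟩, h6⟩ => ⟨h1, h2, h3, h4, h5, h6⟩⟩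
    rw [h]
    refine ((((IsClosed.inter ?_ ?_).inter ?_).inter ?_).inter ?_).inter ?_
    · exact isClosed_eq (by fun_prop) (by fun_prop)
    · simp only [Set.ofPred_forall]
      exact isClosed_iInter fun i => isClosed_eq (by fun_prop) (by fun_prop)
    all_goals
      simp only [Set.ofPred_forall]
      exact isClosed_iInter fun i => isClosed_iInter fun j => isClosed_le (by fun_prop) (by fun_prop)
  · refine Metric.isBounded_closedBall (x := 0) (r := 1) |>.subset fun x hx => ?_
    rw [mem_closedBall_zero_iff, Prod.norm_def, max_le_iff]
    exact ⟨(norm_eq_one_of_inner hx.norm_zero).le, (pi_norm_le_iff_of_nonneg zero_le_one).2 fun i =>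
      (norm_eq_one_of_inner (hx.norm_one i)).le⟩

variable [DecidableEq V] (G : DirectedNetwork V)

/-- A buyer is outside A exactly when its rotated vector is separated from `v₀`. The coefficients
give 1 for i ∈ A, j ∉ A, give p/2 for both outside, and cancel when j ∈ A. -/
theorem ieEdgeRevenue_influenceSet (p γ : ℝ) (v₀ : SDPSpace V) (v : V → SDPSpace V) (i j : V)
    (r : Metric.sphere (0 : SDPSpace V) 1) :
    G.ieEdgeRevenue (influenceSet γ v₀ v (r : SDPSpace V)) p i j =
      G.weight i j * p * (1 - p) * ((1 - p / 2) / 2) *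
          sepIndicator (rotate γ v₀ (v i)) (rotate γ v₀ (v j)) r -
        G.weight i j * p * (1 - p) * ((1 - p / 2) / 2) * sepIndicator v₀ (rotate γ v₀ (v i)) r +
        G.weight i j * p * (1 - p) * ((1 + p / 2) / 2) *
          sepIndicator v₀ (rotate γ v₀ (v j)) r := by
  classical
  simp only [ieEdgeRevenue, mem_influenceSet_iff, sepIndicator, Set.indicator_apply, separating,
    Set.mem_ofPred_eq, Pi.one_apply]
  unfold sgn
  split_ifs <;> first | ring1 | simp_all

theorem integrable_ieEdgeRevenue (p γ : ℝ) (v₀ : SDPSpace V) (v : V → SDPSpace V) (i j : V) :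
    Integrable (fun r : Metric.sphere (0 : SDPSpace V) 1 =>
      G.ieEdgeRevenue (influenceSet γ v₀ v (r : SDPSpace V)) p i j)
      (uniformSphere (Fintype.card V + 1)) := by
  simp only [ieEdgeRevenue_influenceSet]
  exact ((integrable_sepIndicator _ _ _).sub (integrable_sepIndicator _ _ _)).add
    (integrable_sepIndicator _ _ _)

theorem expectedEdgeRevenue_eq (p γ : ℝ) {v₀ : SDPSpace V} {v : V → SDPSpace V}
    (h : IsFeasible v₀ v) (i j : V) : expectedEdgeRevenue G p γ v₀ v i j =
      G.weight i j * p * (1 - p) *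
        (((1 - p / 2) * vecAngle (rotate γ v₀ (v i)) (rotate γ v₀ (v j))
            - (1 - p / 2) * vecAngle v₀ (rotate γ v₀ (v i))
            + (1 + p / 2) * vecAngle v₀ (rotate γ v₀ (v j))) /
          (2 * Real.pi)) := by
  have hr := fun i => inner_rotate_self h.norm_zero (h.norm_one i) γ
  simp only [expectedEdgeRevenue, ieEdgeRevenue_influenceSet]
  refine (integral_add ((integrable_sepIndicator _ _ _).sub (integrable_sepIndicator _ _ _))
    (integrable_sepIndicator _ _ _)).trans ?_
  simp only [Pi.sub_apply]
  rw [integral_sub (integrable_sepIndicator _ _ _) (integrable_sepIndicator _ _ _),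
    integral_sepIndicator _ (hr i) (hr j),
    integral_sepIndicator _ h.norm_zero (hr i), integral_sepIndicator _ h.norm_zero (hr j)]
  field_simp

theorem ieRevenue_eq_sum (A : Finset V) (p : ℝ) :
    G.ieRevenue A p = ∑ i, ∑ j, G.ieEdgeRevenue A p i j := by
  rw [Finset.sum_comm, ieRevenue, ← Finset.sum_add_sum_compl A fun j => ∑ i, G.ieEdgeRevenue A p i j,
    Finset.sum_eq_zero (s := A), zero_add, Finset.mul_sum]
  · refine Finset.sum_congr rfl fun j hj => ?_
    rw [Finset.mem_compl] at hj
    -- Absence of loops removes the diagonal term and allows the erased index to be put back.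
    rw [← Finset.sum_add_sum_compl A fun i => G.ieEdgeRevenue A p i j, G.weight_self, zero_add,
      Finset.sum_erase _ (by rw [G.weight_self]; simp), mul_add, Finset.mul_sum, Finset.mul_sum]
    refine congrArg₂ _ (Finset.sum_congr rfl fun i hi => ?_) (Finset.sum_congr rfl fun i hi => ?_)
    · rw [ieEdgeRevenue, if_neg hj, if_pos hi]
    · rw [ieEdgeRevenue, if_neg hj, if_neg (Finset.mem_compl.1 hi)]; ring
  · intro j hj
    exact Finset.sum_eq_zero fun i _ => if_pos hj

theorem expectedRevenue_eq_sum (p γ : ℝ) (v₀ : SDPSpace V) (v : V → SDPSpace V) :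
    expectedRevenue G p γ v₀ v = ∑ i, ∑ j, expectedEdgeRevenue G p γ v₀ v i j := by
  simp only [expectedRevenue, ieRevenue_eq_sum]
  rw [integral_finsetSum _ fun i _ => integrable_finsetSum _ fun j _ =>
    integrable_ieEdgeRevenue G p γ v₀ v i j]
  exact Finset.sum_congr rfl fun i _ =>
    integral_finsetSum _ fun j _ => integrable_ieEdgeRevenue G p γ v₀ v i j

theorem exists_unit (V : Type*) [Fintype V] : ∃ e : SDPSpace V, ⟪e, e⟫ = 1 :=
  ⟨EuclideanSpace.single 0 1, by simp⟩

/-- The solution of the semidefinite program that corresponds to an influence set. -/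
theorem isFeasible_ite {e : SDPSpace V} (he : ⟪e, e⟫ = 1) (A : Finset V) :
    IsFeasible e fun i => if i ∈ A then e else -e := by
  constructor
  · exact he
  all_goals
    intro i
    try intro j
    split_ifs <;> simp only [inner_neg_left, inner_neg_right, he] <;> norm_num

/-- This makes (S1) a relaxation: every influence set is a feasible solution with the same value. -/
theorem sdpObjective_ite {e : SDPSpace V} (he : ⟪e, e⟫ = 1) (A : Finset V) (p : ℝ) :
    G.sdpObjective p e (fun i => if i ∈ A then e else -e) = G.ieRevenue A p := by
  rw [ieRevenue_eq_sum, sdpObjective, Finset.mul_sum]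
  refine Finset.sum_congr rfl fun i _ => ?_
  rw [Finset.mul_sum]
  refine Finset.sum_congr rfl fun j _ => ?_
  rw [ieEdgeRevenue]
  split_ifs <;> simp only [inner_neg_left, inner_neg_right, he] <;> ring

theorem bestIERevenue_le {p : ℝ} {v₀ : SDPSpace V} {v : V → SDPSpace V} (h : G.IsOptimal p v₀ v) :
    G.bestIERevenue p ≤ G.sdpObjective p v₀ v := by
  obtain ⟨e, he⟩ := exists_unit V
  refine Finset.sup'_le _ _ fun A _ => ?_
  rw [← sdpObjective_ite G he A p]
  exact h.2 _ _ (isFeasible_ite he A)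

theorem exists_isOptimal (p : ℝ) : ∃ v₀ v, G.IsOptimal p v₀ v := by
  obtain ⟨e, he⟩ := exists_unit V
  obtain ⟨x, hx, hmax⟩ := (isCompact_feasible (V := V)).exists_isMaxOn
    ⟨(e, fun i => if i ∈ (∅ : Finset V) then e else -e), isFeasible_ite he ∅⟩
    (f := fun x => G.sdpObjective p x.1 x.2)
    (by unfold sdpObjective; exact Continuous.continuousOn (by fun_prop))
  exact ⟨x.1, x.2, hx, fun u₀ u hu => hmax (a := (u₀, u)) hu⟩

theorem le_expectedRevenue {v₀ : SDPSpace V} {v : V → SDPSpace V} (h : IsFeasible v₀ v) :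
    0.9064 * G.sdpObjective (2 / 3) v₀ v ≤ expectedRevenue G (2 / 3) 0.722 v₀ v := by
  rw [expectedRevenue_eq_sum, sdpObjective, Finset.mul_sum, Finset.mul_sum]
  refine Finset.sum_le_sum fun i _ => ?_
  rw [Finset.mul_sum, Finset.mul_sum]
  refine Finset.sum_le_sum fun j _ => ?_
  rw [expectedEdgeRevenue_eq G _ _ h, vecAngle_rotate h.norm_zero, vecAngle_rotate h.norm_zero]
  have hi := cos_vecAngle h.norm_zero (h.norm_one i)
  have hj := cos_vecAngle h.norm_zero (h.norm_one j)
  have key := Certificate.key_inequality (a := vecAngle v₀ (v i)) (b := vecAngle v₀ (v j))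
    ⟨Real.arccos_nonneg _, Real.arccos_le_pi _⟩ ⟨Real.arccos_nonneg _, Real.arccos_le_pi _⟩
    inner_orthDir_le_one (inner_eq_cos_add_sin h.norm_zero (h.norm_one i) (h.norm_one j))
    (by rw [hi, hj]; exact h.triangle₁ i j) (by rw [hi, hj]; exact h.triangle₂ i j)
    (by rw [hi, hj]; exact h.triangle₃ i j) (by rw [hi, hj]; exact h.triangle₄ i j)
  rw [← rotAngle_eq_rot, ← rotAngle_eq_rot, ← inner_rotate h.norm_zero, rotAngle_eq_rot,
    rotAngle_eq_rot, hi, hj] at key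
  change _ ≤ vecAngle (rotate 0.722 v₀ (v i)) (rotate 0.722 v₀ (v j)) at key
  generalize vecAngle (rotate 0.722 v₀ (v i)) (rotate 0.722 v₀ (v j)) = φ at *
  generalize Certificate.rot (vecAngle v₀ (v i)) = A at *
  generalize Certificate.rot (vecAngle v₀ (v j)) = B at *
  generalize ⟪v₀, v i⟫ = x at *
  generalize ⟪v₀, v j⟫ = y at *
  generalize ⟪v i, v j⟫ = z at *
  -- For p = 2/3 the coefficients 1 - p/2 and 1 + p/2 are in the ratio 1 : 2, and 0.4532 is half of
  -- 0.9064.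
  have hk : 4532 / 10000 * (2 + x - 2 * y - z) ≤ (φ - A + 2 * B) / Real.pi := by
    rw [le_div_iff₀ Real.pi_pos]
    unfold Certificate.kap at key
    linarith
  have e : ((1 - 2 / 3 / 2) * φ - (1 - 2 / 3 / 2) * A + (1 + 2 / 3 / 2) * B) / (2 * Real.pi) =
      1 / 3 * ((φ - A + 2 * B) / Real.pi) := by
    field_simp
    ring
  rw [e]
  linarith [mul_le_mul_of_nonneg_left hk (G.weight_nonneg i j)]

end SDPIE

end

theorem mainTheorem6 {V : Type*} [Fintype V] [DecidableEq V] (G : DirectedNetwork V) :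
    (∀ p : ℝ, 1 / 2 ≤ p → p < 1 →
      (∃ v₀ v, G.IsOptimal p v₀ v) ∧
      ∀ γ : ℝ, 0 ≤ γ → γ ≤ 1 → ∀ v₀ v, G.IsOptimal p v₀ v → ∀ i j : V,
        SDPIE.expectedEdgeRevenue G p γ v₀ v i j =
          G.weight i j * p * (1 - p) *
            (((1 - p / 2) *
                  SDPIE.vecAngle (SDPIE.rotate γ v₀ (v i)) (SDPIE.rotate γ v₀ (v j))
                - (1 - p / 2) * SDPIE.vecAngle v₀ (SDPIE.rotate γ v₀ (v i))
                + (1 + p / 2) * SDPIE.vecAngle v₀ (SDPIE.rotate γ v₀ (v j))) /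
              (2 * Real.pi))) ∧
    (∀ v₀ v, G.IsOptimal (2 / 3) v₀ v →
      0.9064 * G.bestIERevenue (2 / 3) ≤ SDPIE.expectedRevenue G (2 / 3) 0.722 v₀ v) :=
  ⟨fun p _ _ => ⟨SDPIE.exists_isOptimal G p, fun γ _ _ _ _ h i j =>
      SDPIE.expectedEdgeRevenue_eq G p γ h.1 i j⟩,
    fun _ _ h => (mul_le_mul_of_nonneg_left (SDPIE.bestIERevenue_le G h) (by norm_num)).trans
      (SDPIE.le_expectedRevenue G h.1)⟩
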